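/- Let $N\in\{2,3\}$, $1+\frac{2N}{N+2}\le p<\infty$, $T>0$, let $Q\subset\mathbb{R}^N$ be a bounded smooth domain and $Q_T=Q\times(0,T)$. Let $\mathcal V=\{\varphi\in\mathcal C_0^\infty(Q)^N:\operatorname{div}\varphi=0\}$, let $\mathbb V$ be the closure of $\mathcal V$ in $W^{1,p}(Q)^N$ and $\mathbb H$ the closure of $\mathcal V$ in $L^2(Q)^N$. Assume: (A1) $a=(a_{ij})\in L^\infty(\mathbb{R}^{N+1})^{N\times N}$ is symmetric and, for some $\nu_0>0$, $(a(y,\tau)\lambda)\cdot\lambda\ge\nu_0|\lambda|^2$ for all $\lambda\in\mathbb{R}^N$ and a.e. $(y,\tau)\in\mathbb{R}^{N}\times\mathbb{R}$; (A2) $b\in L^\infty(\mathbb{R}^{N+1})$ and $\nu_1\le b\le\nu_2$ a.e. for some $\nu_1,\nu_2>0$; (A3) $\rho\in L^\infty(\mathbb{R}^N)$ and $\Lambda^{-1}\le\rho\le\Lambda$ a.e. for some $\Lambda>0$; (A4) $f:\mathbb{R}\times\mathbb{R}^N\to\mathbb{R}^N$ is continuous, $(\tau,w)\mapsto f(\tau,w(\cdot))$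 maps $\mathbb{R}\times\mathbb H$ continuously into $\mathbb H$, and for some $k>0$ one has $|f(\tau,0)|\le k$ and $|f(\tau,r_1)-f(\tau,r_2)|\le k|r_1-r_2|$ for all $\tau\in\mathbb{R}$, $r_1,r_2\in\mathbb{R}^N$. Let $u^0\in\mathbb H$. For $\varepsilon>0$ put $\rho^\varepsilon(x)=\rho(x/\varepsilon)$, $a^\varepsilon(x,t)=a(x/\varepsilon,t/\varepsilon^2)$, $b^\varepsilon(x,t)=b(x/\varepsilon,t/\varepsilon^2)$, and let $u_\varepsilon\in L^p(0,T;\mathbb V)\cap L^\infty(0,T;\mathbb H)$ be the velocity field of a weak solution of $$\rho^\varepsilon\frac{\partial u_\varepsilon}{\partial t}-\operatorname{div}\left(a^\varepsilon\nabla u_\varepsilon+b^\varepsilon|\nabla u_\varepsilon|^{p-2}\nabla u_\varepsilon\right)+(u_\varepsilon\cdot\nabla)u_\varepsilon+\nabla q_\varepsilon=\rho^\varepsilon f\left(\tfrac{t}{\varepsilon^2},u_\varepsilon\right),\quad \operatorname{div}u_\varepsilon=0\ \text{ in }Q_T,$$ $u_\varepsilon=0$ on $\partial Q\times(0,T)$,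 $u_\varepsilon(\cdot,0)=u^0$ in $Q$; that is, for every $v\in\mathbb V$ and a.e. $t\in(0,T)$, $$\int_Q\rho^\varepsilon u_\varepsilon(t)\cdot v\,dx+\int_0^t\!\int_Q\Big[(a^\varepsilon\nabla u_\varepsilon+b^\varepsilon|\nabla u_\varepsilon|^{p-2}\nabla u_\varepsilon)\cdot\nabla v+(u_\varepsilon\cdot\nabla)u_\varepsilon\cdot v\Big]dx\,ds=\int_Q\rho^\varepsilon u^0\cdot v\,dx+\int_0^t\!\int_Q\rho^\varepsilon f\left(\tfrac{s}{\varepsilon^2},u_\varepsilon\right)\cdot v\,dx\,ds.$$ Then the family $(u_\varepsilon)_{\varepsilon>0}$ is contained in $L^2(Q_T)^N$ and relatively compact there, i.e. the set $\{u_\varepsilon:\varepsilon>0\}$ has compact closure in $L^2(Q_T)^N$. -/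

import Mathlib

open MeasureTheory Filter Topology Set
open scoped ENNReal NNReal ContDiff

noncomputable section

namespace Ladyzhenskaya

/-- Points of `ℝ^N`, and values of vector fields, with the Euclidean norm. -/
abbrev Vec (N : ℕ) : Type := EuclideanSpace ℝ (Fin N)

/-- Values of gradients of vector fields. The entry `(i, j)` stands for `∂ u_j / ∂ x_i`; the norm and
the inner product are the Euclidean (Frobenius) ones. -/
abbrev Grad (N : ℕ) : Type := EuclideanSpace ℝ (Fin N × Fin N)

/-- A bounded smooth domain: a nonempty connected bounded open set which near each of its boundary
points is a strict sublevel set of a smooth function with nonvanishing differential there. -/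
structure IsBoundedSmoothDomain {N : ℕ} (Q : Set (Vec N)) : Prop where
  isOpen : IsOpen Q
  isConnected : IsConnected Q
  isBounded : Bornology.IsBounded Q
  smooth_boundary : ∀ x ∈ frontier Q, ∃ (U : Set (Vec N)) (g : Vec N → ℝ),
    IsOpen U ∧ x ∈ U ∧ ContDiff ℝ ∞ g ∧ fderiv ℝ g x ≠ 0 ∧ Q ∩ U = {y ∈ U | g y < 0}

/-- The space-time cylinder `Q_T = Q × (0, T)`. -/
def cylinder {N : ℕ} (Q : Set (Vec N)) (T : ℝ) : Set (Vec N × ℝ) := Q ×ˢ Ioo 0 T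

/-- The classical partial derivative `∂ φ_j / ∂ x_i` at `x`. -/
def partialDeriv {N : ℕ} (φ : Vec N → Vec N) (i j : Fin N) (x : Vec N) : ℝ :=
  (fderiv ℝ φ x (EuclideanSpace.single i 1)) j

/-- The classical gradient of a vector field. -/
def grad {N : ℕ} (φ : Vec N → Vec N) (x : Vec N) : Grad N :=
  WithLp.toLp 2 (fun ij : Fin N × Fin N => partialDeriv φ ij.1 ij.2 x)

/-- The space `𝒱` of smooth divergence-free vector fields with compact support in `Q`. -/
structure IsSolenoidalTest {N : ℕ} (Q : Set (Vec N)) (φ : Vec N → Vec N) : Prop where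
  smooth : ContDiff ℝ ∞ φ
  compactSupport : HasCompactSupport φ
  support_subset : tsupport φ ⊆ Q
  divergence_free : ∀ x, ∑ i, partialDeriv φ i i x = 0

/-- `v` belongs to `ℍ`, the closure of `𝒱` in `L²(Q)^N`. -/
def MemH {N : ℕ} (Q : Set (Vec N)) (v : Vec N → Vec N) : Prop :=
  MemLp v 2 (volume.restrict Q) ∧
    ∃ φ : ℕ → Vec N → Vec N, (∀ n, IsSolenoidalTest Q (φ n)) ∧
      Tendsto (fun n => eLpNorm (φ n - v) 2 (volume.restrict Q)) atTop (𝓝 0)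

/-- `v` belongs to `𝕍`, the closure of `𝒱` in `W^{1,p}(Q)^N`, and `G` is its weak gradient: some
sequence in `𝒱` converges to `v` in `L^p` while its gradients converge to `G` in `L^p`. (Passing to
the limit in the integration by parts formula, such a `G` is the weak gradient of `v`, so that this
is convergence in `W^{1,p}(Q)^N`; in particular `G` is determined by `v` almost everywhere.) -/
def MemV {N : ℕ} (Q : Set (Vec N)) (p : ℝ) (v : Vec N → Vec N) (G : Vec N → Grad N) : Prop :=
  MemLp v (ENNReal.ofReal p) (volume.restrict Q) ∧
  MemLp G (ENNReal.ofReal p) (volume.restrict Q) ∧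
    ∃ φ : ℕ → Vec N → Vec N, (∀ n, IsSolenoidalTest Q (φ n)) ∧
      Tendsto (fun n => eLpNorm (φ n - v) (ENNReal.ofReal p) (volume.restrict Q)) atTop (𝓝 0) ∧
      Tendsto (fun n => eLpNorm (grad (φ n) - G) (ENNReal.ofReal p) (volume.restrict Q))
        atTop (𝓝 0)

/-- `u` belongs to `L^p(0,T; 𝕍)`, with spatial gradient `Du`. -/
structure MemLpV {N : ℕ} (Q : Set (Vec N)) (T p : ℝ) (u : Vec N × ℝ → Vec N)
    (Du : Vec N × ℝ → Grad N) : Prop where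
  memLp : MemLp u (ENNReal.ofReal p) (volume.restrict (cylinder Q T))
  memLp_grad : MemLp Du (ENNReal.ofReal p) (volume.restrict (cylinder Q T))
  memV : ∀ᵐ t ∂(volume.restrict (Ioo 0 T)), MemV Q p (fun x => u (x, t)) (fun x => Du (x, t))

/-- `u` belongs to `L^∞(0,T; ℍ)`. -/
structure MemLinftyH {N : ℕ} (Q : Set (Vec N)) (T : ℝ) (u : Vec N × ℝ → Vec N) : Prop where
  aestronglyMeasurable : AEStronglyMeasurable u (volume.restrict (cylinder Q T))
  memH : ∀ᵐ t ∂(volume.restrict (Ioo 0 T)), MemH Q (fun x => u (x, t))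
  bounded : ∃ C : ℝ≥0, ∀ᵐ t ∂(volume.restrict (Ioo 0 T)),
    eLpNorm (fun x => u (x, t)) 2 (volume.restrict Q) ≤ C

/-- The matrix `a` has entries in `L^∞(ℝ^{N+1})`, is symmetric, and is uniformly coercive. -/
structure IsAdmissibleMatrix {N : ℕ} (a : Vec N × ℝ → Matrix (Fin N) (Fin N) ℝ) : Prop where
  memLp : ∀ i j, MemLp (fun z => a z i j) ∞ volume
  symm : ∀ᵐ z, ∀ i j, a z i j = a z j i
  coercive : ∃ ν₀ : ℝ, 0 < ν₀ ∧
    ∀ᵐ z, ∀ l : Vec N, ν₀ * ‖l‖ ^ 2 ≤ ∑ i, ∑ j, a z i j * l j * l i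

/-- The function `b` belongs to `L^∞(ℝ^{N+1})` and lies between two positive constants. -/
structure IsAdmissibleViscosity {N : ℕ} (b : Vec N × ℝ → ℝ) : Prop where
  memLp : MemLp b ∞ volume
  bounds : ∃ ν₁ ν₂ : ℝ, 0 < ν₁ ∧ 0 < ν₂ ∧ ∀ᵐ z, ν₁ ≤ b z ∧ b z ≤ ν₂

/-- The density `ρ` belongs to `L^∞(ℝ^N)` and satisfies `Λ⁻¹ ≤ ρ ≤ Λ` for some `Λ > 0`. -/
structure IsAdmissibleDensity {N : ℕ} (ρ : Vec N → ℝ) : Prop where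
  memLp : MemLp ρ ∞ volume
  bounds : ∃ L : ℝ, 0 < L ∧ ∀ᵐ y, L⁻¹ ≤ ρ y ∧ ρ y ≤ L

/-- The force `f : ℝ × ℝ^N → ℝ^N` is continuous, maps `ℝ × ℍ` continuously into `ℍ` (by composition),
is bounded at `r = 0`, and is Lipschitz in `r`, uniformly in time. -/
structure IsAdmissibleForce {N : ℕ} (Q : Set (Vec N)) (f : ℝ → Vec N → Vec N) : Prop where
  continuous : Continuous (fun z : ℝ × Vec N => f z.1 z.2)
  maps_H : ∀ (τ : ℝ) (w : Vec N → Vec N), MemH Q w → MemH Q (fun x => f τ (w x))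
  continuous_H : ∀ (τ : ℕ → ℝ) (τ₀ : ℝ) (w : ℕ → Vec N → Vec N) (w₀ : Vec N → Vec N),
    (∀ n, MemH Q (w n)) → MemH Q w₀ → Tendsto τ atTop (𝓝 τ₀) →
    Tendsto (fun n => eLpNorm (w n - w₀) 2 (volume.restrict Q)) atTop (𝓝 0) →
    Tendsto (fun n => eLpNorm (fun x => f (τ n) (w n x) - f τ₀ (w₀ x)) 2 (volume.restrict Q))
      atTop (𝓝 0)
  lipschitz : ∃ k : ℝ, 0 < k ∧ (∀ τ, ‖f τ 0‖ ≤ k) ∧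
    ∀ τ r₁ r₂, ‖f τ r₁ - f τ r₂‖ ≤ k * ‖r₁ - r₂‖

/-- `(u, v)_ε = ∫_Q ρ(x/ε) u · v dx`. -/
def rhoInner {N : ℕ} (Q : Set (Vec N)) (ρ : Vec N → ℝ) (ε : ℝ) (u v : Vec N → Vec N) : ℝ :=
  ∫ x in Q, ρ (ε⁻¹ • x) * inner ℝ (u x) (v x)

/-- `a_I^ε(t; u, v) = ∫_Q (a^ε ∇u) · ∇v dx + ∫_Q b^ε |∇u|^{p-2} ∇u · ∇v dx` where `G`, `H` are the
gradients of `u`, `v` and `a^ε`, `b^ε` are evaluated at `(x/ε, t/ε²)`. -/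
def aForm {N : ℕ} (Q : Set (Vec N)) (a : Vec N × ℝ → Matrix (Fin N) (Fin N) ℝ) (b : Vec N × ℝ → ℝ)
    (p ε t : ℝ) (G H : Vec N → Grad N) : ℝ :=
  (∫ x in Q, ∑ k, ∑ i, ∑ j, a (ε⁻¹ • x, t / ε ^ 2) i j * G x (j, k) * H x (i, k)) +
    ∫ x in Q, b (ε⁻¹ • x, t / ε ^ 2) * ‖G x‖ ^ (p - 2) * inner ℝ (G x) (H x)

/-- `b_I(u, v, w) = ∑_{i,j} ∫_Q u_i (∂ v_j / ∂ x_i) w_j dx`, where `G` is the gradient of `v`. -/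
def bForm {N : ℕ} (Q : Set (Vec N)) (u : Vec N → Vec N) (G : Vec N → Grad N)
    (w : Vec N → Vec N) : ℝ :=
  ∑ i, ∑ j, ∫ x in Q, u x i * G x (i, j) * w x j

/-- `u` is the velocity field of a weak solution, in `L^p(0,T; 𝕍) ∩ L^∞(0,T; ℍ)`, of
`ρ^ε ∂_t u - div (a^ε ∇u + b^ε |∇u|^{p-2} ∇u) + (u · ∇) u + ∇q = ρ^ε f(t/ε², u)` and `div u = 0` in
`Q_T`, `u = 0` on `∂Q × (0,T)`, `u(0) = u⁰`. The equation is tested with elements `v` of `𝕍`, which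
eliminates the pressure, and integrated over `(0, t)`. -/
def IsVelocitySolution {N : ℕ} (Q : Set (Vec N)) (T p : ℝ) (ρ : Vec N → ℝ)
    (a : Vec N × ℝ → Matrix (Fin N) (Fin N) ℝ) (b : Vec N × ℝ → ℝ) (f : ℝ → Vec N → Vec N)
    (u₀ : Vec N → Vec N) (ε : ℝ) (u : Vec N × ℝ → Vec N) : Prop :=
  MemLinftyH Q T u ∧
  ∃ Du : Vec N × ℝ → Grad N, MemLpV Q T p u Du ∧
    ∀ (v : Vec N → Vec N) (Dv : Vec N → Grad N), MemV Q p v Dv →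
      ∀ᵐ t ∂(volume.restrict (Ioo 0 T)),
        rhoInner Q ρ ε (fun x => u (x, t)) v +
            ∫ s in (0 : ℝ)..t,
              (aForm Q a b p ε s (fun x => Du (x, s)) Dv +
                bForm Q (fun x => u (x, s)) (fun x => Du (x, s)) v) =
          rhoInner Q ρ ε u₀ v +
            ∫ s in (0 : ℝ)..t, rhoInner Q ρ ε (fun x => f (s / ε ^ 2) (u (x, s))) v

end Ladyzhenskaya

end

/-! Extended by zero outside `Q_T`, the velocities are shown to be bounded in `L²(ℝ^{N+1})` and
equicontinuous there under translations; the Kolmogorov–Riesz criterion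
(`isCompact_closure_range_toLp`) then gives compactness. The coefficients enter only through their
bounds and ellipticity constants, which the rescaling `(x/ε, t/ε²)` does not change. So every `u_ε`
is an instance of one abstract problem, `IsEvolution`, with constants independent of `ε`: a velocity
`U` with gradient `DU`, a force `F` (convection minus the external force), a stress `G` and a
density `r` between `L⁻¹` and `L`.

The lower bound on `p` is what puts the convective term in duality with the velocity. By
Gagliardo–Nirenberg interpolation (`exists_sobolev_const`), `U ∈ L^∞(L²)` together with `DU ∈
L^{critExp}` gives `U ∈ L^{velExp}` in space-time. Hölder then puts `(U·∇)U` in `L^{convExp}`, whose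
dual exponent is `velExp`. Hence a solution and its time increments may be used as test fields, and
the convective term does no work on the solution.

The equation is given only for test fields constant in time, each with its own null set of times.
Separability of `𝕍` makes the null set common to all test fields
(`EvolutionData.ae_forall_weakIdentity`). Subtracting the identities at `t` and `t - η` gives a
formula for the increment of `U`, tested with any element of `𝕍` (`ae_increment`).

Testing the increment with `U(t)`, integrating in `t`, dividing by `η` and letting `η → 0` yields
the energy inequality (`ae_energy_le`); the limit uses only continuity of translations in `L^p` and
Lebesgue differentiation, so no time derivative of `U` is needed. Coercivity and a Gronwall argument
turn it into bounds for `U` in `L^∞(L²)` and `DU` in `L^p` that depend only on the constants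
(`exists_uniform_bound`).

Testing the increment with itself bounds its weighted `L²` norm by the work of the forces over a
time `η`. After integration in `t` this is `O(η)`, so `‖U(·) - U(· - η)‖² ≤ Cη` in `L²`
(`eLpNorm_timeDiff_sq_le`). The density stays inside the quadratic form, where only its two-sided
bounds matter; its oscillation is harmless. Space translations are controlled by the gradient
(`eLpNorm_spaceShift_le`). -/

noncomputable section

namespace Ladyzhenskaya

/-! ### The Kolmogorov–Riesz criterion in `L²`. -/

section Kolmogorov

variable {E F ι : Type*} [NormedAddCommGroup E] [NormedSpace ℝ E] [FiniteDimensional ℝ E]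
  [MeasurableSpace E] [BorelSpace E] [NormedAddCommGroup F] [NormedSpace ℝ F]

/-- The square of an integral is controlled by the integral of the square. -/
theorem sq_lintegral_le {α : Type*} [MeasurableSpace α] (μ : Measure α) {g : α → ℝ≥0∞}
    (hg : AEMeasurable g μ) :
    (∫⁻ x, g x ∂μ) ^ 2 ≤ μ univ * ∫⁻ x, g x ^ 2 ∂μ := by
  have h := ENNReal.lintegral_mul_le_Lp_mul_Lq μ Real.HolderConjugate.two_two
    (aemeasurable_const (b := (1 : ℝ≥0∞))) hg
  simp only [Pi.mul_apply, one_mul, ENNReal.one_rpow, lintegral_const] at h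
  calc (∫⁻ x, g x ∂μ) ^ 2
      ≤ (μ univ ^ (1 / (2:ℝ)) * (∫⁻ x, g x ^ (2:ℝ) ∂μ) ^ (1 / (2:ℝ))) ^ 2 := by gcongr
    _ = μ univ * ∫⁻ x, g x ^ 2 ∂μ := by
      rw [mul_pow, ← ENNReal.rpow_natCast, ← ENNReal.rpow_natCast, ← ENNReal.rpow_mul,
        ← ENNReal.rpow_mul]
      simp

theorem eLpNorm_two_sq {α G : Type*} [MeasurableSpace α] [NormedAddCommGroup G] (μ : Measure α)
    (g : α → G) : eLpNorm g 2 μ ^ 2 = ∫⁻ x, ‖g x‖ₑ ^ 2 ∂μ := by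
  have := eLpNorm_nnreal_pow_eq_lintegral (μ := μ) (f := g) (p := 2) (by simp)
  simpa using this

/-- An `L²` function is approximated by a step function built from its averages over balls, with an
error controlled by its translations. -/
theorem lintegral_sub_average_le [MeasurableSpace F] [BorelSpace F] [CompleteSpace F]
    [SecondCountableTopology F] (μ : Measure E) [μ.IsAddHaarMeasure]
    {f : E → F} (hf : Measurable f) (hf2 : MemLp f 2 μ) {S : Set E} {δ : ℝ} (hδ : 0 < δ)
    {e : E → E} (he : ∀ x ∈ S, dist (e x) x < δ) (hS : MeasurableSet S) {η : ℝ≥0∞}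
    (htr : ∀ z, ‖z‖ < 2 * δ → eLpNorm (fun x => f (x + z) - f x) 2 μ ≤ η) :
    ∫⁻ x in S, ‖f x - ⨍ y in Metric.ball (e x) δ, f y ∂μ‖ₑ ^ 2 ∂μ
      ≤ (μ (Metric.ball 0 δ))⁻¹ * (μ (Metric.ball 0 (2 * δ)) * η ^ 2) := by
  set m := μ (Metric.ball 0 δ) with hm
  have hm0 : m ≠ 0 := (Metric.measure_ball_pos μ 0 hδ).ne'
  have hmt : m ≠ ⊤ := measure_ball_lt_top.ne
  have hball : ∀ x, μ (Metric.ball x δ) = m := fun x => Measure.addHaar_ball_center μ x δ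
  have hloc : LocallyIntegrable f μ := hf2.locallyIntegrable (by norm_num)
  have hint : ∀ x, IntegrableOn f (Metric.ball x δ) μ := fun x =>
    (hloc.integrableOn_isCompact (isCompact_closedBall x δ)).mono_set Metric.ball_subset_closedBall
  -- Cauchy–Schwarz for the average of `f x - f y`, then enlargement of the ball: as `e x` is within
  -- `δ` of `x`, the ball about `e x` of radius `δ` lies in the ball about `x` of radius `2δ`.
  have key : ∀ x ∈ S, ‖f x - ⨍ y in Metric.ball (e x) δ, f y ∂μ‖ₑ ^ 2
      ≤ m⁻¹ * ∫⁻ z in Metric.ball (0 : E) (2 * δ), ‖f (x + z) - f x‖ₑ ^ 2 ∂μ := by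
    intro x hx
    have h1 : f x - ⨍ y in Metric.ball (e x) δ, f y ∂μ
        = ⨍ y in Metric.ball (e x) δ, (f x - f y) ∂μ := by
      rw [setAverage_eq, setAverage_eq, integral_sub _ (hint _), smul_sub]
      · congr 1
        simp only [integral_const, measureReal_restrict_apply_univ, smul_smul]
        rw [inv_mul_cancel₀, one_smul]
        simp [measureReal_def, hball, ENNReal.toReal_eq_zero_iff, hm0, hmt]
      · simp [hball, hmt.lt_top, isFiniteMeasure_iff]
    have h2 : ‖⨍ y in Metric.ball (e x) δ, (f x - f y) ∂μ‖ₑ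
        ≤ m⁻¹ * ∫⁻ y in Metric.ball (e x) δ, ‖f y - f x‖ₑ ∂μ := by
      rw [setAverage_eq, enorm_smul]
      gcongr
      · simp only [measureReal_def, hball]
        rw [Real.enorm_of_nonneg (by positivity), ENNReal.ofReal_inv_of_pos
          (ENNReal.toReal_pos hm0 hmt), ENNReal.ofReal_toReal hmt]
      · refine (enorm_integral_le_lintegral_enorm _).trans (le_of_eq ?_)
        simp_rw [enorm_sub_rev]
    rw [h1]
    calc _ ≤ (m⁻¹ * ∫⁻ y in Metric.ball (e x) δ, ‖f y - f x‖ₑ ∂μ) ^ 2 := by gcongr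
      _ = m⁻¹ ^ 2 * (∫⁻ y in Metric.ball (e x) δ, ‖f y - f x‖ₑ ∂μ) ^ 2 := mul_pow _ _ _
      _ ≤ m⁻¹ ^ 2 * (m * ∫⁻ y in Metric.ball (e x) δ, ‖f y - f x‖ₑ ^ 2 ∂μ) := by
        gcongr
        refine (sq_lintegral_le _ ?_).trans ?_
        · exact ((hf.sub_const _).enorm).aemeasurable
        · simp [hball]
      _ = m⁻¹ * ∫⁻ y in Metric.ball (e x) δ, ‖f y - f x‖ₑ ^ 2 ∂μ := by
        rw [pow_two, ← mul_assoc, mul_assoc m⁻¹ m⁻¹ m, ENNReal.inv_mul_cancel hm0 hmt, mul_one]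
      _ ≤ m⁻¹ * ∫⁻ y in Metric.ball x (2 * δ), ‖f y - f x‖ₑ ^ 2 ∂μ := by
        gcongr
        intro y hy
        have h3 := he x hx
        rw [Metric.mem_ball] at hy ⊢
        linarith [dist_triangle y (e x) x]
      _ = _ := by
        congr 1
        have h4 : Metric.ball (0 : E) (2 * δ) = (fun z => x + z) ⁻¹' Metric.ball x (2 * δ) := by
          ext z; simp [Metric.mem_ball, dist_eq_norm]
        rw [h4, (measurePreserving_add_left μ x).setLIntegral_comp_preimage measurableSet_ball
          ((hf.sub_const _).enorm.pow_const 2)]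
  calc _ ≤ ∫⁻ x in S, m⁻¹ * ∫⁻ z in Metric.ball (0 : E) (2 * δ), ‖f (x + z) - f x‖ₑ ^ 2 ∂μ ∂μ :=
        setLIntegral_mono' hS key
    _ ≤ ∫⁻ x, m⁻¹ * ∫⁻ z in Metric.ball (0 : E) (2 * δ), ‖f (x + z) - f x‖ₑ ^ 2 ∂μ ∂μ :=
        setLIntegral_le_lintegral _ _
    _ = m⁻¹ * ∫⁻ x, ∫⁻ z in Metric.ball (0 : E) (2 * δ), ‖f (x + z) - f x‖ₑ ^ 2 ∂μ ∂μ := by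
        rw [lintegral_const_mul' _ _ (ENNReal.inv_ne_top.2 hm0)]
    _ = m⁻¹ * ∫⁻ z in Metric.ball (0 : E) (2 * δ), ∫⁻ x, ‖f (x + z) - f x‖ₑ ^ 2 ∂μ ∂μ := by
        rw [lintegral_lintegral_swap]
        refine Measurable.aemeasurable ?_
        simp only [Function.uncurry_def]
        fun_prop
    _ ≤ m⁻¹ * ∫⁻ z in Metric.ball (0 : E) (2 * δ), η ^ 2 ∂μ := by
        refine mul_le_mul_right ?_ _
        refine setLIntegral_mono' measurableSet_ball fun z hz => ?_
        rw [← eLpNorm_two_sq]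
        have := htr z (by simpa using hz)
        gcongr
    _ = _ := by rw [setLIntegral_const, mul_comm (η ^ 2)]

/-- **Kolmogorov–Riesz**: a family which is bounded in `L²` and equicontinuous in `L²` under
translations is relatively compact in `L²` on bounded sets. -/
theorem isCompact_closure_range_toLp [FiniteDimensional ℝ F] [MeasurableSpace F] [BorelSpace F]
    (μ : Measure E) [μ.IsAddHaarMeasure] {f : ι → E → F} (hf : ∀ i, Measurable (f i))
    {R : ℝ≥0∞} (hR : R ≠ ⊤) (hfR : ∀ i, eLpNorm (f i) 2 μ ≤ R)
    {S : Set E} (hS : Bornology.IsBounded S) (hSm : MeasurableSet S)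
    (htr : ∀ η : ℝ≥0∞, η ≠ 0 → ∃ δ : ℝ, 0 < δ ∧ ∀ i, ∀ z, ‖z‖ < δ →
      eLpNorm (fun x => f i (x + z) - f i x) 2 μ ≤ η)
    (hL : ∀ i, MemLp (f i) 2 (μ.restrict S)) :
    IsCompact (closure (range fun i => (hL i).toLp (f i))) := by
  have : CompleteSpace F := FiniteDimensional.complete ℝ F
  have : ProperSpace F := FiniteDimensional.proper ℝ F
  have : Fact ((1 : ℝ≥0∞) ≤ 2) := ⟨by norm_num⟩
  have hSfin : μ S < ⊤ := hS.measure_lt_top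
  have : IsFiniteMeasure (μ.restrict S) := ⟨by simpa using hSfin⟩
  refine isCompact_iff_totallyBounded_isComplete.2 ⟨TotallyBounded.closure ?_,
    isClosed_closure.isComplete⟩
  rw [Metric.totallyBounded_iff]
  intro ε hε
  -- The ratio of the measures of balls of radii `2δ` and `δ`, which is the loss in the averaging
  -- estimate.
  set K : ℝ≥0∞ := ENNReal.ofReal (2 ^ Module.finrank ℝ E) with hK
  have hK0 : K ≠ 0 := by simp [hK]
  have hKt : K ≠ ⊤ := ENNReal.ofReal_ne_top
  obtain ⟨η, hη0, hη⟩ : ∃ η : ℝ≥0∞, η ≠ 0 ∧ K * η ^ 2 ≤ ENNReal.ofReal (ε / 4) ^ 2 := by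
    refine ⟨ENNReal.ofReal (ε / 4 / √(2 ^ Module.finrank ℝ E)), ?_, ?_⟩
    · simp only [ne_eq, ENNReal.ofReal_eq_zero, not_le]; positivity
    · rw [hK, ← ENNReal.ofReal_pow (by positivity), ← ENNReal.ofReal_mul (by positivity),
        ← ENNReal.ofReal_pow (by positivity)]
      refine ENNReal.ofReal_le_ofReal (le_of_eq ?_)
      rw [div_pow, Real.sq_sqrt (by positivity)]
      field_simp
  obtain ⟨δ', hδ', hδtr⟩ := htr η hη0
  -- The averaging estimate sees translations of length up to `2δ`.
  set δ := δ' / 2 with hδdef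
  have hδ : 0 < δ := by positivity
  obtain ⟨n, hn⟩ : ∃ n : ℕ, S ⊆ ⋃ k ∈ Finset.range (n + 1),
      Metric.ball (TopologicalSpace.denseSeq E k) δ := by
    have hc : IsCompact (closure S) := hS.isCompact_closure
    obtain ⟨t, ht⟩ := hc.elim_finite_subcover
      (fun k => Metric.ball (TopologicalSpace.denseSeq E k) δ) (fun _ => Metric.isOpen_ball) (by
        intro x _
        obtain ⟨k, hk⟩ := (TopologicalSpace.denseRange_denseSeq E).exists_dist_lt x hδ
        exact mem_iUnion.2 ⟨k, hk⟩)
    refine ⟨t.sup id, fun x hx => ?_⟩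
    obtain ⟨k, hk, hxk⟩ := mem_iUnion₂.1 (ht (subset_closure hx))
    exact mem_iUnion₂.2 ⟨k, Finset.mem_range.2 (Nat.lt_succ_of_le (Finset.le_sup (f := id) hk)),
      hxk⟩
  -- Rounding to the nearest of finitely many points gives a measurable partition of `S` into cells
  -- of radius less than `δ`, the same for every member of the family.
  set ind := SimpleFunc.nearestPtInd (TopologicalSpace.denseSeq E) n with hind
  have hindle : ∀ x, ind x < n + 1 := fun x =>
    Nat.lt_succ_of_le (SimpleFunc.nearestPtInd_le _ _ x)
  set e : E → E := fun x => TopologicalSpace.denseSeq E (ind x) with he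
  have hedist : ∀ x ∈ S, dist (e x) x < δ := by
    intro x hx
    obtain ⟨k, hk, hxk⟩ := mem_iUnion₂.1 (hn hx)
    have := SimpleFunc.edist_nearestPt_le (TopologicalSpace.denseSeq E) x
      (Nat.lt_succ_iff.1 (Finset.mem_range.1 hk))
    have h2 : edist (e x) x ≤ edist (TopologicalSpace.denseSeq E k) x := this
    rw [edist_dist, edist_dist, ENNReal.ofReal_le_ofReal_iff dist_nonneg] at h2
    exact h2.trans_lt (by rw [dist_comm]; exact hxk)
  -- the step functions
  have hmeas : ∀ c : Fin (n + 1) → F, Measurable fun x => c ⟨ind x, hindle x⟩ := by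
    intro c
    have : Measurable fun x => (⟨ind x, hindle x⟩ : Fin (n + 1)) := by
      have h : Measurable fun x => Fin.ofNat (n + 1) (ind x) :=
        (measurable_from_top (f := fun k : ℕ => Fin.ofNat (n + 1) k)).comp ind.measurable
      convert h using 2 with x
      exact Fin.ext (Nat.mod_eq_of_lt (hindle x)).symm
    exact (measurable_of_finite c).comp this
  have hstep : ∀ c : Fin (n + 1) → F, MemLp (fun x => c ⟨ind x, hindle x⟩) 2 (μ.restrict S) :=
    fun c => MemLp.of_bound (hmeas c).aestronglyMeasurable ‖c‖
      (ae_of_all _ fun x => norm_le_pi_norm c _)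
  -- Step functions on this partition depend continuously on finitely many values in `F`, so those
  -- with bounded values form a compact set. Approximating the family by them gives total
  -- boundedness.
  let Φ : (Fin (n + 1) → F) → Lp F 2 (μ.restrict S) := fun c => (hstep c).toLp _
  have hΦ : Continuous Φ := by
    refine LipschitzWith.continuous
      (K := ((μ.restrict S) univ ^ (2 : ℝ≥0∞).toReal⁻¹).toNNReal) fun c d => ?_
    rw [Lp.edist_toLp_toLp, ENNReal.coe_toNNReal
      (ENNReal.rpow_ne_top_of_nonneg (by positivity) (measure_ne_top _ _)), edist_nndist]
    have hb := eLpNorm_le_of_ae_nnnorm_bound (μ := μ.restrict S) (p := 2)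
      (f := (fun x => c ⟨ind x, hindle x⟩) - fun x => d ⟨ind x, hindle x⟩)
      (C := ‖c - d‖₊) (ae_of_all _ fun x => nnnorm_le_pi_nnnorm (c - d) _)
    simpa [nndist_eq_nnnorm, ENNReal.smul_def, mul_comm] using hb
  set m := μ (Metric.ball 0 δ) with hm
  have hm0 : m ≠ 0 := (Metric.measure_ball_pos μ 0 hδ).ne'
  have hmt : m ≠ ⊤ := measure_ball_lt_top.ne
  -- The Cauchy–Schwarz bound for an average over a ball of measure `m` of a function with `L²` norm
  -- at most `R`.
  set M : ℝ≥0∞ := m⁻¹ * (R * m ^ (1 - 1 / (2:ℝ))) with hM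
  have hMt : M ≠ ⊤ := ENNReal.mul_ne_top (ENNReal.inv_ne_top.2 hm0)
    (ENNReal.mul_ne_top hR (ENNReal.rpow_ne_top_of_nonneg (by norm_num) hmt))
  have havg : ∀ i x, ‖⨍ y in Metric.ball x δ, f i y ∂μ‖ ≤ M.toReal := by
    intro i x
    rw [← toReal_enorm]
    refine ENNReal.toReal_mono hMt ?_
    rw [setAverage_eq, enorm_smul, measureReal_def, Measure.addHaar_ball_center,
      Real.enorm_of_nonneg (by positivity), ENNReal.ofReal_inv_of_pos
          (ENNReal.toReal_pos hm0 hmt), ENNReal.ofReal_toReal hmt, hM]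
    gcongr
    refine (enorm_integral_le_lintegral_enorm _).trans ?_
    rw [← eLpNorm_one_eq_lintegral_enorm]
    refine (eLpNorm_le_eLpNorm_mul_rpow_measure_univ (q := 2) (by norm_num)
      (hf i).aestronglyMeasurable).trans ?_
    simp only [Measure.restrict_apply_univ, Measure.addHaar_ball_center]
    exact mul_le_mul' ((eLpNorm_mono_measure _ Measure.restrict_le_self).trans (hfR i))
      (le_of_eq (by simp [hm]))
  have hcomp : IsCompact (Φ '' Metric.closedBall 0 M.toReal) :=
    (isCompact_closedBall _ _).image hΦ
  obtain ⟨t, htfin, ht⟩ := Metric.totallyBounded_iff.1 hcomp.totallyBounded (ε / 2) (by positivity)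
  refine ⟨t, htfin, ?_⟩
  rintro _ ⟨i, rfl⟩
  set c : Fin (n + 1) → F := fun k =>
    ⨍ y in Metric.ball (TopologicalSpace.denseSeq E k) δ, f i y ∂μ with hc
  have hcM : c ∈ Metric.closedBall 0 M.toReal := by
    rw [mem_closedBall_zero_iff, pi_norm_le_iff_of_nonneg ENNReal.toReal_nonneg]
    exact fun k => havg i _
  obtain ⟨y, hyt, hy⟩ := mem_iUnion₂.1 (ht (mem_image_of_mem Φ hcM))
  refine mem_iUnion₂.2 ⟨y, hyt, ?_⟩
  have hmem2 : MemLp (f i) 2 μ := ⟨(hf i).aestronglyMeasurable, (hfR i).trans_lt hR.lt_top⟩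
  have hd : dist ((hL i).toLp (f i)) (Φ c) ≤ ε / 4 := by
    rw [dist_edist, Lp.edist_toLp_toLp]
    refine ENNReal.toReal_le_of_le_ofReal (by positivity) ?_
    rw [← ENNReal.pow_le_pow_left_iff two_ne_zero, eLpNorm_two_sq]
    refine le_trans ?_ hη
    refine (lintegral_sub_average_le μ (hf i) hmem2 hδ hedist hSm (η := η) ?_).trans ?_
    · intro z hz
      exact hδtr i z (by rw [hδdef] at hz; linarith)
    · have : μ (Metric.ball 0 (2 * δ)) = K * m := by
        rw [hK, hm]
        exact Measure.addHaar_ball_mul_of_pos μ 0 two_pos δ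
      rw [this, mul_comm K m, mul_assoc, ← mul_assoc, ENNReal.inv_mul_cancel hm0 hmt, one_mul]
  rw [Metric.mem_ball] at hy ⊢
  linarith [dist_triangle ((hL i).toLp (f i)) (Φ c) y]

end Kolmogorov

/-! ### Pairings of functions of space and time with a time shift. -/

section Shift

variable {X E : Type*} [MeasurableSpace X] [NormedAddCommGroup E] [InnerProductSpace ℝ E]
  [MeasurableSpace E] [BorelSpace E] [SecondCountableTopology E]

/-- The spatial pairing of the slice of `F` at time `s` with the slice of `w` at time `t`. -/
def pairing (μ : Measure X) (F w : X × ℝ → E) (s t : ℝ) : ℝ :=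
  ∫ x, inner ℝ (F (x, s)) (w (x, t)) ∂μ

theorem measurePreserving_timeShift (μ : Measure X) [SFinite μ] (s : ℝ) :
    MeasurePreserving (fun z : X × ℝ => (z.1, z.2 - s)) (μ.prod volume) (μ.prod volume) :=
  (MeasurePreserving.id μ).prod (measurePreserving_sub_right volume s)

theorem measurable_timeShift : Measurable fun z : (X × ℝ) × ℝ => (z.1.1, z.1.2 - z.2) := by
  fun_prop

variable {μ : Measure X} [SFinite μ] {F w : X × ℝ → E} {p q : ℝ≥0∞}

theorem eLpNorm_timeShift (hF : Measurable F) (s : ℝ) :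
    eLpNorm (fun z : X × ℝ => F (z.1, z.2 - s)) p (μ.prod volume) = eLpNorm F p (μ.prod volume) :=
  eLpNorm_comp_measurePreserving hF.aestronglyMeasurable (measurePreserving_timeShift μ s)

theorem memLp_timeShift (hFp : MemLp F p (μ.prod volume)) (s : ℝ) :
    MemLp (fun z : X × ℝ => F (z.1, z.2 - s)) p (μ.prod volume) :=
  hFp.comp_measurePreserving (measurePreserving_timeShift μ s)

theorem eLpNorm_inner_le [ENNReal.HolderConjugate p q] {α : Type*} [MeasurableSpace α]
    {ν : Measure α} {f g : α → E} (hf : AEStronglyMeasurable f ν) (hg : AEStronglyMeasurable g ν) :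
    eLpNorm (fun z => inner ℝ (f z) (g z)) 1 ν ≤ eLpNorm f p ν * eLpNorm g q ν := by
  have := eLpNorm_le_eLpNorm_mul_eLpNorm'_of_norm (p := p) (q := q) (r := 1) hf hg
    (fun a b : E => inner ℝ a b) 1 (ae_of_all _ fun x => by
      simpa using norm_inner_le_norm (𝕜 := ℝ) (f x) (g x))
  simpa using this

theorem lintegral_inner_timeShift_le [ENNReal.HolderConjugate p q] (hF : Measurable F)
    (hw : Measurable w) (s : ℝ) :
    ∫⁻ z : X × ℝ, ‖(inner ℝ (F (z.1, z.2 - s)) (w z) : ℝ)‖ₑ ∂(μ.prod volume)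
      ≤ eLpNorm F p (μ.prod volume) * eLpNorm w q (μ.prod volume) := by
  rw [← eLpNorm_timeShift (p := p) hF s, ← eLpNorm_one_eq_lintegral_enorm]
  exact eLpNorm_inner_le
    ((hF.comp (measurePreserving_timeShift μ s).measurable).aestronglyMeasurable)
    hw.aestronglyMeasurable

theorem integrable_inner_timeShift [ENNReal.HolderConjugate p q] (hF : Measurable F)
    (hw : Measurable w) (hFp : MemLp F p (μ.prod volume)) (hwq : MemLp w q (μ.prod volume)) (s : ℝ) :
    Integrable (fun z : X × ℝ => (inner ℝ (F (z.1, z.2 - s)) (w z) : ℝ)) (μ.prod volume) := by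
  refine ⟨?_, (lintegral_inner_timeShift_le (p := p) (q := q) hF hw s).trans_lt
    (ENNReal.mul_lt_top hFp.2 hwq.2)⟩
  exact ((hF.comp (measurePreserving_timeShift μ s).measurable).inner hw).aestronglyMeasurable

/-- The Hölder bound for a fixed shift does not depend on the shift, so it can be integrated over a
finite measure of shifts. This is the integrability behind every exchange of the `s` and `t`
integrals below. -/
theorem integrable_inner_timeShift_prod [ENNReal.HolderConjugate p q] (hF : Measurable F)
    (hw : Measurable w) (hFp : MemLp F p (μ.prod volume)) (hwq : MemLp w q (μ.prod volume))
    (ν : Measure ℝ) [IsFiniteMeasure ν] :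
    Integrable (fun z : (X × ℝ) × ℝ => (inner ℝ (F (z.1.1, z.1.2 - z.2)) (w z.1) : ℝ))
      ((μ.prod volume).prod ν) := by
  have hm : Measurable fun z : (X × ℝ) × ℝ => (inner ℝ (F (z.1.1, z.1.2 - z.2)) (w z.1) : ℝ) :=
    (hF.comp measurable_timeShift).inner (hw.comp measurable_fst)
  refine ⟨hm.aestronglyMeasurable, ?_⟩
  rw [HasFiniteIntegral, lintegral_prod_symm' _ hm.enorm]
  refine (lintegral_mono fun s => lintegral_inner_timeShift_le (p := p) (q := q) hF hw s).trans_lt ?_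
  rw [lintegral_const]
  exact ENNReal.mul_lt_top (ENNReal.mul_lt_top hFp.2 hwq.2) (measure_lt_top _ _)

theorem integrable_pairing_timeShift_prod [ENNReal.HolderConjugate p q] (hF : Measurable F)
    (hw : Measurable w) (hFp : MemLp F p (μ.prod volume)) (hwq : MemLp w q (μ.prod volume))
    (ν : Measure ℝ) [IsFiniteMeasure ν] :
    Integrable (fun z : ℝ × ℝ => pairing μ F w (z.1 - z.2) z.1) (volume.prod ν) := by
  have h := integrable_inner_timeShift_prod (p := p) (q := q) hF hw hFp hwq ν
  have h2 := ((measurePreserving_prodAssoc μ (volume : Measure ℝ) ν).symm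
    MeasurableEquiv.prodAssoc).integrable_comp_of_integrable h
  exact h2.integral_prod_right

theorem integrable_pairing_timeShift [ENNReal.HolderConjugate p q] (hF : Measurable F)
    (hw : Measurable w) (hFp : MemLp F p (μ.prod volume)) (hwq : MemLp w q (μ.prod volume)) (s : ℝ) :
    Integrable fun t : ℝ => pairing μ F w (t - s) t :=
  (integrable_inner_timeShift (p := p) (q := q) hF hw hFp hwq s).integral_prod_right

theorem integral_pairing_timeShift [ENNReal.HolderConjugate p q] (hF : Measurable F)
    (hw : Measurable w) (hFp : MemLp F p (μ.prod volume)) (hwq : MemLp w q (μ.prod volume)) (s : ℝ) :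
    ∫ t, pairing μ F w (t - s) t
      = ∫ z : X × ℝ, (inner ℝ (F (z.1, z.2 - s)) (w z) : ℝ) ∂(μ.prod volume) :=
  (integral_prod_symm _ (integrable_inner_timeShift (p := p) (q := q) hF hw hFp hwq s)).symm

/-- Hölder in space-time and translation invariance. The bound is uniform in `s`, so averaging over
`0 < s < η` produces a factor `η`. -/
theorem abs_integral_pairing_timeShift_le [ENNReal.HolderConjugate p q] (hF : Measurable F)
    (hw : Measurable w) (hFp : MemLp F p (μ.prod volume)) (hwq : MemLp w q (μ.prod volume)) (s : ℝ) :
    |∫ t, pairing μ F w (t - s) t|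
      ≤ (eLpNorm F p (μ.prod volume)).toReal * (eLpNorm w q (μ.prod volume)).toReal := by
  rw [integral_pairing_timeShift (p := p) (q := q) hF hw hFp hwq, ← Real.norm_eq_abs,
    ← toReal_enorm, ← ENNReal.toReal_mul]
  exact ENNReal.toReal_mono (ENNReal.mul_lt_top hFp.2 hwq.2).ne
    ((enorm_integral_le_lintegral_enorm _).trans (lintegral_inner_timeShift_le hF hw s))

theorem integral_integral_pairing_timeShift [ENNReal.HolderConjugate p q] (hF : Measurable F)
    (hw : Measurable w) (hFp : MemLp F p (μ.prod volume)) (hwq : MemLp w q (μ.prod volume))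
    {h : ℝ} (hh : 0 ≤ h) :
    ∫ t, ∫ s in (0 : ℝ)..h, pairing μ F w (t - s) t
      = ∫ s in (0 : ℝ)..h, ∫ t, pairing μ F w (t - s) t := by
  simp_rw [intervalIntegral.integral_of_le hh]
  exact integral_integral_swap (integrable_pairing_timeShift_prod (p := p) (q := q) hF hw hFp hwq _)

theorem integrable_integral_pairing_timeShift [ENNReal.HolderConjugate p q] (hF : Measurable F)
    (hw : Measurable w) (hFp : MemLp F p (μ.prod volume)) (hwq : MemLp w q (μ.prod volume))
    {h : ℝ} (hh : 0 ≤ h) :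
    Integrable fun t => ∫ s in (0 : ℝ)..h, pairing μ F w (t - s) t := by
  simp_rw [intervalIntegral.integral_of_le hh]
  exact (integrable_pairing_timeShift_prod (p := p) (q := q) hF hw hFp hwq _).integral_prod_left

theorem intervalIntegrable_integral_pairing_timeShift [ENNReal.HolderConjugate p q]
    (hF : Measurable F)
    (hw : Measurable w) (hFp : MemLp F p (μ.prod volume)) (hwq : MemLp w q (μ.prod volume))
    {h : ℝ} (hh : 0 ≤ h) :
    IntervalIntegrable (fun s => ∫ t, pairing μ F w (t - s) t) volume 0 h := by
  rw [intervalIntegrable_iff_integrableOn_Ioc_of_le hh]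
  exact (integrable_pairing_timeShift_prod (p := p) (q := q) hF hw hFp hwq
    (volume.restrict (Ioc 0 h))).integral_prod_right

/-- Composition with measure-preserving maps that vary continuously is continuous in `L^p` for
finite `p`. -/
theorem tendsto_eLpNorm_timeShift [TopologicalSpace X] [BorelSpace X] [R1Space X]
    [SecondCountableTopology X] [LocallyCompactSpace X]
    [IsLocallyFiniteMeasure (μ.prod (volume : Measure ℝ))]
    [(μ.prod (volume : Measure ℝ)).InnerRegularCompactLTTop] [Fact (1 ≤ p)] (hp : p ≠ ⊤)
    (hFp : MemLp F p (μ.prod volume)) :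
    Tendsto (fun s : ℝ => eLpNorm (fun z : X × ℝ => F (z.1, z.2 - s) - F z) p (μ.prod volume))
      (𝓝 0) (𝓝 0) := by
  let g : C(ℝ, C(X × ℝ, X × ℝ)) :=
    (ContinuousMap.mk (fun y : ℝ × (X × ℝ) => (y.2.1, y.2.2 - y.1)) (by fun_prop)).curry
  have hg : Tendsto (fun s => g s) (𝓝 0) (𝓝 (g 0)) := g.continuous.tendsto 0
  have hmp : ∀ s, MeasurePreserving (g s) (μ.prod volume) (μ.prod volume) := fun s =>
    measurePreserving_timeShift μ s
  have h := (tendsto_const_nhds (x := hFp.toLp F)).compMeasurePreservingLp hg hmp (hmp 0) hp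
  rw [tendsto_iff_edist_tendsto_0] at h
  refine h.congr fun s => ?_
  rw [Lp.toLp_compMeasurePreserving, Lp.toLp_compMeasurePreserving, Lp.edist_toLp_toLp]
  refine eLpNorm_congr_ae (ae_of_all _ fun z => ?_)
  simp [g]

/-- Identifies the limit of the difference quotients in the energy argument: the force at time `t -
s` may be replaced by the force at time `t` as `s → 0`. -/
theorem tendsto_integral_pairing_timeShift [TopologicalSpace X] [BorelSpace X] [R1Space X]
    [SecondCountableTopology X] [LocallyCompactSpace X]
    [IsLocallyFiniteMeasure (μ.prod (volume : Measure ℝ))]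
    [(μ.prod (volume : Measure ℝ)).InnerRegularCompactLTTop] [Fact (1 ≤ p)] (hp : p ≠ ⊤)
    [ENNReal.HolderConjugate p q] (hF : Measurable F)
    (hw : Measurable w) (hFp : MemLp F p (μ.prod volume)) (hwq : MemLp w q (μ.prod volume)) :
    Tendsto (fun s => ∫ t, pairing μ F w (t - s) t) (𝓝 0) (𝓝 (∫ t, pairing μ F w t t)) := by
  have h0 : ∫ t, pairing μ F w t t = ∫ z, (inner ℝ (F z) (w z) : ℝ) ∂(μ.prod volume) := by
    simpa using integral_pairing_timeShift (p := p) (q := q) hF hw hFp hwq 0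
  have hi0 : Integrable (fun z => (inner ℝ (F z) (w z) : ℝ)) (μ.prod volume) := by
    simpa using integrable_inner_timeShift (p := p) (q := q) hF hw hFp hwq 0
  rw [h0, tendsto_iff_edist_tendsto_0]
  have hlim := ENNReal.Tendsto.mul_const (tendsto_eLpNorm_timeShift hp hFp)
    (b := eLpNorm w q (μ.prod volume)) (Or.inr hwq.2.ne)
  rw [zero_mul] at hlim
  refine tendsto_of_tendsto_of_tendsto_of_le_of_le tendsto_const_nhds hlim (fun _ => zero_le)
    fun s => ?_
  have hi := integrable_inner_timeShift (p := p) (q := q) hF hw hFp hwq s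
  rw [integral_pairing_timeShift (p := p) (q := q) hF hw hFp hwq, edist_eq_enorm_sub,
    ← integral_sub hi hi0]
  refine (enorm_integral_le_lintegral_enorm _).trans ?_
  rw [← eLpNorm_one_eq_lintegral_enorm]
  simp_rw [← inner_sub_left]
  exact eLpNorm_inner_le (((hF.comp (measurePreserving_timeShift μ s).measurable).sub
    hF).aestronglyMeasurable) hw.aestronglyMeasurable

end Shift

/-! ### Exponents, smooth test fields and the interpolation inequality. -/

section TestFields

variable {N : ℕ} {Q : Set (Vec N)} {φ ψ : Vec N → Vec N}

/-- The exponent `1 + 2N/(N+2)` above which the energy method applies. -/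
def critExp (N : ℕ) : ℝ := (3 * N + 2) / (N + 2)

/-- The space-time integrability exponent of velocities, twice the conjugate of `critExp`. -/
def velExp (N : ℕ) : ℝ := (3 * N + 2) / N

/-- The conjugate exponent of `velExp`. -/
def convExp (N : ℕ) : ℝ := (3 * N + 2) / (2 * N + 2)

/-- The reciprocals are `N/(3N+2)`, `(N+2)/(3N+2)` and `(2N+2)/(3N+2)`. Thus velocity times gradient
lies in `L^{convExp}`, and the next lemma pairs that space with velocities again. -/
theorem holderTriple_velExp_critExp (hN : 0 < N) :
    (ENNReal.ofReal (velExp N)).HolderTriple (ENNReal.ofReal (critExp N))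
      (ENNReal.ofReal (convExp N)) := by
  have : (0 : ℝ) < N := by exact_mod_cast hN
  refine Real.HolderTriple.ennrealOfReal ⟨?_, ?_, ?_⟩
  · simp only [velExp, critExp, convExp]; field_simp; ring
  · simp only [velExp]; positivity
  · simp only [critExp]; positivity

theorem holderConjugate_convExp_velExp (hN : 0 < N) :
    (ENNReal.ofReal (convExp N)).HolderConjugate (ENNReal.ofReal (velExp N)) := by
  have : (0 : ℝ) < N := by exact_mod_cast hN
  refine Real.HolderConjugate.ennrealOfReal ⟨?_, ?_, ?_⟩
  · simp only [velExp, convExp]; field_simp; ring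
  · simp only [convExp]; positivity
  · simp only [velExp]; positivity

theorem grad_apply (φ : Vec N → Vec N) (x : Vec N) (i j : Fin N) :
    grad φ x (i, j) = (fderiv ℝ φ x (EuclideanSpace.single i 1)) j := rfl

theorem fderiv_apply_eq_sum_grad (φ : Vec N → Vec N) (x v : Vec N) (j : Fin N) :
    (fderiv ℝ φ x v) j = ∑ i, v i * grad φ x (i, j) := by
  have hv : v = ∑ i, v i • EuclideanSpace.single i (1 : ℝ) := by
    ext k; simp [Finset.sum_apply, Pi.single_apply]
  conv_lhs => rw [hv]
  simp [grad_apply]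

/-- The operator norm is at most the Frobenius norm, by Cauchy–Schwarz in each component. -/
theorem norm_fderiv_le_norm_grad (φ : Vec N → Vec N) (x : Vec N) :
    ‖fderiv ℝ φ x‖ ≤ ‖grad φ x‖ := by
  refine ContinuousLinearMap.opNorm_le_bound _ (norm_nonneg _) fun v => ?_
  refine le_of_sq_le_sq ?_ (by positivity)
  rw [mul_pow, EuclideanSpace.real_norm_sq_eq, EuclideanSpace.real_norm_sq_eq (grad φ x),
    Fintype.sum_prod_type_right, Finset.sum_mul]
  refine Finset.sum_le_sum fun j _ => ?_
  rw [fderiv_apply_eq_sum_grad, EuclideanSpace.real_norm_sq_eq v, mul_comm]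
  exact Finset.sum_mul_sq_le_sq_mul_sq _ _ _

theorem grad_sub (hφ : Differentiable ℝ φ) (hψ : Differentiable ℝ ψ) :
    grad (φ - ψ) = grad φ - grad ψ := by
  ext x ij
  simp [grad, partialDeriv, fderiv_sub (hφ x) (hψ x)]

namespace IsSolenoidalTest

theorem differentiable (h : IsSolenoidalTest Q φ) : Differentiable ℝ φ :=
  h.smooth.differentiable (by simp)

theorem continuous_grad (h : IsSolenoidalTest Q φ) : Continuous (grad φ) := by
  have h1 : Continuous (fderiv ℝ φ) := h.smooth.continuous_fderiv (by simp)
  have : Continuous fun x => fun ij : Fin N × Fin N => partialDeriv φ ij.1 ij.2 x := by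
    refine continuous_pi fun ij => ?_
    exact (EuclideanSpace.proj (𝕜 := ℝ) ij.2).continuous.comp (h1.clm_apply continuous_const)
  exact (PiLp.continuous_toLp 2 _).comp this

theorem grad_eq_zero {x : Vec N} (hx : x ∉ tsupport φ) : grad φ x = 0 := by
  have : fderiv ℝ φ x = 0 := by
    by_contra h
    exact hx (support_fderiv_subset ℝ h)
  ext ij; simp [grad, partialDeriv, this]

theorem hasCompactSupport_grad (h : IsSolenoidalTest Q φ) : HasCompactSupport (grad φ) :=
  HasCompactSupport.intro h.compactSupport fun _ hx => grad_eq_zero hx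

theorem memLp (h : IsSolenoidalTest Q φ) (r : ℝ≥0∞) : MemLp φ r volume :=
  h.smooth.continuous.memLp_of_hasCompactSupport h.compactSupport

theorem memLp_grad (h : IsSolenoidalTest Q φ) (r : ℝ≥0∞) : MemLp (grad φ) r volume :=
  h.continuous_grad.memLp_of_hasCompactSupport h.hasCompactSupport_grad

theorem eLpNorm_restrict (h : IsSolenoidalTest Q φ) (r : ℝ≥0∞) :
    eLpNorm φ r (volume.restrict Q) = eLpNorm φ r volume :=
  eLpNorm_restrict_eq_of_support_subset ((subset_tsupport φ).trans h.support_subset)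

theorem eLpNorm_grad_restrict (h : IsSolenoidalTest Q φ) (r : ℝ≥0∞) :
    eLpNorm (grad φ) r (volume.restrict Q) = eLpNorm (grad φ) r volume :=
  eLpNorm_restrict_eq_of_support_subset fun x hx => h.support_subset (by
    by_contra hc; exact hx (grad_eq_zero hc))

theorem sub (h : IsSolenoidalTest Q φ) (h' : IsSolenoidalTest Q ψ) :
    IsSolenoidalTest Q (φ - ψ) where
  smooth := h.smooth.sub h'.smooth
  compactSupport := h.compactSupport.sub h'.compactSupport
  support_subset := (tsupport_sub φ ψ).trans (union_subset h.support_subset h'.support_subset)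
  divergence_free x := by
    have e : ∀ i, partialDeriv (φ - ψ) i i x = partialDeriv φ i i x - partialDeriv ψ i i x :=
      fun i => congrArg (fun g : Vec N → Grad N => g x (i, i))
        (grad_sub h.differentiable h'.differentiable)
    simp_rw [e, Finset.sum_sub_distrib, h.divergence_free, h'.divergence_free, sub_zero]

end IsSolenoidalTest

/-- Interpolation of Lebesgue norms. -/
theorem eLpNorm_interpolation_le {α G : Type*} [MeasurableSpace α] [NormedAddCommGroup G]
    {μ : Measure α} {g : α → G} (hg : AEStronglyMeasurable g μ) {r₀ r r₁ θ : ℝ} (h₀ : 0 < r₀)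
    (hr : 0 < r) (h₁ : 0 < r₁) (hθ₀ : 0 ≤ θ) (hθ₁ : θ ≤ 1) (h : 1 / r = (1 - θ) / r₀ + θ / r₁) :
    eLpNorm g (ENNReal.ofReal r) μ ≤
      eLpNorm g (ENNReal.ofReal r₀) μ ^ (1 - θ) * eLpNorm g (ENNReal.ofReal r₁) μ ^ θ := by
  have e : ∀ s : ℝ, 0 < s → eLpNorm g (ENNReal.ofReal s) μ
      = (∫⁻ x, ‖g x‖ₑ ^ s ∂μ) ^ (1 / s) := fun s hs => by
    rw [eLpNorm_eq_lintegral_rpow_enorm_toReal (by simpa using hs) ENNReal.ofReal_ne_top,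
      ENNReal.toReal_ofReal hs.le]
  rw [e r hr, e r₀ h₀, e r₁ h₁, ← ENNReal.rpow_mul, ← ENNReal.rpow_mul]
  have hsum : r * (1 - θ) / r₀ + r * θ / r₁ = 1 := by
    calc _ = r * ((1 - θ) / r₀ + θ / r₁) := by ring
      _ = r * (1 / r) := by rw [h]
      _ = 1 := by field_simp
  -- Hölder for `|g|^r = (|g|^{r₀})^{r(1-θ)/r₀} (|g|^{r₁})^{rθ/r₁}`; by `hsum` the two outer
  -- exponents add up to one.
  have key := ENNReal.lintegral_mul_norm_pow_le (μ := μ) (f := fun x => ‖g x‖ₑ ^ r₀)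
    (g := fun x => ‖g x‖ₑ ^ r₁) (hg.enorm.pow_const _) (hg.enorm.pow_const _)
    (p := r * (1 - θ) / r₀) (q := r * θ / r₁)
    (div_nonneg (mul_nonneg hr.le (by linarith)) h₀.le) (by positivity) hsum
  have key' : ∫⁻ x, ‖g x‖ₑ ^ r ∂μ ≤ (∫⁻ x, ‖g x‖ₑ ^ r₀ ∂μ) ^ (r * (1 - θ) / r₀)
      * (∫⁻ x, ‖g x‖ₑ ^ r₁ ∂μ) ^ (r * θ / r₁) := by
    refine le_trans (le_of_eq (lintegral_congr fun x => ?_)) key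
    rw [← ENNReal.rpow_mul, ← ENNReal.rpow_mul, mul_div_cancel₀ _ h₀.ne', mul_div_cancel₀ _ h₁.ne',
      ← ENNReal.rpow_add_of_nonneg _ _ (mul_nonneg hr.le (by linarith)) (by positivity)]
    congr 1; ring
  calc _ ≤ ((∫⁻ x, ‖g x‖ₑ ^ r₀ ∂μ) ^ (r * (1 - θ) / r₀)
      * (∫⁻ x, ‖g x‖ₑ ^ r₁ ∂μ) ^ (r * θ / r₁)) ^ (1 / r) := by gcongr
    _ = _ := by
      rw [ENNReal.mul_rpow_of_nonneg _ _ (by positivity), ← ENNReal.rpow_mul, ← ENNReal.rpow_mul]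
      congr 2 <;> field_simp

/-- Ladyzhenskaya's inequality: the embedding `W^{1,1} ⊂ L²` of the plane is applied to `|φ|²`,
whose gradient is at most `2|φ||∇φ|`, and Cauchy–Schwarz separates the factors. -/
theorem sobolev_two {φ : Vec 2 → Vec 2} (h1 : ContDiff ℝ 1 φ) (h2 : HasCompactSupport φ) :
    eLpNorm φ 4 volume ≤
      ((2 * eLpNormLESNormFDerivOneConst (volume : Measure (Vec 2)) 2 : ℝ≥0) : ℝ≥0∞) ^ (1 / 2 : ℝ)
        * (eLpNorm φ 2 volume ^ (1 / 2 : ℝ) * eLpNorm (grad φ) 2 volume ^ (1 / 2 : ℝ)) := by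
  set C := eLpNormLESNormFDerivOneConst (volume : Measure (Vec 2)) 2 with hC
  have hψ : ContDiff ℝ 1 fun x => ‖φ x‖ ^ 2 := h1.norm_sq ℝ
  have hψc : HasCompactSupport fun x => ‖φ x‖ ^ 2 := h2.comp_left (g := fun y => ‖y‖ ^ 2) (by simp)
  have key := eLpNorm_le_eLpNorm_fderiv_one (volume : Measure (Vec 2)) hψ hψc (p := 2)
    (by simpa using NNReal.HolderConjugate.two_two)
  have e1 : eLpNorm (fun x => ‖φ x‖ ^ 2) 2 volume = eLpNorm φ 4 volume ^ (2 : ℝ) := by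
    have := eLpNorm_norm_rpow (p := 2) (q := 2) (μ := volume) φ two_pos
    rw [show (2 : ℝ≥0∞) * ENNReal.ofReal 2 = 4 by
      rw [ENNReal.ofReal_ofNat]; norm_num] at this
    rw [← this]; simp
  have hfd : ∀ x, ‖fderiv ℝ (fun x => ‖φ x‖ ^ 2) x‖ ≤ 2 * ‖φ x‖ * ‖fderiv ℝ φ x‖ := by
    intro x
    rw [((h1.differentiable one_ne_zero) x).hasFDerivAt.norm_sq.fderiv, two_nsmul, two_mul,
      add_mul]
    refine (norm_add_le _ _).trans ?_
    have := (ContinuousLinearMap.opNorm_comp_le ((innerSL ℝ) (φ x)) (fderiv ℝ φ x))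
    rw [innerSL_apply_norm] at this
    linarith
  have e2 : eLpNorm (fderiv ℝ fun x => ‖φ x‖ ^ 2) 1 volume
      ≤ 2 * (eLpNorm φ 2 volume * eLpNorm (grad φ) 2 volume) := by
    have hf : Continuous (fderiv ℝ φ) := h1.continuous_fderiv one_ne_zero
    calc _ ≤ eLpNorm (fun x => (2 : ℝ) * (‖φ x‖ * ‖fderiv ℝ φ x‖)) 1 volume :=
          eLpNorm_mono_real fun x => by rw [← mul_assoc]; exact hfd x
      _ = 2 * eLpNorm (fun x => ‖φ x‖ * ‖fderiv ℝ φ x‖) 1 volume := by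
          have := eLpNorm_const_smul (c := (2 : ℝ)) (f := fun x => ‖φ x‖ * ‖fderiv ℝ φ x‖)
            (p := 1) (μ := volume)
          have h2 : ‖(2 : ℝ)‖ₑ = 2 := by
            rw [Real.enorm_of_nonneg (by norm_num), ENNReal.ofReal_ofNat]
          rw [h2] at this
          exact this
      _ ≤ 2 * (eLpNorm φ 2 volume * eLpNorm (fderiv ℝ φ) 2 volume) := by
          gcongr
          have := eLpNorm_le_eLpNorm_mul_eLpNorm'_of_norm (p := 2) (q := 2) (r := 1)
            (μ := (volume : Measure (Vec 2)))
            h1.continuous.aestronglyMeasurable hf.aestronglyMeasurable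
            (fun a b => ‖a‖ * ‖b‖) 1 (ae_of_all _ fun x => by simp)
          simpa using this
      _ ≤ _ := by
          gcongr
          exact eLpNorm_mono fun x => norm_fderiv_le_norm_grad φ x
  have e3 : eLpNorm φ 4 volume ^ (2 : ℝ)
      ≤ ((2 * C : ℝ≥0) : ℝ≥0∞) * (eLpNorm φ 2 volume * eLpNorm (grad φ) 2 volume) := by
    rw [← e1]
    refine key.trans ((mul_le_mul_right e2 _).trans (le_of_eq ?_))
    push_cast
    ring
  calc eLpNorm φ 4 volume = (eLpNorm φ 4 volume ^ (2 : ℝ)) ^ (1 / 2 : ℝ) := by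
        rw [← ENNReal.rpow_mul]; norm_num
    _ ≤ _ := by
        rw [← ENNReal.mul_rpow_of_nonneg _ _ (by norm_num),
          ← ENNReal.mul_rpow_of_nonneg _ _ (by norm_num)]
        gcongr

/-- The Sobolev conjugate of `11/5` in dimension three is `33/4`, since `5/11 - 1/3 = 4/33`. The
exponent `11/3` is then reached by interpolation: `3/11 = (2/5)/2 + (3/5)·(4/33)`. -/
theorem sobolev_three {φ : Vec 3 → Vec 3} (h1 : ContDiff ℝ 1 φ) (h2 : HasCompactSupport φ) :
    eLpNorm φ (ENNReal.ofReal (11 / 3)) volume ≤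
      ((eLpNormLESNormFDerivOfEqInnerConst (volume : Measure (Vec 3)) (11 / 5) : ℝ≥0) : ℝ≥0∞)
          ^ (3 / 5 : ℝ) * (eLpNorm φ 2 volume ^ (2 / 5 : ℝ)
            * eLpNorm (grad φ) (ENNReal.ofReal (11 / 5)) volume ^ (3 / 5 : ℝ)) := by
  have hint := eLpNorm_interpolation_le (μ := (volume : Measure (Vec 3))) (g := φ)
    h1.continuous.aestronglyMeasurable
    (r₀ := 2) (r := 11 / 3) (r₁ := 33 / 4) (θ := 3 / 5) (by norm_num) (by norm_num) (by norm_num)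
    (by norm_num) (by norm_num) (by norm_num)
  have key := eLpNorm_le_eLpNorm_fderiv_of_eq_inner (volume : Measure (Vec 3)) h1 h2
    (p := 11 / 5) (p' := 33 / 4) (by rw [le_div_iff₀ (by norm_num)]; norm_num) (by simp)
    (by simp; norm_num)
  have ea : ((33 / 4 : ℝ≥0) : ℝ≥0∞) = ENNReal.ofReal (33 / 4) := by
    rw [ENNReal.ofReal, Real.toNNReal_of_nonneg (by norm_num)]; congr 1
  have eb : ((11 / 5 : ℝ≥0) : ℝ≥0∞) = ENNReal.ofReal (11 / 5) := by
    rw [ENNReal.ofReal, Real.toNNReal_of_nonneg (by norm_num)]; congr 1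
  have ec : ((11 / 5 : ℝ≥0) : ℝ) = 11 / 5 := by simp
  rw [ea, eb, ec] at key
  have key2 := key.trans (mul_le_mul_right (eLpNorm_mono fun x => norm_fderiv_le_norm_grad φ x) _)
  calc _ ≤ _ := hint
    _ ≤ eLpNorm φ (ENNReal.ofReal 2) volume ^ (1 - 3 / 5 : ℝ)
        * (((eLpNormLESNormFDerivOfEqInnerConst (volume : Measure (Vec 3)) (11 / 5) : ℝ≥0) : ℝ≥0∞)
          * eLpNorm (grad φ) (ENNReal.ofReal (11 / 5)) volume) ^ (3 / 5 : ℝ) := by gcongr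
    _ = _ := by
      rw [ENNReal.mul_rpow_of_nonneg _ _ (by norm_num), ENNReal.ofReal_ofNat]
      norm_num
      ring

/-- The interpolation inequality for velocities: in each of the dimensions `2` and `3`, the
`velExp`-norm is controlled by the `L²` norm and the `critExp`-norm of the gradient. -/
theorem exists_sobolev_const (hN : N = 2 ∨ N = 3) : ∃ C : ℝ≥0, ∀ φ : Vec N → Vec N,
    ContDiff ℝ 1 φ → HasCompactSupport φ →
      eLpNorm φ (ENNReal.ofReal (velExp N)) volume ≤ C * (eLpNorm φ 2 volume ^ (2 / (N + 2) : ℝ)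
        * eLpNorm (grad φ) (ENNReal.ofReal (critExp N)) volume ^ (N / (N + 2) : ℝ)) := by
  rcases hN with rfl | rfl
  · refine ⟨(2 * eLpNormLESNormFDerivOneConst (volume : Measure (Vec 2)) 2) ^ (1 / 2 : ℝ),
      fun φ h1 h2 => ?_⟩
    have := sobolev_two h1 h2
    rw [ENNReal.coe_rpow_of_nonneg _ (by norm_num)]
    convert this using 2
    · simp only [velExp]; norm_num
    · simp only [critExp]; norm_num
  · refine ⟨(eLpNormLESNormFDerivOfEqInnerConst (volume : Measure (Vec 3)) (11 / 5))
      ^ (3 / 5 : ℝ), fun φ h1 h2 => ?_⟩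
    have := sobolev_three h1 h2
    rw [ENNReal.coe_rpow_of_nonneg _ (by norm_num)]
    convert this using 2
    · simp only [velExp]; norm_num
    · simp only [critExp]; norm_num

end TestFields

/-! ### The space `𝕍`: integrability, the convective term and translations in space. -/

section SolenoidalSpace

variable {N : ℕ} {Q : Set (Vec N)} {p : ℝ} {v w : Vec N → Vec N} {G H : Vec N → Grad N}

theorem critExp_pos (N : ℕ) : 0 < critExp N := by unfold critExp; positivity

theorem velExp_pos (hN : 0 < N) : 0 < velExp N := by
  have : (0 : ℝ) < N := by exact_mod_cast hN
  unfold velExp; positivity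

theorem convExp_pos (N : ℕ) : 0 < convExp N := by unfold convExp; positivity

theorem one_le_convExp (N : ℕ) : 1 ≤ convExp N := by
  unfold convExp
  rw [le_div_iff₀ (by positivity)]
  linarith [(Nat.cast_nonneg N : (0 : ℝ) ≤ N)]

theorem two_le_critExp (hN : 2 ≤ N) : 2 ≤ critExp N := by
  have : (2 : ℝ) ≤ N := by exact_mod_cast hN
  unfold critExp
  rw [le_div_iff₀ (by positivity)]
  linarith

theorem two_le_velExp (hN : 0 < N) : 2 ≤ velExp N := by
  have : (0 : ℝ) < N := by exact_mod_cast hN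
  unfold velExp
  rw [le_div_iff₀ (by positivity)]
  linarith

theorem convExp_le_two (N : ℕ) : convExp N ≤ 2 := by
  unfold convExp
  rw [div_le_iff₀ (by positivity)]
  linarith [(Nat.cast_nonneg N : (0 : ℝ) ≤ N)]

theorem tendsto_eLpNorm_sub_of_le {α E : Type*} [MeasurableSpace α] [NormedAddCommGroup E]
    {μ : Measure α} [IsFiniteMeasure μ] {r s : ℝ≥0∞} (hrs : r ≤ s) {f : ℕ → α → E} {g : α → E}
    (hf : ∀ n, AEStronglyMeasurable (f n) μ) (hg : AEStronglyMeasurable g μ)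
    (h : Tendsto (fun n => eLpNorm (f n - g) s μ) atTop (𝓝 0)) (hr : r ≠ 0) :
    Tendsto (fun n => eLpNorm (f n - g) r μ) atTop (𝓝 0) := by
  have hlim := ENNReal.Tendsto.mul_const h
    (b := μ univ ^ (1 / r.toReal - 1 / s.toReal)) (Or.inr ?_)
  · rw [zero_mul] at hlim
    exact tendsto_of_tendsto_of_tendsto_of_le_of_le tendsto_const_nhds hlim (fun _ => zero_le)
      fun n => eLpNorm_le_eLpNorm_mul_rpow_measure_univ hrs ((hf n).sub hg)
  · refine ENNReal.rpow_ne_top_of_nonneg ?_ (measure_ne_top _ _)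
    rw [sub_nonneg]
    rcases eq_or_ne s ⊤ with rfl | hs
    · simp
    · exact one_div_le_one_div_of_le (ENNReal.toReal_pos hr (hrs.trans_lt hs.lt_top).ne)
        (ENNReal.toReal_mono hs hrs)

theorem tendsto_eLpNorm_of_tendsto_sub {α E : Type*} [MeasurableSpace α] [NormedAddCommGroup E]
    {μ : Measure α} {r : ℝ≥0∞} (hr : 1 ≤ r) {f : ℕ → α → E} {g : α → E}
    (hf : ∀ n, AEStronglyMeasurable (f n) μ) (hg : MemLp g r μ)
    (h : Tendsto (fun n => eLpNorm (f n - g) r μ) atTop (𝓝 0)) :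
    Tendsto (fun n => eLpNorm (f n) r μ) atTop (𝓝 (eLpNorm g r μ)) := by
  have h1 : Tendsto (fun n => eLpNorm g r μ + eLpNorm (f n - g) r μ) atTop
      (𝓝 (eLpNorm g r μ)) := by simpa using tendsto_const_nhds.add h
  have h2 : Tendsto (fun n => eLpNorm g r μ - eLpNorm (f n - g) r μ) atTop
      (𝓝 (eLpNorm g r μ)) := by
    simpa using ENNReal.Tendsto.sub tendsto_const_nhds h (Or.inl hg.2.ne)
  refine tendsto_of_tendsto_of_tendsto_of_le_of_le h2 h1 (fun n => ?_) fun n => ?_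
  · simp only [tsub_le_iff_right]
    have := eLpNorm_sub_le (hf n) ((hf n).sub hg.1) hr
    simpa using this
  · have := eLpNorm_add_le hg.1 ((hf n).sub hg.1) hr
    simpa using this

theorem MemV.congr (h : MemV Q p v G) (hv : v =ᵐ[volume.restrict Q] w)
    (hG : G =ᵐ[volume.restrict Q] H) : MemV Q p w H := by
  obtain ⟨h1, h2, φ, hφ, h3, h4⟩ := h
  refine ⟨(memLp_congr_ae hv).1 h1, (memLp_congr_ae hG).1 h2, φ, hφ, ?_, ?_⟩
  · refine h3.congr fun n => eLpNorm_congr_ae ?_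
    filter_upwards [hv] with x hx; simp [hx]
  · refine h4.congr fun n => eLpNorm_congr_ae ?_
    filter_upwards [hG] with x hx; simp [hx]

/-- Makes time increments of a solution admissible test fields, and lets estimates on `𝕍` be applied
to approximation errors. -/
theorem MemV.sub (hp : 1 ≤ p) (h : MemV Q p v G) (h' : MemV Q p w H) :
    MemV Q p (v - w) (G - H) := by
  obtain ⟨h1, h2, φ, hφ, h3, h4⟩ := h
  obtain ⟨h1', h2', ψ, hψ, h3', h4'⟩ := h'
  have hp' : (1 : ℝ≥0∞) ≤ ENNReal.ofReal p := by simpa using hp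
  refine ⟨h1.sub h1', h2.sub h2', fun n => φ n - ψ n, fun n => (hφ n).sub (hψ n), ?_, ?_⟩
  · have hlim := h3.add h3'
    rw [add_zero] at hlim
    refine tendsto_of_tendsto_of_tendsto_of_le_of_le tendsto_const_nhds hlim (fun _ => zero_le)
      fun n => ?_
    have e : φ n - ψ n - (v - w) = (φ n - v) - (ψ n - w) := by abel
    dsimp only
    rw [e]
    exact eLpNorm_sub_le (((hφ n).memLp 1).1.restrict.sub h1.1)
      (((hψ n).memLp 1).1.restrict.sub h1'.1) hp'
  · have hlim := h4.add h4'
    rw [add_zero] at hlim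
    refine tendsto_of_tendsto_of_tendsto_of_le_of_le tendsto_const_nhds hlim (fun _ => zero_le)
      fun n => ?_
    have e : grad (φ n - ψ n) - (G - H) = (grad (φ n) - G) - (grad (ψ n) - H) := by
      rw [grad_sub (hφ n).differentiable (hψ n).differentiable]; abel
    dsimp only
    rw [e]
    exact eLpNorm_sub_le (((hφ n).memLp_grad 1).1.restrict.sub h2.1)
      (((hψ n).memLp_grad 1).1.restrict.sub h2'.1) hp'

theorem IsSolenoidalTest.memV (h : IsSolenoidalTest Q v) : MemV Q p v (grad v) :=
  ⟨(h.memLp _).restrict Q, (h.memLp_grad _).restrict Q, fun _ => v, fun _ => h, by simp, by simp⟩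

theorem MemV.memLp_two [IsFiniteMeasure (volume.restrict Q)] (hp : 2 ≤ p) (h : MemV Q p v G) :
    MemLp v 2 (volume.restrict Q) :=
  h.1.mono_exponent (by
    rw [← ENNReal.ofReal_ofNat]; exact ENNReal.ofReal_le_ofReal hp)

theorem MemV.memLp_grad [IsFiniteMeasure (volume.restrict Q)] {r : ℝ} (hr : r ≤ p)
    (h : MemV Q p v G) : MemLp G (ENNReal.ofReal r) (volume.restrict Q) :=
  h.2.1.mono_exponent (ENNReal.ofReal_le_ofReal hr)

/-- The interpolation inequality for elements of `𝕍`. -/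
theorem MemV.eLpNorm_velExp_le [IsFiniteMeasure (volume.restrict Q)] (hN : 2 ≤ N)
    (hp : critExp N ≤ p) {C : ℝ≥0}
    (hC : ∀ φ : Vec N → Vec N, ContDiff ℝ 1 φ → HasCompactSupport φ →
      eLpNorm φ (ENNReal.ofReal (velExp N)) volume ≤ C * (eLpNorm φ 2 volume ^ (2 / (N + 2) : ℝ)
        * eLpNorm (grad φ) (ENNReal.ofReal (critExp N)) volume ^ (N / (N + 2) : ℝ)))
    (h : MemV Q p v G) :
    eLpNorm v (ENNReal.ofReal (velExp N)) (volume.restrict Q) ≤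
      C * (eLpNorm v 2 (volume.restrict Q) ^ (2 / (N + 2) : ℝ)
        * eLpNorm G (ENNReal.ofReal (critExp N)) (volume.restrict Q) ^ (N / (N + 2) : ℝ)) := by
  have h2p : 2 ≤ p := (two_le_critExp hN).trans hp
  have hv2 := h.memLp_two h2p
  have hG0 := h.memLp_grad hp
  obtain ⟨h1, h2, φ, hφ, h3, h4⟩ := h
  have hφm : ∀ n, AEStronglyMeasurable (φ n) (volume.restrict Q) := fun n =>
    ((hφ n).memLp 1).1.restrict
  have hφm' : ∀ n, AEStronglyMeasurable (grad (φ n)) (volume.restrict Q) := fun n =>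
    ((hφ n).memLp_grad 1).1.restrict
  have hp0 : ENNReal.ofReal p ≠ 0 := by simp; linarith
  -- Convergence in the `velExp`-norm is not yet known. Along an almost everywhere convergent
  -- subsequence Fatou's lemma gives lower semicontinuity of that norm, while the right-hand side
  -- converges.
  obtain ⟨ns, hns, hae⟩ :=
    (tendstoInMeasure_of_tendsto_eLpNorm hp0 hφm h1.1 h3).exists_seq_tendsto_ae
  have ha := tendsto_eLpNorm_of_tendsto_sub (r := 2) (by norm_num) hφm hv2
    (tendsto_eLpNorm_sub_of_le (by
      rw [← ENNReal.ofReal_ofNat]; exact ENNReal.ofReal_le_ofReal h2p) hφm h1.1 h3 (by simp))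
  have hb := tendsto_eLpNorm_of_tendsto_sub (r := ENNReal.ofReal (critExp N))
    (by simpa using one_le_two.trans (two_le_critExp hN)) hφm' hG0
    (tendsto_eLpNorm_sub_of_le (ENNReal.ofReal_le_ofReal hp) hφm' h2.1 h4
      (by simpa using critExp_pos N))
  have hlim := ENNReal.Tendsto.const_mul (a := (C : ℝ≥0∞))
    (ENNReal.Tendsto.mul (((ENNReal.continuous_rpow_const (y := (2 / (N + 2) : ℝ))).tendsto _).comp
      (ha.comp hns.tendsto_atTop))
      (Or.inr (ENNReal.rpow_ne_top_of_nonneg (by positivity) hG0.2.ne))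
      (((ENNReal.continuous_rpow_const (y := (N / (N + 2) : ℝ))).tendsto _).comp
        (hb.comp hns.tendsto_atTop))
      (Or.inr (ENNReal.rpow_ne_top_of_nonneg (by positivity) hv2.2.ne)))
      (Or.inr ENNReal.coe_ne_top)
  rw [← hlim.liminf_eq]
  refine (Lp.eLpNorm_lim_le_liminf_eLpNorm (fun n => hφm (ns n)) v hae).trans
    (liminf_le_liminf (Eventually.of_forall fun n => ?_))
  have := hC (φ (ns n)) ((hφ _).smooth.of_le (by simp)) (hφ _).compactSupport
  simpa only [(hφ _).eLpNorm_restrict, (hφ _).eLpNorm_grad_restrict, Function.comp] using this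

theorem MemV.memLp_velExp [IsFiniteMeasure (volume.restrict Q)] (hN : N = 2 ∨ N = 3)
    (hp : critExp N ≤ p) (h : MemV Q p v G) :
    MemLp v (ENNReal.ofReal (velExp N)) (volume.restrict Q) := by
  obtain ⟨C, hC⟩ := exists_sobolev_const hN
  have hN2 : 2 ≤ N := by omega
  refine ⟨h.1.1, (h.eLpNorm_velExp_le hN2 hp hC).trans_lt ?_⟩
  have hv2 := h.memLp_two ((two_le_critExp hN2).trans hp)
  have hG0 := h.memLp_grad hp
  exact ENNReal.mul_lt_top ENNReal.coe_lt_top (ENNReal.mul_lt_top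
    (ENNReal.rpow_lt_top_of_nonneg (by positivity) hv2.2.ne)
    (ENNReal.rpow_lt_top_of_nonneg (by positivity) hG0.2.ne))

/-- Elements of `𝕍` are limits of test fields also in the `velExp`-norm. -/
theorem MemV.exists_seq [IsFiniteMeasure (volume.restrict Q)] (hN : N = 2 ∨ N = 3)
    (hp : critExp N ≤ p) (h : MemV Q p v G) :
    ∃ φ : ℕ → Vec N → Vec N, (∀ n, IsSolenoidalTest Q (φ n)) ∧
      Tendsto (fun n => eLpNorm (φ n - v) 2 (volume.restrict Q)) atTop (𝓝 0) ∧
      Tendsto (fun n => eLpNorm (φ n - v) (ENNReal.ofReal (velExp N)) (volume.restrict Q))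
        atTop (𝓝 0) ∧
      Tendsto (fun n => eLpNorm (grad (φ n) - G) (ENNReal.ofReal (critExp N))
        (volume.restrict Q)) atTop (𝓝 0) ∧
      Tendsto (fun n => eLpNorm (grad (φ n) - G) 2 (volume.restrict Q)) atTop (𝓝 0) := by
  obtain ⟨C, hC⟩ := exists_sobolev_const hN
  have hN2 : 2 ≤ N := by omega
  have h2p : 2 ≤ p := (two_le_critExp hN2).trans hp
  have hV := h
  obtain ⟨h1, h2, φ, hφ, h3, h4⟩ := h
  have hφm : ∀ n, AEStronglyMeasurable (φ n) (volume.restrict Q) := fun n =>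
    ((hφ n).memLp 1).1.restrict
  have hφm' : ∀ n, AEStronglyMeasurable (grad (φ n)) (volume.restrict Q) := fun n =>
    ((hφ n).memLp_grad 1).1.restrict
  have h2' : (2 : ℝ≥0∞) ≤ ENNReal.ofReal p := by
    rw [← ENNReal.ofReal_ofNat]; exact ENNReal.ofReal_le_ofReal h2p
  have ha := tendsto_eLpNorm_sub_of_le (r := 2) h2' hφm h1.1 h3 (by simp)
  have hb := tendsto_eLpNorm_sub_of_le (ENNReal.ofReal_le_ofReal hp) hφm' h2.1 h4
      (by simpa using critExp_pos N)
  refine ⟨φ, hφ, ha, ?_, hb, tendsto_eLpNorm_sub_of_le (r := 2) h2' hφm' h2.1 h4 (by simp)⟩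
  have hNpos : (0 : ℝ) < N := by exact_mod_cast (by omega : 0 < N)
  have hlim := ENNReal.Tendsto.const_mul (a := (C : ℝ≥0∞))
    (ENNReal.Tendsto.mul (((ENNReal.continuous_rpow_const (y := (2 / (N + 2) : ℝ))).tendsto _).comp
      ha) (Or.inr (ENNReal.rpow_ne_top_of_nonneg (by positivity) (by simp)))
      (((ENNReal.continuous_rpow_const (y := (N / (N + 2) : ℝ))).tendsto _).comp hb)
      (Or.inr (ENNReal.rpow_ne_top_of_nonneg (by positivity) (by simp))))
      (Or.inr ENNReal.coe_ne_top)
  rw [ENNReal.zero_rpow_of_pos (by positivity), zero_mul, mul_zero] at hlim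
  -- The interpolation inequality is applied to the difference `φ n - v`, itself an element of `𝕍`.
  exact tendsto_of_tendsto_of_tendsto_of_le_of_le tendsto_const_nhds hlim (fun _ => zero_le)
    fun n => ((hφ n).memV.sub (by linarith) hV).eLpNorm_velExp_le hN2 hp hC

/-- `(v · ∇) u` at a point where `∇ u = G`. -/
def convect (v : Vec N) (G : Grad N) : Vec N :=
  WithLp.toLp 2 fun j => ∑ i, v i * G (i, j)

theorem norm_convect_le (v : Vec N) (G : Grad N) : ‖convect v G‖ ≤ ‖v‖ * ‖G‖ := by
  refine le_of_sq_le_sq ?_ (by positivity)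
  rw [mul_pow, EuclideanSpace.real_norm_sq_eq, EuclideanSpace.real_norm_sq_eq G,
    Fintype.sum_prod_type_right, Finset.mul_sum]
  refine Finset.sum_le_sum fun j _ => ?_
  rw [EuclideanSpace.real_norm_sq_eq v]
  exact Finset.sum_mul_sq_le_sq_mul_sq Finset.univ (fun i => v i) fun i => G (i, j)

theorem continuous_convect : Continuous fun z : Vec N × Grad N => convect z.1 z.2 := by
  refine (PiLp.continuous_toLp 2 _).comp (continuous_pi fun j => ?_)
  refine continuous_finsetSum _ fun i _ => ?_
  exact ((EuclideanSpace.proj (𝕜 := ℝ) i).continuous.comp continuous_fst).mul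
    ((EuclideanSpace.proj (𝕜 := ℝ) (i, j)).continuous.comp continuous_snd)

theorem memLp_convect {α : Type*} [MeasurableSpace α] {μ : Measure α} {u : α → Vec N}
    {K : α → Grad N} {q r s : ℝ≥0∞} [q.HolderTriple r s] (hu : MemLp u q μ) (hK : MemLp K r μ) :
    MemLp (fun x => convect (u x) (K x)) s μ :=
  MemLp.of_bilin convect 1 hu hK (continuous_convect.comp_aestronglyMeasurable (hu.1.prodMk hK.1))
    (ae_of_all _ fun x => by
      rw [one_mul]; exact_mod_cast norm_convect_le (u x) (K x))

theorem eLpNorm_convect_le {α : Type*} [MeasurableSpace α] {μ : Measure α} {u : α → Vec N}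
    {K : α → Grad N} {q r s : ℝ≥0∞} [q.HolderTriple r s] (hu : AEStronglyMeasurable u μ)
    (hK : AEStronglyMeasurable K μ) :
    eLpNorm (fun x => convect (u x) (K x)) s μ ≤ eLpNorm u q μ * eLpNorm K r μ := by
  have := eLpNorm_le_eLpNorm_mul_eLpNorm'_of_norm (p := q) (q := r) (r := s) hu hK
    convect 1 (ae_of_all _ fun x => by simpa using norm_convect_le (u x) (K x))
  simpa using this

theorem inner_convect (a b : Vec N) (K : Grad N) :
    inner ℝ (convect a K) b = ∑ i, ∑ j, a i * K (i, j) * b j := by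
  rw [PiLp.inner_apply, Finset.sum_comm]
  refine Finset.sum_congr rfl fun j _ => ?_
  simp [convect, Finset.mul_sum, mul_comm]

theorem integrable_inner_convect (hN : 0 < N) {μ : Measure (Vec N)} {u w : Vec N → Vec N}
    (hu : MemLp u (ENNReal.ofReal (velExp N)) μ) (hG : MemLp G (ENNReal.ofReal (critExp N)) μ)
    (hw : MemLp w (ENNReal.ofReal (velExp N)) μ) :
    Integrable (fun x => (inner ℝ (convect (u x) (G x)) (w x) : ℝ)) μ := by
  have := holderTriple_velExp_critExp hN
  have := holderConjugate_convExp_velExp hN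
  have h1 : MemLp (fun x => convect (u x) (G x)) (ENNReal.ofReal (convExp N)) μ :=
    memLp_convect hu hG
  refine memLp_one_iff_integrable.1 ⟨h1.1.inner hw.1, ?_⟩
  exact (eLpNorm_inner_le (p := ENNReal.ofReal (convExp N)) (q := ENNReal.ofReal (velExp N))
    h1.1 hw.1).trans_lt (ENNReal.mul_lt_top h1.2 hw.2)

theorem enorm_integral_inner_convect_le (hN : 0 < N) {μ : Measure (Vec N)} {u w : Vec N → Vec N}
    (hu : AEStronglyMeasurable u μ) (hG : AEStronglyMeasurable G μ)
    (hw : AEStronglyMeasurable w μ) :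
    ‖∫ x, (inner ℝ (convect (u x) (G x)) (w x) : ℝ) ∂μ‖ₑ
      ≤ eLpNorm u (ENNReal.ofReal (velExp N)) μ * eLpNorm G (ENNReal.ofReal (critExp N)) μ
        * eLpNorm w (ENNReal.ofReal (velExp N)) μ := by
  have := holderTriple_velExp_critExp hN
  have := holderConjugate_convExp_velExp hN
  refine (enorm_integral_le_lintegral_enorm _).trans ?_
  rw [← eLpNorm_one_eq_lintegral_enorm]
  refine (eLpNorm_inner_le (p := ENNReal.ofReal (convExp N)) (q := ENNReal.ofReal (velExp N))
    (continuous_convect.comp_aestronglyMeasurable (hu.prodMk hG)) hw).trans ?_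
  exact mul_le_mul_left (eLpNorm_convect_le hu hG) _

theorem bForm_eq_integral (hN : 0 < N) {u : Vec N → Vec N}
    (hu : MemLp u (ENNReal.ofReal (velExp N)) (volume.restrict Q))
    (hG : MemLp G (ENNReal.ofReal (critExp N)) (volume.restrict Q))
    (hw : MemLp w (ENNReal.ofReal (velExp N)) (volume.restrict Q)) :
    bForm Q u G w = ∫ x in Q, inner ℝ (convect (u x) (G x)) (w x) := by
  have := holderTriple_velExp_critExp hN
  have := holderConjugate_convExp_velExp hN
  have hcoord : ∀ {r : ℝ≥0∞} {ι : Type} [Fintype ι] {f : Vec N → EuclideanSpace ℝ ι},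
      MemLp f r (volume.restrict Q) → ∀ i, MemLp (fun x => f x i) r (volume.restrict Q) :=
    fun hf i => (EuclideanSpace.proj (𝕜 := ℝ) i).comp_memLp' hf
  have hint : ∀ i j, Integrable (fun x => u x i * G x (i, j) * w x j) (volume.restrict Q) := by
    intro i j
    have h1 : MemLp (fun x => u x i * G x (i, j)) (ENNReal.ofReal (convExp N))
      (volume.restrict Q) := (hcoord hG (i, j)).mul' (hcoord hu i)
    exact memLp_one_iff_integrable.1 ((hcoord hw j).mul' h1)
  simp_rw [bForm, inner_convect]
  rw [integral_finsetSum _ fun i _ => integrable_finsetSum _ fun j _ => hint i j]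
  exact Finset.sum_congr rfl fun i _ => (integral_finsetSum _ fun j _ => hint i j).symm

/-- The integrand is `½ v · ∇|v|²`; integration by parts turns it into `-½ |v|² div v`, which
vanishes. -/
theorem IsSolenoidalTest.integral_inner_convect_self (h : IsSolenoidalTest Q v) :
    ∫ x, (inner ℝ (convect (v x) (grad v x)) (v x) : ℝ) = 0 := by
  set g : Vec N → ℝ := fun x => ‖v x‖ ^ 2 with hg
  have hgs : ContDiff ℝ 1 g := (h.smooth.of_le (by simp)).norm_sq ℝ
  have hgc : HasCompactSupport g := h.compactSupport.comp_left (g := fun y => ‖y‖ ^ 2) (by simp)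
  have hvs : ∀ i, ContDiff ℝ 1 fun x => v x i := fun i =>
    contDiff_euclidean.1 (h.smooth.of_le (by simp)) i
  have hfd : ∀ x e, fderiv ℝ g x e = 2 * inner ℝ (v x) (fderiv ℝ v x e) := by
    intro x e
    rw [(h.differentiable x).hasFDerivAt.norm_sq.fderiv]
    simp [two_mul]
  have hfi : ∀ i x e, fderiv ℝ (fun x => v x i) x e = (fderiv ℝ v x e) i := by
    intro i x e
    have := ((EuclideanSpace.proj (𝕜 := ℝ) i : Vec N →L[ℝ] ℝ).hasFDerivAt.comp x
      (h.differentiable x).hasFDerivAt).fderiv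
    exact congrArg (fun L : Vec N →L[ℝ] ℝ => L e) this
  have hcont : ∀ i : Fin N, Continuous fun x => fderiv ℝ g x (EuclideanSpace.single i 1) :=
    fun i => (hgs.continuous_fderiv one_ne_zero).clm_apply continuous_const
  have hconti : ∀ i : Fin N, Continuous fun x =>
      fderiv ℝ (fun x => v x i) x (EuclideanSpace.single i 1) :=
    fun i => ((hvs i).continuous_fderiv one_ne_zero).clm_apply continuous_const
  have hI1 : ∀ i : Fin N, Integrable fun x =>
      fderiv ℝ (fun x => v x i) x (EuclideanSpace.single i 1) * g x := fun i =>
    ((hconti i).mul hgs.continuous).integrable_of_hasCompactSupport hgc.mul_left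
  have hI2 : ∀ i : Fin N, Integrable fun x => v x i *
      fderiv ℝ g x (EuclideanSpace.single i 1) := fun i =>
    ((hvs i).continuous.mul (hcont i)).integrable_of_hasCompactSupport
      ((hgc.fderiv_apply ℝ _).mul_left)
  have hpt : ∀ x, (inner ℝ (convect (v x) (grad v x)) (v x) : ℝ)
      = 2⁻¹ * ∑ i, v x i * fderiv ℝ g x (EuclideanSpace.single i 1) := by
    intro x
    rw [inner_convect, Finset.mul_sum]
    refine Finset.sum_congr rfl fun i _ => ?_
    rw [hfd, PiLp.inner_apply, Finset.mul_sum, Finset.mul_sum, Finset.mul_sum]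
    refine Finset.sum_congr rfl fun j _ => ?_
    simp [grad_apply]
    ring
  simp_rw [hpt]
  rw [integral_const_mul, integral_finsetSum _ fun i _ => hI2 i]
  have hibp : ∀ i : Fin N, ∫ x, v x i * fderiv ℝ g x (EuclideanSpace.single i 1)
      = -∫ x, fderiv ℝ (fun x => v x i) x (EuclideanSpace.single i 1) * g x := fun i =>
    integral_mul_fderiv_eq_neg_fderiv_mul_of_integrable (hI1 i) (hI2 i)
      (((hvs i).continuous.mul hgs.continuous).integrable_of_hasCompactSupport hgc.mul_left)
      (fun x _ => (hvs i).differentiable one_ne_zero x)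
      (fun x _ => hgs.differentiable one_ne_zero x)
  simp_rw [hibp]
  rw [Finset.sum_neg_distrib, ← integral_finsetSum _ fun i _ => hI1 i]
  have hz : ∀ x, ∑ i, fderiv ℝ (fun x => v x i) x (EuclideanSpace.single i 1) * g x = 0 := by
    intro x
    rw [← Finset.sum_mul]
    simp_rw [hfi]
    have := h.divergence_free x
    simp only [partialDeriv] at this
    rw [this, zero_mul]
  simp [hz]

/-- The convective term does no work. -/
theorem MemV.integral_inner_convect_self [IsFiniteMeasure (volume.restrict Q)]
    (hN : N = 2 ∨ N = 3) (hp : critExp N ≤ p) (h : MemV Q p v G) :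
    ∫ x in Q, (inner ℝ (convect (v x) (G x)) (v x) : ℝ) = 0 := by
  have hN0 : 0 < N := by omega
  have hvq := h.memLp_velExp hN hp
  have hG0 := h.memLp_grad hp
  obtain ⟨φ, hφ, -, hq, hc, -⟩ := h.exists_seq hN hp
  have hφq : ∀ n, MemLp (φ n) (ENNReal.ofReal (velExp N)) (volume.restrict Q) := fun n =>
    ((hφ n).memLp _).restrict Q
  have hφc : ∀ n, MemLp (grad (φ n)) (ENNReal.ofReal (critExp N)) (volume.restrict Q) := fun n =>
    ((hφ n).memLp_grad _).restrict Q
  have h1q : (1 : ℝ≥0∞) ≤ ENNReal.ofReal (velExp N) := by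
    simpa using one_le_two.trans (two_le_velExp hN0)
  have h1c : (1 : ℝ≥0∞) ≤ ENNReal.ofReal (critExp N) := by
    simpa using one_le_two.trans (two_le_critExp (by omega : 2 ≤ N))
  have hzero : ∀ n, ∫ x in Q, (inner ℝ (convect (φ n x) (grad (φ n) x)) (φ n x) : ℝ) = 0 := by
    intro n
    rw [setIntegral_eq_integral_of_forall_compl_eq_zero, (hφ n).integral_inner_convect_self]
    intro x hx
    rw [image_eq_zero_of_notMem_tsupport fun hc => hx ((hφ n).support_subset hc), inner_zero_right]
  set A := eLpNorm v (ENNReal.ofReal (velExp N)) (volume.restrict Q) with hA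
  set B := eLpNorm G (ENNReal.ofReal (critExp N)) (volume.restrict Q) with hB
  set a := fun n => eLpNorm (φ n - v) (ENNReal.ofReal (velExp N)) (volume.restrict Q)
  set b := fun n => eLpNorm (grad (φ n) - G) (ENNReal.ofReal (critExp N)) (volume.restrict Q)
  set A' := fun n => eLpNorm (φ n) (ENNReal.ofReal (velExp N)) (volume.restrict Q)
  set B' := fun n => eLpNorm (grad (φ n)) (ENNReal.ofReal (critExp N)) (volume.restrict Q)
  have hA' : Tendsto A' atTop (𝓝 A) := tendsto_eLpNorm_of_tendsto_sub h1q (fun n => (hφq n).1) hvq hq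
  have hB' : Tendsto B' atTop (𝓝 B) := tendsto_eLpNorm_of_tendsto_sub h1c (fun n => (hφc n).1) hG0 hc
  have hAt : A ≠ ⊤ := hvq.2.ne
  have hBt : B ≠ ⊤ := hG0.2.ne
  have hbound : ∀ n, ‖∫ x in Q, (inner ℝ (convect (v x) (G x)) (v x) : ℝ)‖ₑ
      ≤ a n * B * A + A' n * b n * A + A' n * B' n * a n := by
    intro n
    -- The trilinear form is telescoped from `v` to the test field, one slot at a time. Each
    -- difference tends to zero by Hölder, and the last term integrates to zero.
    have e : ∀ x, (inner ℝ (convect (v x) (G x)) (v x) : ℝ)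
        = -inner ℝ (convect ((φ n - v) x) (G x)) (v x)
          - inner ℝ (convect (φ n x) ((grad (φ n) - G) x)) (v x)
          - inner ℝ (convect (φ n x) (grad (φ n) x)) ((φ n - v) x)
          + inner ℝ (convect (φ n x) (grad (φ n) x)) (φ n x) := by
      intro x
      simp only [inner_convect, ← Finset.sum_neg_distrib, ← Finset.sum_sub_distrib,
        ← Finset.sum_add_distrib]
      refine Finset.sum_congr rfl fun i _ => Finset.sum_congr rfl fun j _ => ?_
      simp only [Pi.sub_apply, PiLp.sub_apply]
      ring
    have i1 := integrable_inner_convect hN0 ((hφq n).sub hvq) hG0 hvq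
    have i2 := integrable_inner_convect hN0 (hφq n) ((hφc n).sub hG0) hvq
    have i3 := integrable_inner_convect hN0 (hφq n) (hφc n) ((hφq n).sub hvq)
    have i4 := integrable_inner_convect hN0 (hφq n) (hφc n) (hφq n)
    have e' : ∫ x in Q, (inner ℝ (convect (v x) (G x)) (v x) : ℝ)
        = -(∫ x in Q, (inner ℝ (convect ((φ n - v) x) (G x)) (v x) : ℝ))
          - (∫ x in Q, (inner ℝ (convect (φ n x) ((grad (φ n) - G) x)) (v x) : ℝ))
          - ∫ x in Q, (inner ℝ (convect (φ n x) (grad (φ n) x)) ((φ n - v) x) : ℝ) := by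
      rw [← integral_neg', ← integral_sub' i1.neg i2, ← integral_sub' (i1.neg.sub i2) i3,
        ← add_zero (∫ x in Q, (_ - _ : Vec N → ℝ) x), ← hzero n,
        ← integral_add' ((i1.neg.sub i2).sub i3) i4]
      exact integral_congr_ae (ae_of_all _ e)
    rw [e']
    refine (enorm_sub_le).trans (add_le_add ((enorm_sub_le).trans (add_le_add ?_ ?_)) ?_)
    · rw [enorm_neg]
      exact enorm_integral_inner_convect_le hN0 ((hφq n).sub hvq).1 hG0.1 hvq.1
    · exact enorm_integral_inner_convect_le hN0 (hφq n).1 ((hφc n).sub hG0).1 hvq.1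
    · exact enorm_integral_inner_convect_le hN0 (hφq n).1 (hφc n).1 ((hφq n).sub hvq).1
  have hlim : Tendsto (fun n => a n * B * A + A' n * b n * A + A' n * B' n * a n) atTop
      (𝓝 (0 * B * A + A * 0 * A + A * B * 0)) := by
    refine ((ENNReal.Tendsto.mul_const (ENNReal.Tendsto.mul_const hq (Or.inr hBt))
      (Or.inr hAt)).add (ENNReal.Tendsto.mul_const (ENNReal.Tendsto.mul hA' (Or.inr (by simp)) hc
        (Or.inr hAt)) (Or.inr hAt))).add (ENNReal.Tendsto.mul (ENNReal.Tendsto.mul hA' (Or.inr hBt)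
          hB' (Or.inr hAt)) (Or.inr (by simp)) hq (Or.inr (ENNReal.mul_ne_top hAt hBt)))
  have := ge_of_tendsto' hlim hbound
  simpa using this

/-- Translations of test fields. -/
theorem IsSolenoidalTest.eLpNorm_translate_sub_le (h : IsSolenoidalTest Q v) (y : Vec N) :
    eLpNorm (fun x => v (x + y) - v x) 2 volume ≤ ‖y‖ₑ * eLpNorm (grad v) 2 volume := by
  have hc := h.continuous_grad
  have hcf : Continuous (fderiv ℝ v) := h.smooth.continuous_fderiv (by simp)
  -- The fundamental theorem of calculus along the segment from `x` to `x + y`, then Cauchy–Schwarz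
  -- on the unit interval.
  have hpt : ∀ x, ‖v (x + y) - v x‖ₑ ^ 2
      ≤ ∫⁻ s in Ioc (0 : ℝ) 1, (‖y‖ₑ ^ 2 * ‖grad v (x + s • y)‖ₑ ^ 2) := by
    intro x
    have hd : ∀ s : ℝ, HasDerivAt (fun s : ℝ => v (x + s • y)) (fderiv ℝ v (x + s • y) y) s := by
      intro s
      have h1 : HasDerivAt (fun s : ℝ => x + s • y) y s := by
        simpa using ((hasDerivAt_id s).smul_const y).const_add x
      exact (h.differentiable _).hasFDerivAt.comp_hasDerivAt s h1
    have hcd : Continuous fun s : ℝ => fderiv ℝ v (x + s • y) y :=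
      (hcf.comp (by fun_prop)).clm_apply continuous_const
    have hftc := intervalIntegral.integral_eq_sub_of_hasDerivAt (a := 0) (b := 1)
      (fun s _ => hd s) (hcd.intervalIntegrable _ _)
    simp only [one_smul, zero_smul, add_zero] at hftc
    rw [← hftc, intervalIntegral.integral_of_le zero_le_one]
    calc _ ≤ (∫⁻ s in Ioc (0 : ℝ) 1, ‖fderiv ℝ v (x + s • y) y‖ₑ) ^ 2 := by
          gcongr; exact enorm_integral_le_lintegral_enorm _
      _ ≤ ∫⁻ s in Ioc (0 : ℝ) 1, ‖fderiv ℝ v (x + s • y) y‖ₑ ^ 2 := by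
          refine (sq_lintegral_le _ hcd.enorm.measurable.aemeasurable).trans ?_
          simp
      _ ≤ _ := by
          refine lintegral_mono fun s => ?_
          rw [← mul_pow]
          gcongr
          rw [mul_comm]
          refine ((fderiv ℝ v (x + s • y)).le_opENorm y).trans ?_
          gcongr
          exact enorm_le_iff_norm_le.2 (norm_fderiv_le_norm_grad v _)
  rw [← ENNReal.pow_le_pow_left_iff two_ne_zero, mul_pow, eLpNorm_two_sq, eLpNorm_two_sq]
  calc _ ≤ ∫⁻ x, ∫⁻ s in Ioc (0 : ℝ) 1, (‖y‖ₑ ^ 2 * ‖grad v (x + s • y)‖ₑ ^ 2) :=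
        lintegral_mono hpt
    _ = ∫⁻ s in Ioc (0 : ℝ) 1, ∫⁻ x, (‖y‖ₑ ^ 2 * ‖grad v (x + s • y)‖ₑ ^ 2) := by
        refine lintegral_lintegral_swap (Measurable.aemeasurable ?_)
        refine Measurable.const_mul (Measurable.pow_const (Continuous.measurable ?_) 2) _
        exact (hc.comp (by fun_prop)).enorm
    _ = ∫⁻ s in Ioc (0 : ℝ) 1, ‖y‖ₑ ^ 2 * ∫⁻ x, ‖grad v x‖ₑ ^ 2 := by
        refine lintegral_congr fun s => ?_
        rw [lintegral_const_mul' _ _ (by simp),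
          lintegral_add_right_eq_self (fun x => ‖grad v x‖ₑ ^ 2)]
    _ = _ := by simp

/-- Translations of zero extensions of elements of `𝕍`. -/
theorem MemV.eLpNorm_translate_sub_le [IsFiniteMeasure (volume.restrict Q)] (hQ : MeasurableSet Q)
    (hN : N = 2 ∨ N = 3) (hp : critExp N ≤ p) (h : MemV Q p v G) (y : Vec N) :
    eLpNorm (fun x => Q.indicator v (x + y) - Q.indicator v x) 2 volume
      ≤ ‖y‖ₑ * eLpNorm G 2 (volume.restrict Q) := by
  have h2p : 2 ≤ p := (two_le_critExp (by omega : 2 ≤ N)).trans hp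
  have hG2 : MemLp G 2 (volume.restrict Q) := by
    have := h.memLp_grad h2p
    rwa [ENNReal.ofReal_ofNat] at this
  have hv2 := h.memLp_two h2p
  obtain ⟨φ, hφ, h2, -, -, hG⟩ := h.exists_seq hN hp
  have hlim : Tendsto (fun n => 2 * eLpNorm (φ n - v) 2 (volume.restrict Q)
      + ‖y‖ₑ * eLpNorm (grad (φ n)) 2 (volume.restrict Q)) atTop
      (𝓝 (2 * 0 + ‖y‖ₑ * eLpNorm G 2 (volume.restrict Q))) := by
    refine (ENNReal.Tendsto.const_mul h2 (Or.inr (by simp))).add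
      (ENNReal.Tendsto.const_mul (tendsto_eLpNorm_of_tendsto_sub (by norm_num)
        (fun n => ((hφ n).memLp_grad 1).1.restrict) hG2 hG) (Or.inr (by simp)))
  rw [mul_zero, zero_add] at hlim
  refine ge_of_tendsto' hlim fun n => ?_
  -- Test fields vanish off `Q`, so `g` is the zero extension of `φ n - v`. It enters once as it is
  -- and once translated, hence the factor 2 in `hlim`.
  set g : Vec N → Vec N := φ n - Q.indicator v with hg
  have hind : g = Q.indicator (φ n - v) := by
    funext x
    by_cases hx : x ∈ Q
    · simp [hg, hx]
    · simp [hg, hx, image_eq_zero_of_notMem_tsupport fun hc => hx ((hφ n).support_subset hc)]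
  have hgm : AEStronglyMeasurable g volume := by
    rw [hind, aestronglyMeasurable_indicator_iff hQ]
    exact ((hφ n).memLp 1).1.restrict.sub hv2.1
  have hgn : eLpNorm g 2 volume = eLpNorm (φ n - v) 2 (volume.restrict Q) := by
    rw [hind, eLpNorm_indicator_eq_eLpNorm_restrict hQ]
  have hmp : MeasurePreserving (fun x : Vec N => x + y) volume volume :=
    measurePreserving_add_right _ y
  have hgy : eLpNorm (fun x => g (x + y)) 2 volume = eLpNorm g 2 volume :=
    eLpNorm_comp_measurePreserving hgm hmp
  have hφc := (hφ n).smooth.continuous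
  have e : (fun x => Q.indicator v (x + y) - Q.indicator v x)
      = (g - fun x => g (x + y)) + fun x => φ n (x + y) - φ n x := by
    funext x; simp only [hg, Pi.add_apply, Pi.sub_apply]; abel
  have hgym : AEStronglyMeasurable (fun x => g (x + y)) volume := hgm.comp_measurePreserving hmp
  rw [e]
  refine (eLpNorm_add_le (hgm.sub hgym)
    (((hφc.comp (continuous_add_const y)).sub hφc).aestronglyMeasurable) (by norm_num)).trans ?_
  refine add_le_add ((eLpNorm_sub_le hgm hgym (by norm_num)).trans ?_) ?_
  · rw [hgy, hgn, two_mul]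
  · rw [(hφ n).eLpNorm_grad_restrict]
    exact (hφ n).eLpNorm_translate_sub_le y

end SolenoidalSpace

/-! ### Functions on the cylinder and a priori bounds in space-time. -/

section SpaceTime

theorem ae_slices {X Y : Type*} [MeasurableSpace X] [MeasurableSpace Y] {μ : Measure X}
    {ν : Measure Y} [SFinite μ] [SFinite ν] {P : X × Y → Prop} (h : ∀ᵐ z ∂(μ.prod ν), P z) :
    ∀ᵐ t ∂ν, ∀ᵐ x ∂μ, P (x, t) :=
  Measure.ae_ae_of_ae_prod (p := fun z : Y × X => P z.swap)
    (Measure.measurePreserving_swap.quasiMeasurePreserving.ae h)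

theorem zero_convect {N : ℕ} (K : Grad N) : convect (0 : Vec N) K = 0 := by
  ext j; simp [convect]

/-- Strong-weak convergence of pairings. -/
theorem tendsto_integral_inner {α E : Type*} [MeasurableSpace α] [NormedAddCommGroup E]
    [InnerProductSpace ℝ E] [MeasurableSpace E] [BorelSpace E] [SecondCountableTopology E]
    {μ : Measure α} {r s : ℝ≥0∞} [ENNReal.HolderConjugate r s] {g : α → E} (hg : MemLp g r μ)
    {v : ℕ → α → E} {w : α → E} (hv : ∀ n, MemLp (v n) s μ) (hw : MemLp w s μ)
    (h : Tendsto (fun n => eLpNorm (v n - w) s μ) atTop (𝓝 0)) :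
    Tendsto (fun n => ∫ x, (inner ℝ (g x) (v n x) : ℝ) ∂μ) atTop
      (𝓝 (∫ x, (inner ℝ (g x) (w x) : ℝ) ∂μ)) := by
  have hint : ∀ {f : α → E}, MemLp f s μ → Integrable (fun x => (inner ℝ (g x) (f x) : ℝ)) μ :=
    fun hf => memLp_one_iff_integrable.1 ⟨hg.1.inner hf.1, (eLpNorm_inner_le (p := r) (q := s)
      hg.1 hf.1).trans_lt (ENNReal.mul_lt_top hg.2 hf.2)⟩
  rw [tendsto_iff_edist_tendsto_0]
  have hlim := ENNReal.Tendsto.const_mul (a := eLpNorm g r μ) h (Or.inr hg.2.ne)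
  rw [mul_zero] at hlim
  refine tendsto_of_tendsto_of_tendsto_of_le_of_le tendsto_const_nhds hlim (fun _ => zero_le)
    fun n => ?_
  rw [edist_eq_enorm_sub, ← integral_sub (hint (hv n)) (hint hw)]
  refine (enorm_integral_le_lintegral_enorm _).trans ?_
  rw [← eLpNorm_one_eq_lintegral_enorm]
  simp_rw [← inner_sub_right]
  exact eLpNorm_inner_le hg.1 ((hv n).sub hw).1

theorem eLpNorm_rpow_eq_lintegral {α E : Type*} [MeasurableSpace α] [NormedAddCommGroup E]
    {μ : Measure α} {r : ℝ} (hr : 0 < r) (f : α → E) :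
    eLpNorm f (ENNReal.ofReal r) μ ^ r = ∫⁻ x, ‖f x‖ₑ ^ r ∂μ := by
  rw [eLpNorm_eq_lintegral_rpow_enorm_toReal (by simpa using hr) ENNReal.ofReal_ne_top,
    ENNReal.toReal_ofReal hr.le, ← ENNReal.rpow_mul]
  simp [hr.ne']

variable {N : ℕ} {Q : Set (Vec N)} {T p : ℝ}

theorem volume_restrict_cylinder (Q : Set (Vec N)) (T : ℝ) :
    (volume : Measure (Vec N × ℝ)).restrict (cylinder Q T)
      = (volume.restrict Q).prod (volume.restrict (Ioo 0 T)) := by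
  rw [cylinder, Measure.volume_eq_prod, Measure.prod_restrict]

theorem measurableSet_cylinder (hQ : MeasurableSet Q) (T : ℝ) : MeasurableSet (cylinder Q T) :=
  hQ.prod measurableSet_Ioo

theorem volume_cylinder_ne_top [IsFiniteMeasure (volume.restrict Q)] (T : ℝ) :
    (volume : Measure (Vec N × ℝ)) (cylinder Q T) ≠ ⊤ := by
  rw [cylinder, Measure.volume_eq_prod, Measure.prod_prod]
  have : volume Q = (volume.restrict Q) univ := by simp
  rw [this]
  exact ENNReal.mul_ne_top (measure_ne_top _ _) (by simp)

/-- Hölder on the set that carries `f`. With zero extensions this compares exponents although the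
ambient measure is infinite. -/
theorem eLpNorm_le_of_zero_off {α E : Type*} [MeasurableSpace α] [NormedAddCommGroup E]
    {μ : Measure α} {S : Set α} {f : α → E} (hf : ∀ z, z ∉ S → f z = 0)
    {r s : ℝ≥0∞} (hrs : r ≤ s) (hm : AEStronglyMeasurable f μ) :
    eLpNorm f r μ ≤ eLpNorm f s μ * μ S ^ (1 / r.toReal - 1 / s.toReal) := by
  have hsupp : Function.support f ⊆ S := fun z hz => by_contra fun h => hz (hf z h)
  rw [← eLpNorm_restrict_eq_of_support_subset hsupp,
    ← eLpNorm_restrict_eq_of_support_subset (p := s) hsupp]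
  simpa using eLpNorm_le_eLpNorm_mul_rpow_measure_univ hrs hm.restrict (μ := μ.restrict S)

/-- The extension of a function of space to a function on the cylinder which is constant in
time. -/
def slab {E : Type*} [Zero E] (Q : Set (Vec N)) (T : ℝ) (v : Vec N → E) : Vec N × ℝ → E :=
  (cylinder Q T).indicator fun z => v z.1

section Slab

variable {E : Type*} [NormedAddCommGroup E] [InnerProductSpace ℝ E] [MeasurableSpace E]
  [BorelSpace E] [SecondCountableTopology E] {v : Vec N → E} {F : Vec N × ℝ → E} {r s : ℝ≥0∞}

theorem memLp_slab (hQ : MeasurableSet Q) (hv : MemLp v s (volume.restrict Q)) :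
    MemLp (slab Q T v) s volume := by
  rw [slab, memLp_indicator_iff_restrict (measurableSet_cylinder hQ T), volume_restrict_cylinder]
  exact hv.comp_fst _

theorem eLpNorm_slab (hQ : MeasurableSet Q) (hs : s ≠ ⊤)
    (hv : AEStronglyMeasurable v (volume.restrict Q)) :
    eLpNorm (slab Q T v) s volume
      = ENNReal.ofReal T ^ (1 / s).toReal * eLpNorm v s (volume.restrict Q) := by
  rw [slab, eLpNorm_indicator_eq_eLpNorm_restrict (measurableSet_cylinder hQ T),
    volume_restrict_cylinder]
  have hmap := Measure.map_fst_prod (μ := volume.restrict Q)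
    (ν := (volume : Measure ℝ).restrict (Ioo 0 T))
  have h1 := eLpNorm_map_measure (p := s) (f := Prod.fst) (g := v)
    (μ := (volume.restrict Q).prod ((volume : Measure ℝ).restrict (Ioo 0 T)))
    (by rw [hmap]; exact hv.mono_ac Measure.smul_absolutelyContinuous) measurable_fst.aemeasurable
  rw [hmap, eLpNorm_smul_measure_of_ne_top hs] at h1
  simpa [Function.comp_def] using h1.symm

theorem integrable_inner_slab [ENNReal.HolderConjugate r s] (hQ : MeasurableSet Q)
    (hF : MemLp F r volume) (hv : MemLp v s (volume.restrict Q)) (t : ℝ) :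
    Integrable (fun z => (inner ℝ (F z) ((univ ×ˢ Iic t).indicator (slab Q T v) z) : ℝ)) := by
  have hw : MemLp ((univ ×ˢ Iic t).indicator (slab Q T v)) s volume :=
    (memLp_slab hQ hv).indicator (MeasurableSet.univ.prod measurableSet_Iic)
  exact memLp_one_iff_integrable.1 ⟨hF.1.inner hw.1, (eLpNorm_inner_le (p := r) (q := s)
      hF.1 hw.1).trans_lt (ENNReal.mul_lt_top hF.2 hw.2)⟩

theorem integral_slice_slab (hF0 : ∀ z, z ∉ cylinder Q T → F z = 0) (t σ : ℝ) :
    ∫ x, (inner ℝ (F (x, σ)) ((univ ×ˢ Iic t).indicator (slab Q T v) (x, σ)) : ℝ)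
      = (Ioc 0 t).indicator (fun σ => ∫ x, (inner ℝ (F (x, σ)) (v x) : ℝ)) σ := by
  by_cases hσ : σ ∈ Ioc 0 t
  · rw [indicator_of_mem hσ]
    refine integral_congr_ae (ae_of_all _ fun x => ?_)
    by_cases hx : (x, σ) ∈ cylinder Q T
    · simp [slab, hx, hσ.2]
    · simp [hF0 _ hx]
  · rw [indicator_of_notMem hσ]
    refine integral_eq_zero_of_ae (ae_of_all _ fun x => ?_)
    by_cases hx : (x, σ) ∈ cylinder Q T
    · have : ¬ σ ≤ t := fun h => hσ ⟨hx.2.1, h⟩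
      simp [this]
    · simp [hF0 _ hx]

/-- Rewrites an iterated integral of the weak formulation as one space-time pairing with a cut-off
slab, where Hölder gives continuity in the test field. -/
theorem intervalIntegral_inner_eq [ENNReal.HolderConjugate r s] (hQ : MeasurableSet Q)
    (hF : MemLp F r volume) (hF0 : ∀ z, z ∉ cylinder Q T → F z = 0)
    (hv : MemLp v s (volume.restrict Q)) {t : ℝ} (ht : 0 ≤ t) :
    ∫ σ in (0 : ℝ)..t, ∫ x, (inner ℝ (F (x, σ)) (v x) : ℝ)
      = ∫ z, (inner ℝ (F z) ((univ ×ˢ Iic t).indicator (slab Q T v) z) : ℝ) := by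
  rw [Measure.volume_eq_prod, integral_prod_symm _ (integrable_inner_slab hQ hF hv t),
    intervalIntegral.integral_of_le ht, ← integral_indicator measurableSet_Ioc]
  exact integral_congr_ae (ae_of_all _ fun σ => (integral_slice_slab hF0 t σ).symm)

theorem intervalIntegrable_inner [ENNReal.HolderConjugate r s] (hQ : MeasurableSet Q)
    (hF : MemLp F r volume) (hF0 : ∀ z, z ∉ cylinder Q T → F z = 0)
    (hv : MemLp v s (volume.restrict Q)) {t : ℝ} (ht : 0 ≤ t) :
    IntervalIntegrable (fun σ => ∫ x, (inner ℝ (F (x, σ)) (v x) : ℝ)) volume 0 t := by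
  rw [intervalIntegrable_iff_integrableOn_Ioc_of_le ht, ← integrable_indicator_iff measurableSet_Ioc]
  have h := (integrable_inner_slab (T := T) hQ hF hv t)
  rw [Measure.volume_eq_prod] at h
  exact h.integral_prod_right.congr (ae_of_all _ fun σ => integral_slice_slab hF0 t σ)

theorem tendsto_intervalIntegral_inner [ENNReal.HolderConjugate r s] (hs : s ≠ ⊤)
    (hQ : MeasurableSet Q)
    (hF : MemLp F r volume) (hF0 : ∀ z, z ∉ cylinder Q T → F z = 0)
    {w : ℕ → Vec N → E} (hw : ∀ n, MemLp (w n) s (volume.restrict Q))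
    (hv : MemLp v s (volume.restrict Q))
    (h : Tendsto (fun n => eLpNorm (w n - v) s (volume.restrict Q)) atTop (𝓝 0))
    {t : ℝ} (ht : 0 ≤ t) :
    Tendsto (fun n => ∫ σ in (0 : ℝ)..t, ∫ x, (inner ℝ (F (x, σ)) (w n x) : ℝ)) atTop
      (𝓝 (∫ σ in (0 : ℝ)..t, ∫ x, (inner ℝ (F (x, σ)) (v x) : ℝ))) := by
  rw [intervalIntegral_inner_eq hQ hF hF0 hv ht]
  simp_rw [fun n => intervalIntegral_inner_eq hQ hF hF0 (hw n) ht]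
  have hS : MeasurableSet ((univ : Set (Vec N)) ×ˢ Iic t) :=
    MeasurableSet.univ.prod measurableSet_Iic
  refine tendsto_integral_inner hF (fun n => (memLp_slab hQ (hw n)).indicator hS)
    ((memLp_slab hQ hv).indicator hS) ?_
  have hlim := ENNReal.Tendsto.const_mul (a := ENNReal.ofReal T ^ (1 / s).toReal) h
    (Or.inr (ENNReal.rpow_ne_top_of_nonneg (by positivity) (by simp)))
  rw [mul_zero] at hlim
  refine tendsto_of_tendsto_of_tendsto_of_le_of_le tendsto_const_nhds hlim (fun _ => zero_le)
    fun n => ?_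
  dsimp only
  rw [← eLpNorm_slab hQ hs ((hw n).sub hv).1]
  refine eLpNorm_mono fun z => ?_
  by_cases hz : z ∈ (univ : Set (Vec N)) ×ˢ Iic t
  · by_cases hc : z ∈ cylinder Q T <;> simp [slab, hz, hc]
  · simp [hz]

end Slab

/-- The data of an evolution problem, extended by zero outside of the cylinder: a velocity `U` with
gradient `DU`, a convective force `F` and a stress `G`. -/
structure EvolutionData (Q : Set (Vec N)) (T p c K : ℝ) (U : Vec N × ℝ → Vec N)
    (DU : Vec N × ℝ → Grad N) (F : Vec N × ℝ → Vec N) (G : Vec N × ℝ → Grad N) : Prop where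
  measurable_U : Measurable U
  measurable_DU : Measurable DU
  measurable_F : Measurable F
  measurable_G : Measurable G
  U_zero : ∀ z, z ∉ cylinder Q T → U z = 0
  DU_zero : ∀ z, z ∉ cylinder Q T → DU z = 0
  F_zero : ∀ z, z ∉ cylinder Q T → F z = 0
  G_zero : ∀ z, z ∉ cylinder Q T → G z = 0
  memLp_DU : MemLp DU (ENNReal.ofReal p) volume
  bounded : ∃ M : ℝ≥0, ∀ᵐ t, t ∈ Ioo 0 T → eLpNorm (fun x => U (x, t)) 2 (volume.restrict Q) ≤ M
  memV : ∀ᵐ t, t ∈ Ioo 0 T → MemV Q p (fun x => U (x, t)) (fun x => DU (x, t))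
  coercive : ∀ᵐ z, c * ‖DU z‖ ^ p ≤ inner ℝ (G z) (DU z)
  growth_G : ∀ᵐ z, ‖G z‖ ≤ K * (‖DU z‖ + ‖DU z‖ ^ (p - 1))
  growth_F : ∀ᵐ z, z ∈ cylinder Q T → ‖F z - convect (U z) (DU z)‖ ≤ K * (1 + ‖U z‖)

namespace EvolutionData

variable {c K : ℝ} {U : Vec N × ℝ → Vec N} {DU : Vec N × ℝ → Grad N} {F : Vec N × ℝ → Vec N}
  {G : Vec N × ℝ → Grad N}

theorem support_slice {E : Type*} [Zero E] {f : Vec N × ℝ → E}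
    (hf : ∀ z, z ∉ cylinder Q T → f z = 0) (t : ℝ) : Function.support (fun x => f (x, t)) ⊆ Q :=
  fun x hx => by_contra fun h => hx (hf _ fun hc => h hc.1)

theorem slice_eq_zero {E : Type*} [Zero E] {f : Vec N × ℝ → E}
    (hf : ∀ z, z ∉ cylinder Q T → f z = 0) {t : ℝ} (ht : t ∉ Ioo 0 T) (x : Vec N) : f (x, t) = 0 :=
  hf _ fun hc => ht hc.2

theorem lintegral_eq_lintegral_slices {E : Type*} [NormedAddCommGroup E] [MeasurableSpace E]
    [BorelSpace E] {f : Vec N × ℝ → E} (hm : Measurable f)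
    (hf : ∀ z, z ∉ cylinder Q T → f z = 0) {r : ℝ} (hr : 0 < r) :
    ∫⁻ z, ‖f z‖ₑ ^ r = ∫⁻ t in Ioo 0 T, eLpNorm (fun x => f (x, t)) (ENNReal.ofReal r)
      (volume.restrict Q) ^ r := by
  rw [Measure.volume_eq_prod, lintegral_prod_symm' _ (hm.enorm.pow_const r),
    ← lintegral_indicator measurableSet_Ioo]
  refine lintegral_congr fun t => ?_
  by_cases ht : t ∈ Ioo 0 T
  · rw [indicator_of_mem ht, eLpNorm_restrict_eq_of_support_subset (support_slice hf t),
      eLpNorm_rpow_eq_lintegral hr]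
  · rw [indicator_of_notMem ht]
    simp [slice_eq_zero hf ht, hr]

/-- The interpolation inequality on each time slice is raised to the power `velExp` and integrated
in time. The `L²` factor is pulled out by its supremum, and the gradient is left with exactly the
power `critExp`. -/
theorem eLpNorm_U_le [IsFiniteMeasure (volume.restrict Q)]
    (hN : 2 ≤ N) (hp : critExp N ≤ p) {C : ℝ≥0}
    (hC : ∀ φ : Vec N → Vec N, ContDiff ℝ 1 φ → HasCompactSupport φ →
      eLpNorm φ (ENNReal.ofReal (velExp N)) volume ≤ C * (eLpNorm φ 2 volume ^ (2 / (N + 2) : ℝ)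
        * eLpNorm (grad φ) (ENNReal.ofReal (critExp N)) volume ^ (N / (N + 2) : ℝ)))
    (h : EvolutionData Q T p c K U DU F G) {M : ℝ≥0∞} (hMt : M ≠ ⊤)
    (hM : ∀ᵐ t, t ∈ Ioo 0 T → eLpNorm (fun x => U (x, t)) 2 (volume.restrict Q) ≤ M) :
    eLpNorm U (ENNReal.ofReal (velExp N)) volume ≤ C * (M ^ (2 / (N + 2) : ℝ)
      * eLpNorm DU (ENNReal.ofReal (critExp N)) volume ^ (N / (N + 2) : ℝ)) := by
  have hN0 : 0 < N := by omega
  have hNr : (0 : ℝ) < N := by exact_mod_cast hN0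
  have hq := velExp_pos hN0
  have hc := critExp_pos N
  -- The identity that makes the integration in time close.
  have hexp : (N / (N + 2) : ℝ) * velExp N = critExp N := by
    unfold velExp critExp; field_simp
  rw [← ENNReal.rpow_le_rpow_iff hq, eLpNorm_rpow_eq_lintegral hq,
    ENNReal.mul_rpow_of_nonneg _ _ hq.le, ENNReal.mul_rpow_of_nonneg _ _ hq.le,
    ← ENNReal.rpow_mul _ (N / (N + 2) : ℝ), hexp, eLpNorm_rpow_eq_lintegral hc,
    lintegral_eq_lintegral_slices h.measurable_U h.U_zero hq,
    lintegral_eq_lintegral_slices h.measurable_DU h.DU_zero hc, ← mul_assoc,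
    ← lintegral_const_mul' _ _ (ENNReal.mul_ne_top
      (ENNReal.rpow_ne_top_of_nonneg hq.le ENNReal.coe_ne_top)
      (ENNReal.rpow_ne_top_of_nonneg hq.le (ENNReal.rpow_ne_top_of_nonneg (by positivity) hMt)))]
  refine lintegral_mono_ae ?_
  rw [ae_restrict_iff' measurableSet_Ioo]
  filter_upwards [h.memV, hM] with t hV hMb ht
  have h1 := (hV ht).eLpNorm_velExp_le hN hp hC
  calc _ ≤ (C * (M ^ (2 / (N + 2) : ℝ)
      * eLpNorm (fun x => DU (x, t)) (ENNReal.ofReal (critExp N)) (volume.restrict Q)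
        ^ (N / (N + 2) : ℝ))) ^ velExp N := by
        refine ENNReal.rpow_le_rpow (h1.trans ?_) hq.le
        gcongr
        exact hMb ht
    _ = _ := by
        rw [ENNReal.mul_rpow_of_nonneg _ _ hq.le, ENNReal.mul_rpow_of_nonneg _ _ hq.le,
          ← ENNReal.rpow_mul _ (N / (N + 2) : ℝ), hexp, mul_assoc]

/-- The bound `B` is chosen before the data, from `M`, `D` and the structural constants alone. It
serves twice: qualitatively for one solution in `memLp_all`, and uniformly once `M` and `D` are
known not to depend on the scale. -/
theorem exists_bound [IsFiniteMeasure (volume.restrict Q)] (hQ : MeasurableSet Q)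
    (hN : N = 2 ∨ N = 3) (hp : critExp N ≤ p) (T c K : ℝ) {M D : ℝ≥0∞} (hM : M ≠ ⊤) (hD : D ≠ ⊤) :
    ∃ B : ℝ≥0∞, B ≠ ⊤ ∧ ∀ U DU F G, EvolutionData Q T p c K U DU F G →
      (∀ᵐ t, t ∈ Ioo 0 T → eLpNorm (fun x => U (x, t)) 2 (volume.restrict Q) ≤ M) →
      eLpNorm DU (ENNReal.ofReal p) volume ≤ D →
      eLpNorm U (ENNReal.ofReal (velExp N)) volume ≤ B ∧
      eLpNorm F (ENNReal.ofReal (convExp N)) volume ≤ B ∧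
      eLpNorm G (ENNReal.ofReal (p / (p - 1))) volume ≤ B := by
  obtain ⟨C, hC⟩ := exists_sobolev_const hN
  have hN2 : 2 ≤ N := by omega
  have hN0 : 0 < N := by omega
  have h2p : 2 ≤ p := (two_le_critExp hN2).trans hp
  have h2q := two_le_velExp hN0
  have hp' : 1 ≤ p / (p - 1) := by rw [le_div_iff₀ (by linarith)]; linarith
  have hp'2 : p / (p - 1) ≤ p := by
    rw [div_le_iff₀ (by linarith)]; nlinarith
  have hV : (volume : Measure (Vec N × ℝ)) (cylinder Q T) ≠ ⊤ := volume_cylinder_ne_top T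
  set V := (volume : Measure (Vec N × ℝ)) (cylinder Q T) with hVdef
  have hpow : ∀ {r s : ℝ}, 0 < r → r ≤ s → V ^ (1 / (ENNReal.ofReal r).toReal
      - 1 / (ENNReal.ofReal s).toReal) ≠ ⊤ := by
    intro r s hr hrs
    refine ENNReal.rpow_ne_top_of_nonneg ?_ hV
    rw [ENNReal.toReal_ofReal hr.le, ENNReal.toReal_ofReal (hr.le.trans hrs), sub_nonneg]
    exact one_div_le_one_div_of_le hr hrs
  -- Bound for the `critExp`-norm of the gradient, by Hölder on the cylinder; `B1`, `B2` and `B3`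
  -- bound `U`, `F` and `G`.
  set E0 : ℝ≥0∞ := D * V ^ (1 / (ENNReal.ofReal (critExp N)).toReal
      - 1 / (ENNReal.ofReal p).toReal) with hE0
  have hE0t : E0 ≠ ⊤ := ENNReal.mul_ne_top hD (hpow (critExp_pos N) hp)
  set B1 : ℝ≥0∞ := C * (M ^ (2 / (N + 2) : ℝ) * E0 ^ (N / (N + 2) : ℝ)) with hB1
  have hB1t : B1 ≠ ⊤ := ENNReal.mul_ne_top ENNReal.coe_ne_top (ENNReal.mul_ne_top
    (ENNReal.rpow_ne_top_of_nonneg (by positivity) hM)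
    (ENNReal.rpow_ne_top_of_nonneg (by positivity) hE0t))
  set B2 : ℝ≥0∞ := ENNReal.ofReal K * (V ^ (1 / (ENNReal.ofReal (convExp N)).toReal) +
    B1 * V ^ (1 / (ENNReal.ofReal (convExp N)).toReal
      - 1 / (ENNReal.ofReal (velExp N)).toReal)) + B1 * E0 with hB2
  have hcv : convExp N ≤ velExp N := (convExp_le_two N).trans h2q
  have hB2t : B2 ≠ ⊤ := by
    refine ENNReal.add_ne_top.2 ⟨ENNReal.mul_ne_top ENNReal.ofReal_ne_top
      (ENNReal.add_ne_top.2 ⟨ENNReal.rpow_ne_top_of_nonneg (by positivity) hV,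
        ENNReal.mul_ne_top hB1t (hpow (convExp_pos N) hcv)⟩), ENNReal.mul_ne_top hB1t hE0t⟩
  set B3 : ℝ≥0∞ := ENNReal.ofReal K * (D * V ^ (1 / (ENNReal.ofReal (p / (p - 1))).toReal
      - 1 / (ENNReal.ofReal p).toReal) + D ^ (p - 1)) with hB3
  have hB3t : B3 ≠ ⊤ := ENNReal.mul_ne_top ENNReal.ofReal_ne_top (ENNReal.add_ne_top.2
    ⟨ENNReal.mul_ne_top hD (hpow (by linarith) hp'2),
      ENNReal.rpow_ne_top_of_nonneg (by linarith) hD⟩)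
  refine ⟨B1 + B2 + B3, by simp [hB1t, hB2t, hB3t], fun U DU F G h hMU hDU => ?_⟩
  have hDU0 : eLpNorm DU (ENNReal.ofReal (critExp N)) volume ≤ E0 :=
    (eLpNorm_le_of_zero_off h.DU_zero (ENNReal.ofReal_le_ofReal hp)
      h.measurable_DU.aestronglyMeasurable).trans (mul_le_mul_left hDU _)
  have hU : eLpNorm U (ENNReal.ofReal (velExp N)) volume ≤ B1 := by
    refine (h.eLpNorm_U_le hN2 hp hC hM hMU).trans ?_
    rw [hB1]; gcongr
  have hF : eLpNorm F (ENNReal.ofReal (convExp N)) volume ≤ B2 := by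
    have := holderTriple_velExp_critExp hN0
    have h1c : (1 : ℝ≥0∞) ≤ ENNReal.ofReal (convExp N) := by simpa using one_le_convExp N
    have hconv : Measurable fun z => convect (U z) (DU z) :=
      continuous_convect.measurable.comp (h.measurable_U.prodMk h.measurable_DU)
    -- The first part has linear growth in the velocity on the cylinder; the second is the
    -- convective term, estimated by Hölder.
    have e : F = (fun z => F z - convect (U z) (DU z)) + fun z => convect (U z) (DU z) := by
      funext z; simp
    rw [e]
    refine (eLpNorm_add_le (h.measurable_F.sub hconv).aestronglyMeasurable
      hconv.aestronglyMeasurable h1c).trans (add_le_add ?_ ?_)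
    · set I : Vec N × ℝ → ℝ := (cylinder Q T).indicator fun _ => (1 : ℝ)
      have hI : Measurable I := measurable_const.indicator (measurableSet_cylinder hQ T)
      calc _ ≤ ENNReal.ofReal K * eLpNorm (fun z => I z + ‖U z‖) (ENNReal.ofReal (convExp N))
            volume := by
            refine eLpNorm_le_mul_eLpNorm_of_ae_le_mul ?_ _
            filter_upwards [h.growth_F] with z hz
            by_cases hc : z ∈ cylinder Q T
            · have hb := hz hc
              have hI1 : I z = 1 := by simp [I, hc]
              rw [hI1, Real.norm_of_nonneg (by positivity)]
              exact hb
            · simp [h.F_zero z hc, h.U_zero z hc, I, hc, zero_convect]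
        _ ≤ ENNReal.ofReal K * (eLpNorm I (ENNReal.ofReal (convExp N)) volume
            + eLpNorm (fun z => ‖U z‖) (ENNReal.ofReal (convExp N)) volume) := by
            gcongr
            exact eLpNorm_add_le hI.aestronglyMeasurable
              h.measurable_U.norm.aestronglyMeasurable h1c
        _ ≤ _ := by
            gcongr
            · rw [eLpNorm_indicator_const (measurableSet_cylinder hQ T)
                (by simpa using convExp_pos N) ENNReal.ofReal_ne_top]
              simp [hVdef]
            · rw [eLpNorm_norm]
              exact (eLpNorm_le_of_zero_off h.U_zero (ENNReal.ofReal_le_ofReal hcv)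
                h.measurable_U.aestronglyMeasurable).trans (mul_le_mul_left hU _)
    · exact (eLpNorm_convect_le h.measurable_U.aestronglyMeasurable
        h.measurable_DU.aestronglyMeasurable).trans (mul_le_mul' hU hDU0)
  have hG : eLpNorm G (ENNReal.ofReal (p / (p - 1))) volume ≤ B3 := by
    have h1p : (1 : ℝ≥0∞) ≤ ENNReal.ofReal (p / (p - 1)) := by simpa using hp'
    calc _ ≤ ENNReal.ofReal K * eLpNorm (fun z => ‖DU z‖ + ‖DU z‖ ^ (p - 1))
          (ENNReal.ofReal (p / (p - 1))) volume := by
          refine eLpNorm_le_mul_eLpNorm_of_ae_le_mul ?_ _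
          filter_upwards [h.growth_G] with z hz
          rwa [Real.norm_of_nonneg (by positivity)]
      _ ≤ ENNReal.ofReal K * (eLpNorm (fun z => ‖DU z‖) (ENNReal.ofReal (p / (p - 1))) volume
          + eLpNorm (fun z => ‖DU z‖ ^ (p - 1)) (ENNReal.ofReal (p / (p - 1))) volume) := by
          gcongr
          exact eLpNorm_add_le h.measurable_DU.norm.aestronglyMeasurable
            (h.measurable_DU.norm.pow_const _).aestronglyMeasurable h1p
      _ ≤ _ := by
          rw [hB3]
          gcongr
          · rw [eLpNorm_norm]
            exact (eLpNorm_le_of_zero_off h.DU_zero (ENNReal.ofReal_le_ofReal hp'2)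
              h.measurable_DU.aestronglyMeasurable).trans (mul_le_mul_left hDU _)
          · rw [eLpNorm_norm_rpow _ (by linarith), ← ENNReal.ofReal_mul (by linarith),
              div_mul_cancel₀ _ (by linarith : p - 1 ≠ 0)]
            exact ENNReal.rpow_le_rpow hDU (by linarith)
  exact ⟨hU.trans (by rw [add_assoc]; exact le_self_add),
    hF.trans (by rw [add_comm B1, add_assoc]; exact le_self_add), hG.trans le_add_self⟩

theorem memLp_all [IsFiniteMeasure (volume.restrict Q)] (hQ : MeasurableSet Q)
    (hN : N = 2 ∨ N = 3) (hp : critExp N ≤ p) (h : EvolutionData Q T p c K U DU F G) :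
    MemLp U (ENNReal.ofReal (velExp N)) volume ∧ MemLp F (ENNReal.ofReal (convExp N)) volume ∧
      MemLp G (ENNReal.ofReal (p / (p - 1))) volume := by
  obtain ⟨M, hM⟩ := h.bounded
  obtain ⟨B, hB, hb⟩ := exists_bound hQ hN hp T c K (M := M) ENNReal.coe_ne_top h.memLp_DU.2.ne
  obtain ⟨h1, h2, h3⟩ := hb U DU F G h hM le_rfl
  exact ⟨⟨h.measurable_U.aestronglyMeasurable, h1.trans_lt hB.lt_top⟩,
    ⟨h.measurable_F.aestronglyMeasurable, h2.trans_lt hB.lt_top⟩,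
    ⟨h.measurable_G.aestronglyMeasurable, h3.trans_lt hB.lt_top⟩⟩

end EvolutionData

end SpaceTime

/-! ### Weak evolutions and a common null set of times for all test fields. -/

section Evolution

variable {N : ℕ} {Q : Set (Vec N)} {T p c K : ℝ} {r : Vec N → ℝ} {u₀ : Vec N → Vec N}
  {U : Vec N × ℝ → Vec N} {DU : Vec N × ℝ → Grad N} {F : Vec N × ℝ → Vec N}
  {G : Vec N × ℝ → Grad N}

/-- The weak formulation at time `t`, tested with the field `v` whose gradient is `Dv`. -/
def WeakIdentity (Q : Set (Vec N)) (r : Vec N → ℝ) (u₀ : Vec N → Vec N) (U : Vec N × ℝ → Vec N)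
    (F : Vec N × ℝ → Vec N) (G : Vec N × ℝ → Grad N) (t : ℝ) (v : Vec N → Vec N)
    (Dv : Vec N → Grad N) : Prop :=
  (∫ x in Q, r x * inner ℝ (U (x, t)) (v x)) +
      ((∫ s in (0 : ℝ)..t, ∫ x, inner ℝ (F (x, s)) (v x)) +
        ∫ s in (0 : ℝ)..t, ∫ x, inner ℝ (G (x, s)) (Dv x)) =
    ∫ x in Q, r x * inner ℝ (u₀ x) (v x)

/-- A weak evolution with density `r`: the weak formulation holds at almost every time for all test
fields at once. -/
structure IsEvolution (Q : Set (Vec N)) (T p c K : ℝ) (r : Vec N → ℝ) (u₀ : Vec N → Vec N)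
    (U : Vec N × ℝ → Vec N) (DU : Vec N × ℝ → Grad N) (F : Vec N × ℝ → Vec N)
    (G : Vec N × ℝ → Grad N) : Prop extends EvolutionData Q T p c K U DU F G where
  weak : ∀ᵐ t, t ∈ Ioo 0 T → ∀ v Dv, MemV Q p v Dv → WeakIdentity Q r u₀ U F G t v Dv

theorem holderConjugate_ofReal (hp : 2 ≤ p) :
    (ENNReal.ofReal (p / (p - 1))).HolderConjugate (ENNReal.ofReal p) := by
  refine Real.HolderConjugate.ennrealOfReal ⟨?_, ?_, ?_⟩
  · have : p - 1 ≠ 0 := by linarith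
    have : p ≠ 0 := by linarith
    field_simp
    ring
  · exact div_pos (by linarith) (by linarith)
  · linarith

theorem memLp_density_smul {μ : Measure (Vec N)} {L : ℝ} (hr : Measurable r)
    (hL : ∀ᵐ x ∂μ, ‖r x‖ ≤ L) {g : Vec N → Vec N} (hg : MemLp g 2 μ) :
    MemLp (fun x => r x • g x) 2 μ := by
  refine MemLp.of_le_mul (c := L) hg (hr.aestronglyMeasurable.smul hg.1) ?_
  filter_upwards [hL] with x hx
  rw [norm_smul]
  gcongr

/-- By separability, the exceptional set of times in the weak formulation does not depend on the
test field. -/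
theorem EvolutionData.ae_forall_weakIdentity [IsFiniteMeasure (volume.restrict Q)]
    (hQ : MeasurableSet Q) (hN : N = 2 ∨ N = 3) (hp : critExp N ≤ p)
    (h : EvolutionData Q T p c K U DU F G) {L : ℝ} (hr : Measurable r)
    (hL : ∀ᵐ x ∂(volume.restrict Q), ‖r x‖ ≤ L) (hu₀ : MemLp u₀ 2 (volume.restrict Q))
    (hw : ∀ v Dv, MemV Q p v Dv → ∀ᵐ t, t ∈ Ioo 0 T → WeakIdentity Q r u₀ U F G t v Dv) :
    ∀ᵐ t, t ∈ Ioo 0 T → ∀ v Dv, MemV Q p v Dv → WeakIdentity Q r u₀ U F G t v Dv := by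
  have hN2 : 2 ≤ N := by omega
  have hN0 : 0 < N := by omega
  have h2p : 2 ≤ p := (two_le_critExp hN2).trans hp
  have h2q := two_le_velExp hN0
  have : Fact (1 ≤ ENNReal.ofReal (velExp N)) := ⟨by simpa using one_le_two.trans h2q⟩
  have : Fact (ENNReal.ofReal (velExp N) ≠ ⊤) := ⟨ENNReal.ofReal_ne_top⟩
  have : Fact (1 ≤ ENNReal.ofReal p) := ⟨by simpa using one_le_two.trans h2p⟩
  have : Fact (ENNReal.ofReal p ≠ ⊤) := ⟨ENNReal.ofReal_ne_top⟩
  have := holderConjugate_convExp_velExp hN0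
  have := holderConjugate_ofReal h2p
  obtain ⟨hUq, hFq, hGq⟩ := h.memLp_all hQ hN hp
  let Pairs := {P : (Vec N → Vec N) × (Vec N → Grad N) // MemV Q p P.1 P.2}
  have hq : ∀ P : Pairs, MemLp P.1.1 (ENNReal.ofReal (velExp N)) (volume.restrict Q) := fun P =>
    P.2.memLp_velExp hN hp
  let Φ : Pairs → Lp (Vec N) (ENNReal.ofReal (velExp N)) (volume.restrict Q)
      × Lp (Grad N) (ENNReal.ofReal p) (volume.restrict Q) := fun P =>
    ((hq P).toLp P.1.1, P.2.2.1.toLp P.1.2)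
  -- Both sides of the weak identity are continuous in the test pair for this topology, and it is
  -- second countable because the `L^p` spaces are; so a countable dense set of test fields
  -- suffices.
  let : TopologicalSpace Pairs := TopologicalSpace.induced Φ inferInstance
  have hΦ : Continuous Φ := continuous_induced_dom
  have : SecondCountableTopology (Lp (Vec N) (ENNReal.ofReal (velExp N)) (volume.restrict Q)) :=
    Lp.SecondCountableTopology
  have : SecondCountableTopology (Lp (Grad N) (ENNReal.ofReal p) (volume.restrict Q)) :=
    Lp.SecondCountableTopology
  have : SecondCountableTopology Pairs := TopologicalSpace.secondCountableTopology_induced _ _ _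
  have hzero : IsSolenoidalTest Q (0 : Vec N → Vec N) :=
    { smooth := contDiff_const
      compactSupport := HasCompactSupport.zero
      support_subset := by simp
      divergence_free := fun x => by simp [partialDeriv] }
  have : Nonempty Pairs := ⟨⟨(0, grad 0), hzero.memV⟩⟩
  have hU2 : ∀ᵐ t, t ∈ Ioo 0 T → MemLp (fun x => U (x, t)) 2 (volume.restrict Q) := by
    filter_upwards [h.memV] with t ht htT
    exact (ht htT).memLp_two h2p
  have hseq : ∀ᵐ t, ∀ n, t ∈ Ioo 0 T → WeakIdentity Q r u₀ U F G t
      (TopologicalSpace.denseSeq Pairs n).1.1 (TopologicalSpace.denseSeq Pairs n).1.2 :=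
    ae_all_iff.2 fun n => hw _ _ (TopologicalSpace.denseSeq Pairs n).2
  filter_upwards [hseq, hU2] with t ht htU htT v Dv hv
  obtain ⟨d, hd, hdlim⟩ := mem_closure_iff_seq_limit.1
    (TopologicalSpace.denseRange_denseSeq Pairs (⟨(v, Dv), hv⟩ : Pairs))
  have hlim := (hΦ.tendsto _).comp hdlim
  have hlimv : Tendsto (fun n => eLpNorm ((d n).1.1 - v) (ENNReal.ofReal (velExp N))
      (volume.restrict Q)) atTop (𝓝 0) := by
    have h1 := tendsto_iff_edist_tendsto_0.1 ((continuous_fst.tendsto _).comp hlim)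
    refine h1.congr fun n => ?_
    exact Lp.edist_toLp_toLp _ _ (hq (d n)) (hq ⟨(v, Dv), hv⟩)
  have hlimD : Tendsto (fun n => eLpNorm ((d n).1.2 - Dv) (ENNReal.ofReal p)
      (volume.restrict Q)) atTop (𝓝 0) := by
    have h1 := tendsto_iff_edist_tendsto_0.1 ((continuous_snd.tendsto _).comp hlim)
    refine h1.congr fun n => ?_
    exact Lp.edist_toLp_toLp _ _ (d n).2.2.1 hv.2.1
  have hlim2 : Tendsto (fun n => eLpNorm ((d n).1.1 - v) 2 (volume.restrict Q)) atTop (𝓝 0) :=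
    tendsto_eLpNorm_sub_of_le (by
      rw [← ENNReal.ofReal_ofNat]; exact ENNReal.ofReal_le_ofReal h2q)
      (fun n => (hq (d n)).1) hv.1.1 hlimv (by simp)
  have hpair : ∀ {g : Vec N → Vec N}, MemLp g 2 (volume.restrict Q) →
      Tendsto (fun n => ∫ x in Q, r x * inner ℝ (g x) ((d n).1.1 x)) atTop
        (𝓝 (∫ x in Q, r x * inner ℝ (g x) (v x))) := by
    intro g hg
    have := tendsto_integral_inner (r := 2) (s := 2) (memLp_density_smul hr hL hg)
      (fun n => (d n).2.memLp_two h2p) (hv.memLp_two h2p) hlim2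
    simpa only [real_inner_smul_left] using this
  have hlhs := (hpair (htU htT)).add ((tendsto_intervalIntegral_inner ENNReal.ofReal_ne_top hQ hFq
    h.F_zero (fun n => hq (d n)) (hv.memLp_velExp hN hp) hlimv htT.1.le).add
    (tendsto_intervalIntegral_inner ENNReal.ofReal_ne_top hQ hGq
      h.G_zero (fun n => (d n).2.2.1) hv.2.1 hlimD htT.1.le))
  refine tendsto_nhds_unique hlhs ((hpair hu₀).congr fun n => ?_)
  obtain ⟨m, hm⟩ := hd n
  have := ht m htT
  rw [hm] at this
  exact this.symm

/-- The action of the matrix `A` on gradients. -/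
def linStress (A : Matrix (Fin N) (Fin N) ℝ) (K : Grad N) : Grad N :=
  WithLp.toLp 2 fun ik : Fin N × Fin N => ∑ j, A ik.1 j * K (j, ik.2)

theorem inner_linStress (A : Matrix (Fin N) (Fin N) ℝ) (K H : Grad N) :
    inner ℝ (linStress A K) H = ∑ k, ∑ i, ∑ j, A i j * K (j, k) * H (i, k) := by
  rw [PiLp.inner_apply, Fintype.sum_prod_type_right]
  refine Finset.sum_congr rfl fun k _ => Finset.sum_congr rfl fun i _ => ?_
  simp [linStress, Finset.mul_sum, mul_comm]

theorem norm_linStress_le {A : Matrix (Fin N) (Fin N) ℝ} {M : ℝ} (hM : 0 ≤ M)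
    (hA : ∀ i j, ‖A i j‖ ≤ M) (K : Grad N) : ‖linStress A K‖ ≤ N * M * ‖K‖ := by
  refine le_of_sq_le_sq ?_ (by positivity)
  rw [mul_pow, EuclideanSpace.real_norm_sq_eq, EuclideanSpace.real_norm_sq_eq K,
    Fintype.sum_prod_type_right, Fintype.sum_prod_type_right, Finset.mul_sum]
  refine Finset.sum_le_sum fun k _ => ?_
  have h1 : ∀ i, ∑ j, A i j ^ 2 ≤ N * M ^ 2 := by
    intro i
    calc _ ≤ ∑ _j : Fin N, M ^ 2 := Finset.sum_le_sum fun j _ => by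
          rw [← sq_abs]; exact pow_le_pow_left₀ (abs_nonneg _) (hA i j) 2
      _ = N * M ^ 2 := by simp
  calc _ ≤ ∑ i, (∑ j, A i j ^ 2) * ∑ j, K (j, k) ^ 2 := Finset.sum_le_sum fun i _ =>
        Finset.sum_mul_sq_le_sq_mul_sq Finset.univ (fun j => A i j) fun j => K (j, k)
    _ ≤ ∑ _i : Fin N, (N * M ^ 2) * ∑ j, K (j, k) ^ 2 := by
        gcongr with i
        exact h1 i
    _ = _ := by simp; ring

theorem inner_linStress_self_nonneg {A : Matrix (Fin N) (Fin N) ℝ} {ν : ℝ} (hν : 0 ≤ ν)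
    (hA : ∀ l : Vec N, ν * ‖l‖ ^ 2 ≤ ∑ i, ∑ j, A i j * l j * l i) (K : Grad N) :
    0 ≤ (inner ℝ (linStress A K) K : ℝ) := by
  rw [inner_linStress]
  refine Finset.sum_nonneg fun k _ => ?_
  have := hA (WithLp.toLp 2 fun i => K (i, k))
  exact le_trans (by positivity) this

theorem measurable_linStress {A : Vec N × ℝ → Matrix (Fin N) (Fin N) ℝ}
    (hA : ∀ i j, Measurable fun z => A z i j) (hDU : Measurable DU) :
    Measurable fun z => linStress (A z) (DU z) := by
  refine (PiLp.continuous_toLp 2 _).measurable.comp (measurable_pi_lambda _ fun ik => ?_)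
  refine Finset.measurable_sum _ fun j _ => (hA _ _).mul ?_
  exact (EuclideanSpace.proj (𝕜 := ℝ) (j, ik.2)).continuous.measurable.comp hDU

theorem linStress_zero (A : Matrix (Fin N) (Fin N) ℝ) : linStress A (0 : Grad N) = 0 := by
  ext j; simp [linStress]

/-- Needed to split the space integral of a sum of forces or stresses at a fixed time; such a
splitting requires each part to be integrable. -/
theorem ae_integrable_inner_slice {E : Type*} [NormedAddCommGroup E] [InnerProductSpace ℝ E]
    [MeasurableSpace E] [BorelSpace E] [SecondCountableTopology E] {v : Vec N → E}
    {f : Vec N × ℝ → E} {s s' : ℝ≥0∞} [ENNReal.HolderConjugate s s'] (hQ : MeasurableSet Q)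
    (hf : MemLp f s volume) (hf0 : ∀ z, z ∉ cylinder Q T → f z = 0)
    (hv : MemLp v s' (volume.restrict Q)) :
    ∀ᵐ t, Integrable fun x => (inner ℝ (f (x, t)) (v x) : ℝ) := by
  have h := integrable_inner_slab (T := T) hQ hf hv T
  rw [Measure.volume_eq_prod] at h
  filter_upwards [h.prod_left_ae] with t ht
  refine ht.congr (ae_of_all _ fun x => ?_)
  by_cases hx : (x, t) ∈ cylinder Q T
  · simp [slab, hx, hx.2.2.le]
  · simp [hf0 _ hx]

end Evolution

/-! ### From velocity solutions to weak evolutions, uniformly in the scale. -/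

section Derivation

variable {N : ℕ} {Q : Set (Vec N)} {T p : ℝ}

/-- The parabolic rescaling. -/
def rescale (N : ℕ) (ε : ℝ) : Vec N × ℝ → Vec N × ℝ := Prod.map (fun x => ε⁻¹ • x) fun t => t / ε ^ 2

/-- Preimages of null sets are null, so bounds valid almost everywhere for the coefficients carry
over to the rescaled ones with the same constants. -/
theorem quasiMeasurePreserving_rescale {ε : ℝ} (hε : 0 < ε) :
    Measure.QuasiMeasurePreserving (rescale N ε) volume volume := by
  rw [Measure.volume_eq_prod]
  refine QuasiMeasurePreserving.prodMap
    (Measure.quasiMeasurePreserving_smul _ (inv_ne_zero hε.ne')) ?_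
  have h := Measure.quasiMeasurePreserving_smul (volume : Measure ℝ)
    (inv_ne_zero (pow_ne_zero 2 hε.ne'))
  convert h using 2 with t
  rw [smul_eq_mul, div_eq_inv_mul]

/-- A velocity solution gives rise to a weak evolution, with constants which do not depend on the
scale. -/
theorem IsVelocitySolution.exists_isEvolution [IsFiniteMeasure (volume.restrict Q)]
    (hQ : MeasurableSet Q) (hN : N = 2 ∨ N = 3) (hp : critExp N ≤ p)
    {ρ : Vec N → ℝ} {a : Vec N × ℝ → Matrix (Fin N) (Fin N) ℝ} {b : Vec N × ℝ → ℝ}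
    {f : ℝ → Vec N → Vec N} {u₀ : Vec N → Vec N} {ε : ℝ} {u : Vec N × ℝ → Vec N}
    (hρm : AEStronglyMeasurable ρ volume) {L : ℝ} (hL : 0 < L)
    (hρ : ∀ᵐ y, L⁻¹ ≤ ρ y ∧ ρ y ≤ L)
    (ham : ∀ i j, AEStronglyMeasurable (fun z => a z i j) volume) {A : ℝ} (hA : 0 ≤ A)
    (haA : ∀ᵐ z, ∀ i j, ‖a z i j‖ ≤ A) {ν₀ : ℝ} (hν₀ : 0 < ν₀)
    (haν : ∀ᵐ z, ∀ l : Vec N, ν₀ * ‖l‖ ^ 2 ≤ ∑ i, ∑ j, a z i j * l j * l i)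
    (hbm : AEStronglyMeasurable b volume) {ν₁ ν₂ : ℝ} (hν₁ : 0 < ν₁) (hν₂ : 0 < ν₂)
    (hb : ∀ᵐ z, ν₁ ≤ b z ∧ b z ≤ ν₂)
    (hfc : Continuous fun z : ℝ × Vec N => f z.1 z.2) {k : ℝ} (hk : 0 < k)
    (hf0 : ∀ τ, ‖f τ 0‖ ≤ k) (hfL : ∀ τ r₁ r₂, ‖f τ r₁ - f τ r₂‖ ≤ k * ‖r₁ - r₂‖)
    (hu₀ : MemLp u₀ 2 (volume.restrict Q)) (hε : 0 < ε)
    (hu : IsVelocitySolution Q T p ρ a b f u₀ ε u) :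
    ∃ r U DU F G, Measurable r ∧ (∀ᵐ x, L⁻¹ ≤ r x ∧ r x ≤ L) ∧
      IsEvolution Q T p ν₁ (N * A + ν₂ + L * k) r u₀ U DU F G ∧

      u =ᵐ[volume.restrict (cylinder Q T)] U := by
  have hN2 : 2 ≤ N := by omega
  have hN0 : 0 < N := by omega
  have h2p : 2 ≤ p := (two_le_critExp hN2).trans hp
  have := holderConjugate_convExp_velExp hN0
  have := holderConjugate_ofReal h2p
  have hcyl := measurableSet_cylinder (T := T) hQ
  obtain ⟨hH, Du, hV, hweak⟩ := hu
  -- measurable representatives of the coefficients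
  have hS := quasiMeasurePreserving_rescale (N := N) hε
  have hS1 := Measure.quasiMeasurePreserving_smul (volume : Measure (Vec N)) (inv_ne_zero hε.ne')
  have ham' : ∀ i j, AEStronglyMeasurable (fun z => a (rescale N ε z) i j) volume := fun i j =>
    (ham i j).comp_quasiMeasurePreserving hS
  have hbm' : AEStronglyMeasurable (fun z => b (rescale N ε z)) volume :=
    hbm.comp_quasiMeasurePreserving hS
  have hρm' : AEStronglyMeasurable (fun x => ρ (ε⁻¹ • x)) volume :=
    hρm.comp_quasiMeasurePreserving hS1
  obtain ⟨α, hαm, hα⟩ : ∃ α : Vec N × ℝ → Matrix (Fin N) (Fin N) ℝ,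
      (∀ i j, Measurable fun z => α z i j) ∧ ∀ᵐ z, ∀ i j, α z i j = a (rescale N ε z) i j := by
    refine ⟨fun z => Matrix.of fun i j => (ham' i j).mk _ z,
      fun i j => (ham' i j).stronglyMeasurable_mk.measurable, ?_⟩
    refine ae_all_iff.2 fun i => ae_all_iff.2 fun j => ?_
    filter_upwards [(ham' i j).ae_eq_mk] with z hz
    exact hz.symm
  obtain ⟨β, hβm, hβ⟩ : ∃ β : Vec N × ℝ → ℝ, Measurable β ∧ ∀ᵐ z, β z = b (rescale N ε z) :=
    ⟨_, hbm'.stronglyMeasurable_mk.measurable, hbm'.ae_eq_mk.mono fun z hz => hz.symm⟩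
  obtain ⟨r, hrm, hr⟩ : ∃ r : Vec N → ℝ, Measurable r ∧ ∀ᵐ x, r x = ρ (ε⁻¹ • x) :=
    ⟨_, hρm'.stronglyMeasurable_mk.measurable, hρm'.ae_eq_mk.mono fun z hz => hz.symm⟩
  have hrL : ∀ᵐ x, L⁻¹ ≤ r x ∧ r x ≤ L := by
    filter_upwards [hr, hS1.ae hρ] with x hx hx'
    rw [hx]; exact hx'
  have hβν : ∀ᵐ z, ν₁ ≤ β z ∧ β z ≤ ν₂ := by
    filter_upwards [hβ, hS.ae hb] with x hx hx'
    rw [hx]; exact hx'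
  have hαA : ∀ᵐ z, ∀ i j, ‖α z i j‖ ≤ A := by
    filter_upwards [hα, hS.ae haA] with x hx hx' i j
    rw [hx]; exact hx' i j
  have hαν : ∀ᵐ z, ∀ l : Vec N, ν₀ * ‖l‖ ^ 2 ≤ ∑ i, ∑ j, α z i j * l j * l i := by
    filter_upwards [hα, hS.ae haν] with x hx hx' l
    simp_rw [hx]; exact hx' l
  -- measurable representatives of the solution
  have hrep : ∀ {E : Type} [NormedAddCommGroup E] [MeasurableSpace E] [BorelSpace E]
      [SecondCountableTopology E] {w : Vec N × ℝ → E},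
      AEStronglyMeasurable w (volume.restrict (cylinder Q T)) → ∃ W : Vec N × ℝ → E,
        Measurable W ∧ (∀ z, z ∉ cylinder Q T → W z = 0) ∧
          w =ᵐ[volume.restrict (cylinder Q T)] W := by
    intro E _ _ _ _ w hw
    refine ⟨(cylinder Q T).indicator (hw.mk w), hw.stronglyMeasurable_mk.measurable.indicator hcyl,
      fun z hz => indicator_of_notMem hz _, ?_⟩
    exact hw.ae_eq_mk.trans (indicator_ae_eq_restrict hcyl).symm
  obtain ⟨U, hUm, hU0, hU⟩ := hrep hH.aestronglyMeasurable
  obtain ⟨DU, hDUm, hDU0, hDU⟩ := hrep hV.memLp_grad.1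
  have hslice : ∀ {P : Vec N × ℝ → Prop}, (∀ᵐ z ∂(volume.restrict (cylinder Q T)), P z) →
      ∀ᵐ t, t ∈ Ioo 0 T → ∀ᵐ x ∂(volume.restrict Q), P (x, t) := by
    intro P hP
    rw [volume_restrict_cylinder] at hP
    exact (ae_restrict_iff' measurableSet_Ioo).1 (ae_slices hP)
  have hUs := hslice hU
  have hDUs := hslice hDU
  have hαs := hslice (ae_restrict_of_ae hα)
  have hβs := hslice (ae_restrict_of_ae hβ)
  have hVs := (ae_restrict_iff' measurableSet_Ioo).1 hV.memV
  have hmemV : ∀ᵐ t, t ∈ Ioo 0 T → MemV Q p (fun x => U (x, t)) (fun x => DU (x, t)) := by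
    filter_upwards [hUs, hDUs, hVs] with t h1 h2 h3 ht
    exact (h3 ht).congr (h1 ht) (h2 ht)
  set F₁ : Vec N × ℝ → Vec N := fun z => convect (U z) (DU z) with hF₁
  set F₂ : Vec N × ℝ → Vec N :=
    (cylinder Q T).indicator fun z => r z.1 • f (z.2 / ε ^ 2) (U z) with hF₂
  set G₁ : Vec N × ℝ → Grad N := fun z => linStress (α z) (DU z) with hG₁
  set G₂ : Vec N × ℝ → Grad N := fun z => (β z * ‖DU z‖ ^ (p - 2)) • DU z with hG₂
  have hF₁m : Measurable F₁ := continuous_convect.measurable.comp (hUm.prodMk hDUm)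
  have hF₂m : Measurable F₂ := by
    refine Measurable.indicator ?_ hcyl
    exact (hrm.comp measurable_fst).smul
      (hfc.measurable.comp ((measurable_snd.div_const _).prodMk hUm))
  have hG₁m : Measurable G₁ := measurable_linStress hαm hDUm
  have hG₂m : Measurable G₂ := (hβm.mul (hDUm.norm.pow_const _)).smul hDUm
  have hF₁0 : ∀ z, z ∉ cylinder Q T → F₁ z = 0 := fun z hz => by
    simp only [hF₁, hU0 z hz, zero_convect]
  have hF₂0 : ∀ z, z ∉ cylinder Q T → F₂ z = 0 := fun z hz => indicator_of_notMem hz _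
  have hG₁0 : ∀ z, z ∉ cylinder Q T → G₁ z = 0 := fun z hz => by
    simp only [hG₁, hDU0 z hz, linStress_zero]
  have hG₂0 : ∀ z, z ∉ cylinder Q T → G₂ z = 0 := fun z hz => by
    simp only [hG₂, hDU0 z hz, smul_zero]
  have hK : 0 ≤ N * A + ν₂ + L * k := by positivity
  -- For `p = 2` the first factor is `0 ^ 0 = 1` where the gradient vanishes; the second factor
  -- makes both sides zero there.
  have hpow : ∀ z, ‖DU z‖ ^ (p - 2) * ‖DU z‖ = ‖DU z‖ ^ (p - 1) := by
    intro z
    rcases (norm_nonneg (DU z)).eq_or_lt with h0 | h0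
    · rw [← h0, mul_zero, Real.zero_rpow (by linarith)]
    · rw [← Real.rpow_add_one h0.ne']; congr 1; ring
  have hpow2 : ∀ z, ‖DU z‖ ^ (p - 1) * ‖DU z‖ = ‖DU z‖ ^ p := by
    intro z
    rcases (norm_nonneg (DU z)).eq_or_lt with h0 | h0
    · rw [← h0, mul_zero, Real.zero_rpow (by linarith)]
    · rw [← Real.rpow_add_one h0.ne']; congr 1; ring
  have hG₂n : ∀ᵐ z, ‖G₂ z‖ ≤ ν₂ * ‖DU z‖ ^ (p - 1) := by
    filter_upwards [hβν] with z hz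
    simp only [hG₂]
    have hβ0 : 0 ≤ β z := hν₁.le.trans hz.1
    rw [norm_smul, Real.norm_of_nonneg (by positivity), mul_assoc, hpow]
    gcongr
    exact hz.2
  have hG₂c : ∀ᵐ z, ν₁ * ‖DU z‖ ^ p ≤ inner ℝ (G₂ z) (DU z) := by
    filter_upwards [hβν] with z hz
    simp only [hG₂]
    rw [real_inner_smul_left, real_inner_self_eq_norm_sq, mul_assoc, pow_two, ← mul_assoc
      (‖DU z‖ ^ (p - 2)), hpow, hpow2]
    gcongr
    exact hz.1
  -- Auxiliary data with the convective force and the power-law stress only. They give the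
  -- integrability of `F₁` and `G₂` separately; subtracting from the full data gives that of `F₂`
  -- and `G₁`.
  have hbase : EvolutionData Q T p ν₁ (N * A + ν₂ + L * k) U DU F₁ G₂ :=
    { measurable_U := hUm
      measurable_DU := hDUm
      measurable_F := hF₁m
      measurable_G := hG₂m
      U_zero := hU0
      DU_zero := hDU0
      F_zero := hF₁0
      G_zero := hG₂0
      memLp_DU := by
        have h1 : MemLp DU (ENNReal.ofReal p) (volume.restrict (cylinder Q T)) :=
          (memLp_congr_ae hDU).1 hV.memLp_grad
        rw [← memLp_indicator_iff_restrict hcyl] at h1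
        rwa [indicator_eq_self.2 fun z hz => by_contra fun hc => hz (hDU0 z hc)] at h1
      bounded := by
        obtain ⟨C, hC⟩ := hH.bounded
        refine ⟨C, ?_⟩
        filter_upwards [(ae_restrict_iff' measurableSet_Ioo).1 hC, hUs] with t h1 h2 ht
        rw [← eLpNorm_congr_ae (h2 ht)]
        exact h1 ht
      memV := hmemV
      coercive := hG₂c
      growth_G := by
        filter_upwards [hG₂n] with z hz
        refine hz.trans ?_
        have h1 : 0 ≤ ‖DU z‖ ^ (p - 1) := by positivity
        have h2 : 0 ≤ (N * A + L * k) := by positivity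
        nlinarith [mul_nonneg h2 h1, mul_nonneg hK (norm_nonneg (DU z))]
      growth_F := ae_of_all _ fun z _ => by
        simp only [hF₁, sub_self, norm_zero]; positivity }
  have hG₁n : ∀ᵐ z, ‖G₁ z‖ ≤ N * A * ‖DU z‖ := by
    filter_upwards [hαA] with z hz
    exact norm_linStress_le hA hz _
  have hF₂n : ∀ᵐ z : Vec N × ℝ, ‖F₂ z‖ ≤ L * k * (1 + ‖U z‖) := by
    have hrL' : ∀ᵐ z : Vec N × ℝ, L⁻¹ ≤ r z.1 ∧ r z.1 ≤ L :=
      Measure.quasiMeasurePreserving_fst.ae hrL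
    filter_upwards [hrL'] with z hz
    have hfz : ∀ τ w, ‖f τ w‖ ≤ k * (1 + ‖w‖) := by
      intro τ w
      have h1 := hfL τ w 0
      rw [sub_zero] at h1
      have h2 := norm_add_le (f τ w - f τ 0) (f τ 0)
      rw [sub_add_cancel] at h2
      linarith [hf0 τ]
    have hr0 : 0 ≤ r z.1 := (inv_nonneg.2 hL.le).trans hz.1
    refine (norm_indicator_le_norm_self _ _).trans ?_
    rw [norm_smul, Real.norm_of_nonneg hr0, mul_assoc]
    exact mul_le_mul hz.2 (hfz _ _) (norm_nonneg _) hL.le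
  have hdata : EvolutionData Q T p ν₁ (N * A + ν₂ + L * k) U DU (F₁ - F₂) (G₁ + G₂) :=
    { hbase with
      measurable_F := hF₁m.sub hF₂m
      measurable_G := hG₁m.add hG₂m
      F_zero := fun z hz => by simp [hF₁0 z hz, hF₂0 z hz]
      G_zero := fun z hz => by simp [hG₁0 z hz, hG₂0 z hz]
      -- The power-law part carries all the coercivity; the linear part only has to be nonnegative.
      coercive := by
        filter_upwards [hG₂c, hαν] with z h1 h2
        rw [Pi.add_apply, inner_add_left]
        linarith [inner_linStress_self_nonneg hν₀.le h2 (DU z)]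
      growth_G := by
        filter_upwards [hG₁n, hG₂n] with z h1 h2
        have h3 : 0 ≤ ‖DU z‖ ^ (p - 1) := by positivity
        have h4 : 0 ≤ (N * A + L * k) := by positivity
        have h5 : 0 ≤ (ν₂ + L * k) := by positivity
        refine (norm_add_le _ _).trans ((add_le_add h1 h2).trans ?_)
        nlinarith [mul_nonneg h4 h3, mul_nonneg h5 (norm_nonneg (DU z))]
      growth_F := by
        filter_upwards [hF₂n] with z h1 _
        simp only [Pi.sub_apply, hF₁, sub_sub_cancel_left, norm_neg]
        refine h1.trans ?_
        gcongr
        have : 0 ≤ N * A + ν₂ := by positivity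
        linarith }
  obtain ⟨hUq, hF₁q, hG₂q⟩ := hbase.memLp_all hQ hN hp
  obtain ⟨-, hFq, hGq⟩ := hdata.memLp_all hQ hN hp
  have hF₂q : MemLp F₂ (ENNReal.ofReal (convExp N)) volume := by
    simpa using hF₁q.sub hFq
  have hG₁q : MemLp G₁ (ENNReal.ofReal (p / (p - 1))) volume := by
    simpa using hGq.sub hG₂q
  refine ⟨r, U, DU, F₁ - F₂, G₁ + G₂, hrm, hrL, ⟨hdata, ?_⟩, hU⟩
  refine hdata.ae_forall_weakIdentity hQ hN hp hrm (L := L) ?_ hu₀ fun v Dv hv => ?_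
  · filter_upwards [ae_restrict_of_ae hrL] with x hx
    rw [Real.norm_of_nonneg ((inv_nonneg.2 hL.le).trans hx.1)]
    exact hx.2
  have hvq := hv.memLp_velExp hN hp
  have hrQ : ∀ᵐ x ∂(volume.restrict Q), r x = ρ (ε⁻¹ • x) := ae_restrict_of_ae hr
  have hoff : ∀ {E : Type} [NormedAddCommGroup E] [InnerProductSpace ℝ E] {g : Vec N × ℝ → E}
      {w : Vec N → E}, (∀ z, z ∉ cylinder Q T → g z = 0) → ∀ s,
      ∫ x, (inner ℝ (g (x, s)) (w x) : ℝ) = ∫ x in Q, (inner ℝ (g (x, s)) (w x) : ℝ) := by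
    intro E _ _ g w hg s
    refine (setIntegral_eq_integral_of_forall_compl_eq_zero fun x hx => ?_).symm
    rw [hg _ fun hc => hx hc.1, inner_zero_left]
  have haf : ∀ᵐ s, s ∈ Ioo 0 T → aForm Q a b p ε s (fun x => Du (x, s)) Dv
      = ∫ x, inner ℝ ((G₁ + G₂) (x, s)) (Dv x) := by
    filter_upwards [hDUs, hαs, hβs, ae_integrable_inner_slice hQ hG₁q hG₁0 hv.2.1,
      ae_integrable_inner_slice hQ hG₂q hG₂0 hv.2.1] with s h1 h2 h3 h4 h5 hs
    simp only [Pi.add_apply, inner_add_left]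
    rw [integral_add h4 h5, hoff hG₁0, hoff hG₂0, aForm]
    congr 1
    · refine integral_congr_ae ?_
      filter_upwards [h1 hs, h2 hs] with x hx hx'
      simp only [hG₁, inner_linStress, hx, hx']
      rfl
    · refine integral_congr_ae ?_
      filter_upwards [h1 hs, h3 hs] with x hx hx'
      simp only [hG₂, real_inner_smul_left, hx, hx']
      rfl
  have hbf : ∀ᵐ s, s ∈ Ioo 0 T → bForm Q (fun x => u (x, s)) (fun x => Du (x, s)) v
      = ∫ x, inner ℝ (F₁ (x, s)) (v x) := by
    filter_upwards [hUs, hDUs, hmemV] with s h1 h2 h3 hs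
    rw [hoff hF₁0]
    simp only [hF₁]
    rw [← bForm_eq_integral hN0 ((h3 hs).memLp_velExp hN hp) ((h3 hs).memLp_grad hp) hvq]
    refine Finset.sum_congr rfl fun i _ => Finset.sum_congr rfl fun j _ => ?_
    refine integral_congr_ae ?_
    filter_upwards [h1 hs, h2 hs] with x hx hx'
    rw [hx, hx']
  have hff : ∀ᵐ s, s ∈ Ioo 0 T → rhoInner Q ρ ε (fun x => f (s / ε ^ 2) (u (x, s))) v
      = ∫ x, inner ℝ (F₂ (x, s)) (v x) := by
    filter_upwards [hUs] with s h1 hs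
    rw [hoff hF₂0]
    refine integral_congr_ae ?_
    filter_upwards [h1 hs, hrQ, ae_restrict_mem hQ] with x hx hx' hxQ
    have hc : (x, s) ∈ cylinder Q T := ⟨hxQ, hs⟩
    simp only [hF₂, indicator_of_mem hc, real_inner_smul_left, hx, hx']
  have hFsplit : ∀ᵐ s : ℝ, ∫ x, (inner ℝ ((F₁ - F₂) (x, s)) (v x) : ℝ)
      = (∫ x, inner ℝ (F₁ (x, s)) (v x)) - ∫ x, inner ℝ (F₂ (x, s)) (v x) := by
    filter_upwards [ae_integrable_inner_slice hQ hF₁q hF₁0 hvq,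
      ae_integrable_inner_slice hQ hF₂q hF₂0 hvq] with s h1 h2
    rw [← integral_sub h1 h2]
    simp only [Pi.sub_apply, inner_sub_left]
  filter_upwards [(ae_restrict_iff' measurableSet_Ioo).1 (hweak v Dv hv), hUs] with t ht hUt htT
  have hsub : ∀ s ∈ Ioc 0 t, s ∈ Ioo 0 T := fun s hs => ⟨hs.1, hs.2.trans_lt htT.2⟩
  have hcongr : ∀ {f g : ℝ → ℝ}, (∀ᵐ s, s ∈ Ioo 0 T → f s = g s) →
      ∫ s in (0 : ℝ)..t, f s = ∫ s in (0 : ℝ)..t, g s := by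
    intro f g hfg
    rw [intervalIntegral.integral_of_le htT.1.le, intervalIntegral.integral_of_le htT.1.le]
    refine setIntegral_congr_ae measurableSet_Ioc ?_
    filter_upwards [hfg] with s h1 hs
    exact h1 (hsub s hs)
  have hiG := intervalIntegrable_inner hQ hGq hdata.G_zero hv.2.1 htT.1.le
  have hiF₁ := intervalIntegrable_inner hQ hF₁q hF₁0 hvq htT.1.le
  have hiF₂ := intervalIntegrable_inner hQ hF₂q hF₂0 hvq htT.1.le
  have e1 : ∫ s in (0 : ℝ)..t, (aForm Q a b p ε s (fun x => Du (x, s)) Dv +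
      bForm Q (fun x => u (x, s)) (fun x => Du (x, s)) v)
      = (∫ s in (0 : ℝ)..t, ∫ x, inner ℝ ((G₁ + G₂) (x, s)) (Dv x))
        + ∫ s in (0 : ℝ)..t, ∫ x, inner ℝ (F₁ (x, s)) (v x) := by
    rw [← intervalIntegral.integral_add hiG hiF₁]
    refine hcongr ?_
    filter_upwards [haf, hbf] with s h1 h2 hs
    rw [h1 hs, h2 hs]
  have e2 := hcongr hff
  have e3 : ∫ s in (0 : ℝ)..t, ∫ x, (inner ℝ ((F₁ - F₂) (x, s)) (v x) : ℝ)
      = (∫ s in (0 : ℝ)..t, ∫ x, inner ℝ (F₁ (x, s)) (v x))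
        - ∫ s in (0 : ℝ)..t, ∫ x, inner ℝ (F₂ (x, s)) (v x) := by
    rw [← intervalIntegral.integral_sub hiF₁ hiF₂]
    exact hcongr (hFsplit.mono fun s hs _ => hs)
  have e4 : rhoInner Q ρ ε (fun x => u (x, t)) v = ∫ x in Q, r x * inner ℝ (U (x, t)) (v x) := by
    refine integral_congr_ae ?_
    filter_upwards [hUt htT, hrQ] with x hx hx'
    simp only [hx, hx']
  have e5 : rhoInner Q ρ ε u₀ v = ∫ x in Q, r x * inner ℝ (u₀ x) (v x) := by
    refine integral_congr_ae ?_
    filter_upwards [hrQ] with x hx'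
    simp only [hx']
  have := ht htT
  rw [e1, e2, e4, e5] at this
  rw [WeakIdentity, e3]
  linarith

end Derivation

/-! ### The weighted `L²` product and the increment formula. -/

section Energy

/-- The inner product of `L²(Q)` with weight `r`. -/
def weightedInner {N : ℕ} (Q : Set (Vec N)) (r : Vec N → ℝ) (v w : Vec N → Vec N) : ℝ :=
  ∫ x in Q, r x * inner ℝ (v x) (w x)

variable {N : ℕ} {Q : Set (Vec N)} {T p c K L : ℝ} {r : Vec N → ℝ} {u₀ : Vec N → Vec N}
  {U : Vec N × ℝ → Vec N} {DU : Vec N × ℝ → Grad N} {F : Vec N × ℝ → Vec N}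
  {G : Vec N × ℝ → Grad N} {v w z : Vec N → Vec N}

theorem integrable_inner_of_holderConjugate {α E : Type*} [MeasurableSpace α]
    [NormedAddCommGroup E] [InnerProductSpace ℝ E] [MeasurableSpace E] [BorelSpace E]
    [SecondCountableTopology E] {μ : Measure α} {a b : ℝ≥0∞} [ENNReal.HolderConjugate a b]
    {f g : α → E} (hf : MemLp f a μ) (hg : MemLp g b μ) :
    Integrable (fun x => (inner ℝ (f x) (g x) : ℝ)) μ :=
  memLp_one_iff_integrable.1 ⟨hf.1.inner hg.1, (eLpNorm_inner_le (p := a) (q := b)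
    hf.1 hg.1).trans_lt (ENNReal.mul_lt_top hf.2 hg.2)⟩

theorem ae_norm_density_le (hL : 0 < L) (hrL : ∀ᵐ x, L⁻¹ ≤ r x ∧ r x ≤ L) :
    ∀ᵐ x ∂(volume.restrict Q), ‖r x‖ ≤ L := by
  filter_upwards [ae_restrict_of_ae hrL] with x hx
  rw [Real.norm_of_nonneg ((inv_pos.2 hL).le.trans hx.1)]
  exact hx.2

theorem integrable_weightedInner (hr : Measurable r) (hL : 0 < L)
    (hrL : ∀ᵐ x, L⁻¹ ≤ r x ∧ r x ≤ L) (hv : MemLp v 2 (volume.restrict Q))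
    (hw : MemLp w 2 (volume.restrict Q)) :
    Integrable (fun x => r x * (inner ℝ (v x) (w x) : ℝ)) (volume.restrict Q) := by
  simpa only [real_inner_smul_left] using integrable_inner_of_holderConjugate (a := 2) (b := 2)
    (memLp_density_smul hr (ae_norm_density_le hL hrL) hv) hw

theorem weightedInner_sub_left (hr : Measurable r) (hL : 0 < L)
    (hrL : ∀ᵐ x, L⁻¹ ≤ r x ∧ r x ≤ L) (hv : MemLp v 2 (volume.restrict Q))
    (hw : MemLp w 2 (volume.restrict Q)) (hz : MemLp z 2 (volume.restrict Q)) :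
    weightedInner Q r (v - w) z = weightedInner Q r v z - weightedInner Q r w z := by
  unfold weightedInner
  rw [← integral_sub (integrable_weightedInner hr hL hrL hv hz)
    (integrable_weightedInner hr hL hrL hw hz)]
  refine integral_congr_ae (ae_of_all _ fun x => ?_)
  simp [inner_sub_left, mul_sub]

theorem weightedInner_self_nonneg (hL : 0 < L) (hrL : ∀ᵐ x, L⁻¹ ≤ r x ∧ r x ≤ L) :
    0 ≤ weightedInner Q r v v := by
  refine integral_nonneg_of_ae ?_
  filter_upwards [ae_restrict_of_ae hrL] with x hx
  exact mul_nonneg ((inv_pos.2 hL).le.trans hx.1) real_inner_self_nonneg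

/-- Pointwise `|v|² - |w|² ≤ 2 (v - w) · v`, because `|v - w|² ≥ 0`. It replaces the chain rule for
`|U|²`: with `v = U(t)` and `w` an earlier value, the increment of energy is bounded by the
increment of velocity tested with `U(t)`. -/
theorem weightedInner_self_sub_le (hr : Measurable r) (hL : 0 < L)
    (hrL : ∀ᵐ x, L⁻¹ ≤ r x ∧ r x ≤ L) (hv : MemLp v 2 (volume.restrict Q))
    (hw : MemLp w 2 (volume.restrict Q)) :
    weightedInner Q r v v - weightedInner Q r w w ≤ 2 * weightedInner Q r (v - w) v := by
  unfold weightedInner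
  rw [← integral_sub (integrable_weightedInner hr hL hrL hv hv)
    (integrable_weightedInner hr hL hrL hw hw), ← integral_const_mul]
  refine integral_mono_ae ((integrable_weightedInner hr hL hrL hv hv).sub
    (integrable_weightedInner hr hL hrL hw hw))
    ((integrable_weightedInner hr hL hrL (hv.sub hw) hv).const_mul 2) ?_
  filter_upwards [ae_restrict_of_ae hrL] with x hx
  have h0 : 0 ≤ r x := (inv_pos.2 hL).le.trans hx.1
  have h1 : (0 : ℝ) ≤ inner ℝ (v x - w x) (v x - w x) := real_inner_self_nonneg
  simp only [Pi.sub_apply, inner_sub_left, inner_sub_right, real_inner_comm (w x) (v x)] at h1 ⊢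
  nlinarith [mul_nonneg h0 h1]

theorem integral_sq_le_weightedInner (hr : Measurable r) (hL : 0 < L)
    (hrL : ∀ᵐ x, L⁻¹ ≤ r x ∧ r x ≤ L) (hv : MemLp v 2 (volume.restrict Q)) :
    ∫ x in Q, ‖v x‖ ^ 2 ≤ L * weightedInner Q r v v := by
  unfold weightedInner
  rw [← integral_const_mul]
  refine integral_mono_ae ((memLp_two_iff_integrable_sq_norm hv.1).1 hv)
    ((integrable_weightedInner hr hL hrL hv hv).const_mul L) ?_
  filter_upwards [ae_restrict_of_ae hrL] with x hx
  have h1 : 1 ≤ L * r x := by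
    have := mul_le_mul_of_nonneg_left hx.1 hL.le
    rwa [mul_inv_cancel₀ hL.ne'] at this
  have : (inner ℝ (v x) (v x) : ℝ) = ‖v x‖ ^ 2 := real_inner_self_eq_norm_sq _
  rw [this]
  nlinarith [sq_nonneg ‖v x‖]

theorem weightedInner_self_le (hr : Measurable r) (hL : 0 < L)
    (hrL : ∀ᵐ x, L⁻¹ ≤ r x ∧ r x ≤ L) (hv : MemLp v 2 (volume.restrict Q)) :
    weightedInner Q r v v ≤ L * ∫ x in Q, ‖v x‖ ^ 2 := by
  unfold weightedInner
  rw [← integral_const_mul]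
  refine integral_mono_ae (integrable_weightedInner hr hL hrL hv hv)
    (((memLp_two_iff_integrable_sq_norm hv.1).1 hv).const_mul L) ?_
  filter_upwards [ae_restrict_of_ae hrL] with x hx
  have : (inner ℝ (v x) (v x) : ℝ) = ‖v x‖ ^ 2 := real_inner_self_eq_norm_sq _
  rw [this]
  exact mul_le_mul_of_nonneg_right hx.2 (sq_nonneg _)

theorem integrable_integral_inner {E : Type*} [NormedAddCommGroup E] [InnerProductSpace ℝ E]
    [MeasurableSpace E] [BorelSpace E] [SecondCountableTopology E] {v : Vec N → E}
    {f : Vec N × ℝ → E} {a b : ℝ≥0∞} [ENNReal.HolderConjugate a b] (hT : 0 < T)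
    (hQ : MeasurableSet Q) (hf : MemLp f a volume) (hf0 : ∀ z, z ∉ cylinder Q T → f z = 0)
    (hv : MemLp v b (volume.restrict Q)) :
    Integrable fun σ => ∫ x, (inner ℝ (f (x, σ)) (v x) : ℝ) := by
  rw [← integrableOn_iff_integrable_of_support_subset (s := Ioc 0 T),
    ← intervalIntegrable_iff_integrableOn_Ioc_of_le hT.le]
  · exact intervalIntegrable_inner hQ hf hf0 hv hT.le
  · intro σ hσ
    by_contra hc
    exact hσ (by simp [EvolutionData.slice_eq_zero hf0 (fun h => hc ⟨h.1, h.2.le⟩)])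

/-- The velocity, extended by its initial value to all times which are not positive. -/
def history (U : Vec N × ℝ → Vec N) (u₀ : Vec N → Vec N) (t : ℝ) (x : Vec N) : Vec N :=
  if 0 < t then U (x, t) else u₀ x

theorem history_of_pos {t : ℝ} (ht : 0 < t) : history U u₀ t = fun x => U (x, t) := by
  ext1 x; simp [history, ht]

theorem history_of_nonpos {t : ℝ} (ht : ¬0 < t) : history U u₀ t = u₀ := by
  ext1 x; simp [history, ht]

namespace IsEvolution

theorem ae_memLp_two [IsFiniteMeasure (volume.restrict Q)] (hN : N = 2 ∨ N = 3)
    (hp : critExp N ≤ p) (h : IsEvolution Q T p c K r u₀ U DU F G) :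
    ∀ᵐ t, MemLp (fun x => U (x, t)) 2 (volume.restrict Q) := by
  filter_upwards [h.memV] with t ht
  by_cases htT : t ∈ Ioo 0 T
  · exact (ht htT).memLp_two ((two_le_critExp (by omega)).trans hp)
  · simp [EvolutionData.slice_eq_zero h.U_zero htT]

/-- The difference of the weak identities at `t` and `t - η`. Extending the velocity into the past
by `u₀`, and the forces by zero, keeps the formula valid for `t ≤ η`, so no boundary layer at the
initial time has to be excluded. -/
theorem ae_increment [IsFiniteMeasure (volume.restrict Q)] (hQ : MeasurableSet Q)
    (hN : N = 2 ∨ N = 3) (hp : critExp N ≤ p) (hT : 0 < T) (hr : Measurable r) (hL : 0 < L)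
    (hrL : ∀ᵐ x, L⁻¹ ≤ r x ∧ r x ≤ L) (hu₀ : MemLp u₀ 2 (volume.restrict Q))
    (h : IsEvolution Q T p c K r u₀ U DU F G) {η : ℝ} (hη : 0 ≤ η) :
    ∀ᵐ t, t ∈ Ioo 0 T → MemLp (history U u₀ (t - η)) 2 (volume.restrict Q) ∧
      ∀ v Dv, MemV Q p v Dv →
        weightedInner Q r ((fun x => U (x, t)) - history U u₀ (t - η)) v =
          -((∫ s in (0 : ℝ)..η, ∫ x, inner ℝ (F (x, t - s)) (v x)) +
            ∫ s in (0 : ℝ)..η, ∫ x, inner ℝ (G (x, t - s)) (Dv x)) := by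
  have hN0 : 0 < N := by omega
  have h2p : 2 ≤ p := (two_le_critExp (by omega)).trans hp
  have := holderConjugate_convExp_velExp hN0
  have := holderConjugate_ofReal h2p
  obtain ⟨hUq, hFq, hGq⟩ := h.memLp_all hQ hN hp
  -- For almost every `t` the time `t - η` is also unexceptional.
  have hqmp := (measurePreserving_sub_right (volume : Measure ℝ) η).quasiMeasurePreserving
  filter_upwards [h.weak, h.ae_memLp_two hN hp, hqmp.ae h.weak, hqmp.ae (h.ae_memLp_two hN hp)]
    with t ht htU hs hsU htT
  have hHm : MemLp (history U u₀ (t - η)) 2 (volume.restrict Q) := by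
    by_cases hpos : 0 < t - η
    · rw [history_of_pos hpos]; exact hsU
    · rw [history_of_nonpos hpos]; exact hu₀
  refine ⟨hHm, fun v Dv hv => ?_⟩
  have hv2 := hv.memLp_two h2p
  have hF := integrable_integral_inner hT hQ hFq h.F_zero (hv.memLp_velExp hN hp)
  have hG := integrable_integral_inner hT hQ hGq h.G_zero hv.2.1
  have hzero : ∀ {E : Type} [NormedAddCommGroup E] [InnerProductSpace ℝ E] {f : Vec N × ℝ → E}
      {v : Vec N → E}, (∀ z, z ∉ cylinder Q T → f z = 0) → ∀ {s : ℝ}, s ≤ 0 →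
      ∫ σ in (0 : ℝ)..s, ∫ x, (inner ℝ (f (x, σ)) (v x) : ℝ) = 0 := by
    intro E _ _ f v hf s hs
    rw [intervalIntegral.integral_congr (g := fun _ => (0 : ℝ)), intervalIntegral.integral_zero]
    intro σ hσ
    rw [uIcc_of_ge hs] at hσ
    simp [EvolutionData.slice_eq_zero hf (fun h : σ ∈ Ioo 0 T => absurd h.1 hσ.2.not_gt)]
  have hw1 := ht htT v Dv hv
  have hw2 : weightedInner Q r (history U u₀ (t - η)) v +
      ((∫ s in (0 : ℝ)..(t - η), ∫ x, inner ℝ (F (x, s)) (v x)) +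
        ∫ s in (0 : ℝ)..(t - η), ∫ x, inner ℝ (G (x, s)) (Dv x)) =
      weightedInner Q r u₀ v := by
    by_cases hpos : 0 < t - η
    · rw [history_of_pos hpos]
      exact hs ⟨hpos, by linarith [htT.2]⟩ v Dv hv
    · rw [history_of_nonpos hpos, hzero h.F_zero (not_lt.1 hpos), hzero h.G_zero (not_lt.1 hpos)]
      simp
  have hsub : ∀ {f : ℝ → ℝ}, Integrable f → ∫ s in (0 : ℝ)..η, f (t - s)
      = (∫ s in (0 : ℝ)..t, f s) - ∫ s in (0 : ℝ)..(t - η), f s := by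
    intro f hf
    rw [intervalIntegral.integral_comp_sub_left, sub_zero,
      intervalIntegral.integral_interval_sub_left hf.intervalIntegrable hf.intervalIntegrable]
  rw [hsub hF, hsub hG, weightedInner_sub_left hr hL hrL htU hHm hv2]
  unfold WeakIdentity at hw1
  unfold weightedInner at hw2 ⊢
  linarith

end IsEvolution

end Energy

/-! ### The energy inequality averaged over a short time. -/

section EnergyInequality

variable {N : ℕ} {Q : Set (Vec N)} {T p c K L : ℝ} {r : Vec N → ℝ} {u₀ : Vec N → Vec N}
  {U : Vec N × ℝ → Vec N} {DU : Vec N × ℝ → Grad N} {F : Vec N × ℝ → Vec N}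
  {G : Vec N × ℝ → Grad N}

/-- The kinetic energy of `U` at time `t`, for the density `r`. -/
def energy (Q : Set (Vec N)) (r : Vec N → ℝ) (U : Vec N × ℝ → Vec N) (t : ℝ) : ℝ :=
  weightedInner Q r (fun x => U (x, t)) fun x => U (x, t)

/-- The power of the forces `F` and `G` acting on `U` and its gradient at time `t`. -/
def power (F U : Vec N × ℝ → Vec N) (G DU : Vec N × ℝ → Grad N) (t : ℝ) : ℝ :=
  pairing volume F U t t + pairing volume G DU t t

/-- The restriction of a function of space and time to the times in `I`. -/
def timeCut {E : Type*} [Zero E] (I : Set ℝ) (f : Vec N × ℝ → E) : Vec N × ℝ → E :=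
  (univ ×ˢ I).indicator f

section TimeCut

variable {E : Type*} [NormedAddCommGroup E] [InnerProductSpace ℝ E] [MeasurableSpace E]
  {f g : Vec N × ℝ → E} {a : ℝ≥0∞} {I : Set ℝ}

theorem measurable_timeCut (hI : MeasurableSet I) (hf : Measurable f) :
    Measurable (timeCut I f) :=
  hf.indicator (MeasurableSet.univ.prod hI)

theorem memLp_timeCut (hI : MeasurableSet I) (hf : MemLp f a volume) :
    MemLp (timeCut I f) a volume :=
  hf.indicator (MeasurableSet.univ.prod hI)

theorem eLpNorm_timeCut_le : eLpNorm (timeCut I f) a volume ≤ eLpNorm f a volume :=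
  eLpNorm_indicator_le f

theorem pairing_timeCut (s t : ℝ) :
    pairing volume f (timeCut I g) s t = I.indicator (fun t => pairing volume f g s t) t := by
  by_cases ht : t ∈ I
  · rw [indicator_of_mem ht]; simp [pairing, timeCut, ht]
  · rw [indicator_of_notMem ht]; simp [pairing, timeCut, ht]

/-- The restriction to the times in `I` is absorbed in the unshifted factor, so `f` is still shifted
as a whole function. -/
theorem setIntegral_integral_pairing_timeShift [BorelSpace E] [SecondCountableTopology E]
    {p q : ℝ≥0∞} [ENNReal.HolderConjugate p q] (hI : MeasurableSet I) (hf : Measurable f)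
    (hg : Measurable g) (hfp : MemLp f p volume) (hgq : MemLp g q volume) {η : ℝ} (hη : 0 ≤ η) :
    ∫ t in I, ∫ s in (0 : ℝ)..η, pairing volume f g (t - s) t
      = ∫ s in (0 : ℝ)..η, ∫ t, pairing volume f (timeCut I g) (t - s) t := by
  rw [← integral_integral_pairing_timeShift (p := p) (q := q) hf (measurable_timeCut hI hg) hfp
    (memLp_timeCut hI hgq) hη, ← integral_indicator hI]
  refine integral_congr_ae (ae_of_all _ fun t => ?_)
  by_cases ht : t ∈ I <;> simp [pairing_timeCut, ht]

theorem abs_setIntegral_integral_pairing_timeShift_le [BorelSpace E] [SecondCountableTopology E]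
    {p q : ℝ≥0∞} [ENNReal.HolderConjugate p q] (hI : MeasurableSet I) (hf : Measurable f)
    (hg : Measurable g) (hfp : MemLp f p volume) (hgq : MemLp g q volume) {η : ℝ} (hη : 0 ≤ η)
    {A B : ℝ≥0} (hA : eLpNorm f p volume ≤ A) (hB : eLpNorm g q volume ≤ B) :
    |∫ t in I, ∫ s in (0 : ℝ)..η, pairing volume f g (t - s) t| ≤ A * B * η := by
  rw [setIntegral_integral_pairing_timeShift (p := p) (q := q) hI hf hg hfp hgq hη,
    ← Real.norm_eq_abs]
  have h : ∀ s ∈ Set.uIoc 0 η, ‖∫ t, pairing volume f (timeCut I g) (t - s) t‖ ≤ A * B := by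
    intro s _
    refine (abs_integral_pairing_timeShift_le (p := p) (q := q) hf (measurable_timeCut hI hg) hfp
      (memLp_timeCut hI hgq) s).trans ?_
    exact mul_le_mul (ENNReal.toReal_le_coe_of_le_coe hA)
      (ENNReal.toReal_le_coe_of_le_coe (eLpNorm_timeCut_le.trans hB)) ENNReal.toReal_nonneg
      A.coe_nonneg
  simpa [abs_of_nonneg hη] using intervalIntegral.norm_integral_le_of_norm_le_const h

end TimeCut

namespace IsEvolution

theorem memLp_velocity_two [IsFiniteMeasure (volume.restrict Q)] (hQ : MeasurableSet Q)
    (hN : N = 2 ∨ N = 3) (hp : critExp N ≤ p) (h : IsEvolution Q T p c K r u₀ U DU F G) :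
    MemLp U 2 volume := by
  have hN0 : 0 < N := by omega
  have h2q := two_le_velExp hN0
  have h2 : (2 : ℝ≥0∞) ≤ ENNReal.ofReal (velExp N) := by
    rw [← ENNReal.ofReal_ofNat]; exact ENNReal.ofReal_le_ofReal h2q
  refine ⟨h.measurable_U.aestronglyMeasurable, (eLpNorm_le_of_zero_off h.U_zero h2
    h.measurable_U.aestronglyMeasurable).trans_lt
    (ENNReal.mul_lt_top (h.memLp_all hQ hN hp).1.2 (ENNReal.rpow_ne_top_of_nonneg ?_
      (volume_cylinder_ne_top T)).lt_top)⟩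
  rw [ENNReal.toReal_ofReal (velExp_pos hN0).le, sub_nonneg]
  exact one_div_le_one_div_of_le (by simp) (by simpa using h2q)

theorem integrable_energy [IsFiniteMeasure (volume.restrict Q)] (hQ : MeasurableSet Q)
    (hN : N = 2 ∨ N = 3) (hp : critExp N ≤ p) (hr : Measurable r) (hL : 0 < L)
    (hrL : ∀ᵐ x, L⁻¹ ≤ r x ∧ r x ≤ L) (h : IsEvolution Q T p c K r u₀ U DU F G) :
    Integrable (energy Q r U) := by
  have hm : (volume.restrict Q).prod (volume : Measure ℝ)
      = (volume : Measure (Vec N × ℝ)).restrict (Q ×ˢ univ) := by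
    rw [Measure.volume_eq_prod, ← Measure.prod_restrict, Measure.restrict_univ]
  have hU : MemLp U 2 ((volume.restrict Q).prod volume) := by
    rw [hm]; exact (h.memLp_velocity_two hQ hN hp).restrict _
  have hrU : MemLp (fun z : Vec N × ℝ => r z.1 • U z) 2 ((volume.restrict Q).prod volume) := by
    refine MemLp.of_le_mul (c := L) hU
      ((hr.comp measurable_fst).aestronglyMeasurable.smul hU.1) ?_
    filter_upwards [Measure.quasiMeasurePreserving_fst.ae
      (ae_norm_density_le (Q := Q) hL hrL)] with z hz
    rw [norm_smul]
    gcongr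
  have := (integrable_inner_of_holderConjugate (a := 2) (b := 2) hrU hU).integral_prod_right
  simp only [real_inner_smul_left] at this
  exact this

/-- The increment formula is tested with `U(t)` and integrated over `(0, τ)`. The differences of
energies telescope: only the last stretch of length `η` and `η` times the initial energy survive. -/
theorem integral_energy_le [IsFiniteMeasure (volume.restrict Q)] (hQ : MeasurableSet Q)
    (hN : N = 2 ∨ N = 3) (hp : critExp N ≤ p) (hr : Measurable r) (hL : 0 < L)
    (hrL : ∀ᵐ x, L⁻¹ ≤ r x ∧ r x ≤ L) (hu₀ : MemLp u₀ 2 (volume.restrict Q))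
    (h : IsEvolution Q T p c K r u₀ U DU F G) {τ η : ℝ} (hτ : 0 < τ) (hτT : τ ≤ T)
    (hη : 0 ≤ η) (hητ : η ≤ τ) :
    ∫ t in (τ - η)..τ, energy Q r U t ≤ η * weightedInner Q r u₀ u₀
      - 2 * ((∫ s in (0 : ℝ)..η, ∫ t, pairing volume F (timeCut (Ioo 0 τ) U) (t - s) t) +
        ∫ s in (0 : ℝ)..η, ∫ t, pairing volume G (timeCut (Ioo 0 τ) DU) (t - s) t) := by
  have hN0 : 0 < N := by omega
  have h2p : 2 ≤ p := (two_le_critExp (by omega)).trans hp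
  have := holderConjugate_convExp_velExp hN0
  have := holderConjugate_ofReal h2p
  obtain ⟨hUq, hFq, hGq⟩ := h.memLp_all hQ hN hp
  have hy := h.integrable_energy hQ hN hp hr hL hrL
  have hy0 : ∀ t, t ≤ 0 → energy Q r U t = 0 := by
    intro t ht
    simp [energy, weightedInner, EvolutionData.slice_eq_zero h.U_zero
      (fun h : t ∈ Ioo 0 T => absurd h.1 ht.not_gt)]
  set y₀ := weightedInner Q r u₀ u₀ with hy₀
  -- The energy of `U` itself is zero at nonpositive times, so the history only adds the initial
  -- energy there.
  have hhist : ∀ t, weightedInner Q r (history U u₀ t) (history U u₀ t)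
      = energy Q r U t + (Iic 0).indicator (fun _ => y₀) t := by
    intro t
    by_cases ht : 0 < t
    · rw [history_of_pos ht]; simp [energy, ht]
    · rw [history_of_nonpos ht]; simp [hy0 t (not_lt.1 ht), hy₀, not_lt.1 ht]
  have hmF := setIntegral_integral_pairing_timeShift (p := ENNReal.ofReal (convExp N))
    (q := ENNReal.ofReal (velExp N)) (I := Ioo 0 τ) measurableSet_Ioo h.measurable_F
    h.measurable_U hFq hUq hη
  have hmG := setIntegral_integral_pairing_timeShift (p := ENNReal.ofReal (p / (p - 1)))
    (q := ENNReal.ofReal p) (I := Ioo 0 τ) measurableSet_Ioo h.measurable_G h.measurable_DU hGq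
    h.memLp_DU hη
  have hiF := integrable_integral_pairing_timeShift (p := ENNReal.ofReal (convExp N))
      (q := ENNReal.ofReal (velExp N)) h.measurable_F h.measurable_U hFq hUq hη
  have hiG := integrable_integral_pairing_timeShift (p := ENNReal.ofReal (p / (p - 1)))
      (q := ENNReal.ofReal p) h.measurable_G h.measurable_DU hGq h.memLp_DU hη
  have hind : ∫ t in Ioo 0 τ, (Iic 0).indicator (fun _ => y₀) (t - η) = η * y₀ := by
    have e : (fun t => (Iic (0 : ℝ)).indicator (fun _ => y₀) (t - η))
        = (Iic η).indicator fun _ => y₀ := by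
      funext t
      by_cases ht : t ≤ η <;> simp [ht]
    rw [e, ← integral_Ioc_eq_integral_Ioo, integral_indicator measurableSet_Iic,
      Measure.restrict_restrict measurableSet_Iic, inter_comm, Ioc_inter_Iic, min_eq_right hητ]
    simp [hη]
  have hindi : IntegrableOn (fun t => (Iic 0).indicator (fun _ => y₀) (t - η)) (Ioo 0 τ) := by
    refine IntegrableOn.of_bound (by simp) ?_ |y₀| (ae_of_all _ fun t => ?_)
    · exact ((measurable_const.indicator measurableSet_Iic).comp
        (measurable_id.sub_const η)).aestronglyMeasurable
    · by_cases ht : t - η ∈ Iic (0 : ℝ)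
      · rw [indicator_of_mem ht, Real.norm_eq_abs]
      · rw [indicator_of_notMem ht]; simp
  have hys : Integrable fun t => energy Q r U (t - η) := hy.comp_sub_right η
  have hshift : ∫ t in Ioo 0 τ, energy Q r U (t - η)
      = (∫ t in Ioo 0 τ, energy Q r U t) - ∫ t in (τ - η)..τ, energy Q r U t := by
    rw [← integral_Ioc_eq_integral_Ioo, ← integral_Ioc_eq_integral_Ioo,
      ← intervalIntegral.integral_of_le hτ.le, ← intervalIntegral.integral_of_le hτ.le,
      intervalIntegral.integral_comp_sub_right,
      ← intervalIntegral.integral_add_adjacent_intervals (b := τ - η)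
        (hy.intervalIntegrable (a := 0)) (hy.intervalIntegrable (b := τ)), add_sub_cancel_right,
      ← intervalIntegral.integral_add_adjacent_intervals (b := 0)
        (hy.intervalIntegrable (a := 0 - η)) (hy.intervalIntegrable (b := τ - η)), add_eq_right,
      intervalIntegral.integral_congr (g := fun _ => (0 : ℝ)), intervalIntegral.integral_zero]
    intro t ht
    rw [uIcc_of_le (by linarith)] at ht
    exact hy0 t ht.2
  have hmono : ∫ t in Ioo 0 τ, (energy Q r U t - (energy Q r U (t - η)
        + (Iic 0).indicator (fun _ => y₀) (t - η)))
      ≤ ∫ t in Ioo 0 τ, -2 * ((∫ s in (0 : ℝ)..η, pairing volume F U (t - s) t)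
        + ∫ s in (0 : ℝ)..η, pairing volume G DU (t - s) t) := by
    refine setIntegral_mono_ae_restrict (hy.integrableOn.sub (hys.integrableOn.add hindi))
      ((hiF.add hiG).const_mul (-2)).integrableOn ?_
    filter_upwards [ae_restrict_mem measurableSet_Ioo,
      ae_restrict_of_ae (h.ae_increment hQ hN hp (hτ.trans_le hτT) hr hL hrL hu₀ hη),
      ae_restrict_of_ae (h.ae_memLp_two hN hp), ae_restrict_of_ae h.memV] with t ht hinc hU2 hV
    have htT : t ∈ Ioo 0 T := ⟨ht.1, ht.2.trans_le hτT⟩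
    obtain ⟨hH2, hinc⟩ := hinc htT
    have h1 := weightedInner_self_sub_le hr hL hrL hU2 hH2
    rw [hinc _ _ (hV htT), hhist] at h1
    simp only [energy, pairing] at h1 ⊢
    linarith
  have hsplit := integral_add hys.integrableOn hindi
  rw [integral_sub hy.integrableOn (show Integrable (fun t => energy Q r U (t - η)
    + (Iic 0).indicator (fun _ => y₀) (t - η)) (volume.restrict (Ioo 0 τ)) from
      hys.integrableOn.add hindi),
    hsplit, integral_const_mul,
    integral_add hiF.integrableOn hiG.integrableOn, hind, hshift, hmF, hmG] at hmono
  linarith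

end IsEvolution

end EnergyInequality

/-! ### Pointwise energy inequality, Gronwall and dissipation. -/

section EnergyBound

variable {N : ℕ} {Q : Set (Vec N)} {T p c K L : ℝ} {r : Vec N → ℝ} {u₀ : Vec N → Vec N}
  {U : Vec N × ℝ → Vec N} {DU : Vec N × ℝ → Grad N} {F : Vec N × ℝ → Vec N}
  {G : Vec N × ℝ → Grad N}

theorem exists_mul_le_intervalIntegral {J : ℝ → ℝ} {a : ℝ} (hJ : Tendsto J (𝓝 0) (𝓝 a))
    (hJi : ∀ η, 0 ≤ η → IntervalIntegrable J volume 0 η) {γ : ℝ} (hγ : 0 < γ) :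
    ∃ δ > 0, ∀ η, 0 ≤ η → η < δ → η * (a - γ) ≤ ∫ s in (0 : ℝ)..η, J s := by
  obtain ⟨δ, hδ, h⟩ := Metric.tendsto_nhds_nhds.1 hJ γ hγ
  refine ⟨δ, hδ, fun η hη hηδ => ?_⟩
  have : ∫ _ in (0 : ℝ)..η, (a - γ) = η * (a - γ) := by simp [mul_sub]
  rw [← this]
  refine intervalIntegral.integral_mono_on hη (by simp) (hJi η hη) fun s hs => ?_
  have := h (x := s) (by
    rw [Real.dist_eq, sub_zero, abs_of_nonneg hs.1]; exact hs.2.trans_lt hηδ)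
  rw [Real.dist_eq] at this
  linarith [(abs_lt.1 this).1]

/-- A Gronwall inequality for functions which are only bounded almost everywhere. -/
theorem ae_le_of_le_add_integral {y : ℝ → ℝ} {T A C S : ℝ} (hA : 0 ≤ A) (hC : 0 < C)
    (hS : 0 ≤ S) (hyi : Integrable y) (hyS : ∀ᵐ t, t ∈ Ioo 0 T → y t ≤ S)
    (hy : ∀ᵐ τ, τ ∈ Ioo 0 T → y τ ≤ A + C * ∫ t in Ioo 0 τ, y t) :
    ∀ᵐ t, t ∈ Ioo 0 T → y t ≤ 2 * A * Real.exp (2 * C * t) := by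
  -- In the weight `exp (2Ct)` the integral operator contracts by one half: a bound with factor `E`
  -- improves to `A + E/2`, whose fixed point is `2A`. The a priori bound `S` starts the iteration
  -- and drops out of the limit.
  have key : ∀ n : ℕ, ∀ᵐ t, t ∈ Ioo 0 T → y t ≤ (2 * A + S / 2 ^ n) * Real.exp (2 * C * t) := by
    intro n
    induction n with
    | zero =>
      filter_upwards [hyS] with t ht htT
      refine (ht htT).trans ?_
      have h1 : 1 ≤ Real.exp (2 * C * t) := Real.one_le_exp (by have := htT.1; positivity)
      simp only [pow_zero, div_one]
      nlinarith
    | succ n ih =>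
      filter_upwards [hy] with τ hτ hτT
      refine (hτ hτT).trans ?_
      set E := 2 * A + S / 2 ^ n with hE
      have hcont : Continuous fun t => E * Real.exp (2 * C * t) := by fun_prop
      have h1 : ∫ t in Ioo 0 τ, y t ≤ ∫ t in Ioo 0 τ, E * Real.exp (2 * C * t) := by
        refine setIntegral_mono_ae_restrict hyi.integrableOn
          ((hcont.integrableOn_Icc (a := 0) (b := τ)).mono_set Ioo_subset_Icc_self) ?_
        filter_upwards [ae_restrict_mem measurableSet_Ioo, ae_restrict_of_ae ih] with t ht hih
        exact hih ⟨ht.1, ht.2.trans hτT.2⟩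
      have h2 : ∫ t in Ioo 0 τ, E * Real.exp (2 * C * t)
          = E * ((2 * C)⁻¹ * (Real.exp (2 * C * τ) - 1)) := by
        rw [← integral_Ioc_eq_integral_Ioo, ← intervalIntegral.integral_of_le hτT.1.le,
          intervalIntegral.integral_const_mul, intervalIntegral.integral_comp_mul_left _
          (by positivity : (2 * C) ≠ 0), integral_exp]
        simp
      rw [h2] at h1
      have h3 : C * ∫ t in Ioo 0 τ, y t ≤ E / 2 * (Real.exp (2 * C * τ) - 1) := by
        refine (mul_le_mul_of_nonneg_left h1 hC.le).trans_eq ?_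
        field_simp
      have h4 : 1 ≤ Real.exp (2 * C * τ) := Real.one_le_exp (by have := hτT.1; positivity)
      have h5 : S / 2 ^ (n + 1) = S / 2 ^ n / 2 := by rw [pow_succ]; field_simp
      have h6 : 0 ≤ S / 2 ^ n := by positivity
      rw [h5]
      rw [hE] at h3
      nlinarith
  filter_upwards [ae_all_iff.2 key] with t ht htT
  have hlim : Tendsto (fun n : ℕ => (2 * A + S / 2 ^ n) * Real.exp (2 * C * t)) atTop
      (𝓝 ((2 * A + 0) * Real.exp (2 * C * t))) := by
    refine (tendsto_const_nhds.add ?_).mul_const _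
    exact tendsto_const_nhds.div_atTop (tendsto_pow_atTop_atTop_of_one_lt one_lt_two)
  rw [add_zero] at hlim
  exact ge_of_tendsto' hlim fun n => ht n htT

namespace IsEvolution

theorem integrable_power [IsFiniteMeasure (volume.restrict Q)] (hQ : MeasurableSet Q)
    (hN : N = 2 ∨ N = 3) (hp : critExp N ≤ p) (h : IsEvolution Q T p c K r u₀ U DU F G) :
    Integrable (power F U G DU) := by
  have := holderConjugate_convExp_velExp (N := N) (by omega)
  have := holderConjugate_ofReal ((two_le_critExp (by omega)).trans hp)
  obtain ⟨hUq, hFq, hGq⟩ := h.memLp_all hQ hN hp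
  have h1 := integrable_pairing_timeShift (p := ENNReal.ofReal (convExp N))
    (q := ENNReal.ofReal (velExp N)) h.measurable_F h.measurable_U hFq hUq 0
  have h2 := integrable_pairing_timeShift (p := ENNReal.ofReal (p / (p - 1)))
    (q := ENNReal.ofReal p) h.measurable_G h.measurable_DU hGq h.memLp_DU 0
  simp only [sub_zero] at h1 h2
  exact h1.add h2

/-- The shifted pairings are continuous at `s = 0`, so their mean over `(0, η)` is close to the
power at equal times. The inequality is kept in averaged form so that it also applies at `τ = T`. -/
theorem exists_integral_energy_le [IsFiniteMeasure (volume.restrict Q)] (hQ : MeasurableSet Q)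
    (hN : N = 2 ∨ N = 3) (hp : critExp N ≤ p) (hr : Measurable r) (hL : 0 < L)
    (hrL : ∀ᵐ x, L⁻¹ ≤ r x ∧ r x ≤ L) (hu₀ : MemLp u₀ 2 (volume.restrict Q))
    (h : IsEvolution Q T p c K r u₀ U DU F G) {τ γ : ℝ} (hτ : 0 < τ) (hτT : τ ≤ T) (hγ : 0 < γ) :
    ∃ δ > 0, ∀ η, 0 ≤ η → η < δ → ∫ t in (τ - η)..τ, energy Q r U t
      ≤ η * (weightedInner Q r u₀ u₀ - 2 * (∫ t in Ioo 0 τ, power F U G DU t) + γ) := by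
  have hN0 : 0 < N := by omega
  have h2p : 2 ≤ p := (two_le_critExp (by omega)).trans hp
  have := holderConjugate_convExp_velExp hN0
  have := holderConjugate_ofReal h2p
  have : Fact (1 ≤ ENNReal.ofReal (convExp N)) := ⟨by simpa using one_le_convExp N⟩
  have : Fact (1 ≤ ENNReal.ofReal (p / (p - 1))) := ⟨by
    rw [ENNReal.one_le_ofReal, le_div_iff₀ (by linarith)]; linarith⟩
  obtain ⟨hUq, hFq, hGq⟩ := h.memLp_all hQ hN hp
  have htF := tendsto_integral_pairing_timeShift (p := ENNReal.ofReal (convExp N))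
    (q := ENNReal.ofReal (velExp N)) ENNReal.ofReal_ne_top h.measurable_F
    (measurable_timeCut (measurableSet_Ioo (a := 0) (b := τ)) h.measurable_U) hFq (memLp_timeCut measurableSet_Ioo hUq)
  have htG := tendsto_integral_pairing_timeShift (p := ENNReal.ofReal (p / (p - 1)))
    (q := ENNReal.ofReal p) ENNReal.ofReal_ne_top h.measurable_G
    (measurable_timeCut (measurableSet_Ioo (a := 0) (b := τ)) h.measurable_DU) hGq (memLp_timeCut measurableSet_Ioo h.memLp_DU)
  have hiF := fun η (hη : 0 ≤ η) =>
    intervalIntegrable_integral_pairing_timeShift (p := ENNReal.ofReal (convExp N))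
    (q := ENNReal.ofReal (velExp N)) h.measurable_F
    (measurable_timeCut (measurableSet_Ioo (a := 0) (b := τ)) h.measurable_U) hFq (memLp_timeCut measurableSet_Ioo hUq) hη
  have hiG := fun η (hη : 0 ≤ η) =>
    intervalIntegrable_integral_pairing_timeShift (p := ENNReal.ofReal (p / (p - 1)))
    (q := ENNReal.ofReal p) h.measurable_G
    (measurable_timeCut (measurableSet_Ioo (a := 0) (b := τ)) h.measurable_DU) hGq (memLp_timeCut measurableSet_Ioo h.memLp_DU) hη
  have hJ0 : (∫ t, pairing volume F (timeCut (Ioo 0 τ) U) t t)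
      + ∫ t, pairing volume G (timeCut (Ioo 0 τ) DU) t t = ∫ t in Ioo 0 τ, power F U G DU t := by
    have h1 := integrable_pairing_timeShift (p := ENNReal.ofReal (convExp N))
      (q := ENNReal.ofReal (velExp N)) h.measurable_F h.measurable_U hFq hUq 0
    have h2 := integrable_pairing_timeShift (p := ENNReal.ofReal (p / (p - 1)))
      (q := ENNReal.ofReal p) h.measurable_G h.measurable_DU hGq h.memLp_DU 0
    simp only [sub_zero] at h1 h2
    unfold power
    rw [integral_add h1.integrableOn h2.integrableOn, ← integral_indicator measurableSet_Ioo,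
      ← integral_indicator measurableSet_Ioo]
    simp_rw [pairing_timeCut]
    rfl
  have htJ := htF.add htG
  rw [hJ0] at htJ
  obtain ⟨δ, hδ, hJ⟩ := exists_mul_le_intervalIntegral htJ
    (fun η hη => (hiF η hη).add (hiG η hη)) (half_pos hγ)
  refine ⟨min δ τ, lt_min hδ hτ, fun η hη hηδ => ?_⟩
  have h1 := hJ η hη (hηδ.trans_le (min_le_left _ _))
  rw [intervalIntegral.integral_add (hiF η hη) (hiG η hη)] at h1
  have h2 := h.integral_energy_le hQ hN hp hr hL hrL hu₀ hτ hτT hη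
    (hηδ.le.trans (min_le_right _ _))
  linarith

/-- At a Lebesgue point `τ` the backward averages of the energy converge to its value. -/
theorem ae_energy_le [IsFiniteMeasure (volume.restrict Q)] (hQ : MeasurableSet Q)
    (hN : N = 2 ∨ N = 3) (hp : critExp N ≤ p) (hT : 0 < T) (hr : Measurable r) (hL : 0 < L)
    (hrL : ∀ᵐ x, L⁻¹ ≤ r x ∧ r x ≤ L) (hu₀ : MemLp u₀ 2 (volume.restrict Q))
    (h : IsEvolution Q T p c K r u₀ U DU F G) :
    ∀ᵐ τ, τ ∈ Ioo 0 T → energy Q r U τ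
      ≤ weightedInner Q r u₀ u₀ - 2 * ∫ t in Ioo 0 τ, power F U G DU t := by
  have hy := h.integrable_energy hQ hN hp hr hL hrL
  filter_upwards [(hy.intervalIntegrable (a := 0) (b := T)).ae_hasDerivAt_integral]
    with τ hderiv hτ
  have hd := hderiv (by rw [uIcc_of_le hT.le]; exact ⟨hτ.1.le, hτ.2.le⟩) 0 left_mem_uIcc
  refine le_of_forall_pos_le_add fun γ hγ => ?_
  obtain ⟨δ, hδ, hle⟩ := h.exists_integral_energy_le hQ hN hp hr hL hrL hu₀ hτ.1 hτ.2.le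
    (half_pos hγ)
  rw [hasDerivAt_iff_isLittleO_nhds_zero] at hd
  obtain ⟨δ', hδ', hd⟩ := Metric.eventually_nhds_iff.1 (hd.def (half_pos hγ))
  set η := min (δ / 2) (δ' / 2) with hη
  have hη0 : 0 < η := lt_min (half_pos hδ) (half_pos hδ')
  have h1 := hle η hη0.le ((min_le_left _ _).trans_lt (by linarith))
  -- The derivative of the primitive is used backwards in time, to match the interval from `τ - η`
  -- to `τ`.
  have h2 := hd (y := -η) (by
    rw [Real.dist_eq, sub_zero, abs_neg, abs_of_pos hη0]
    exact (min_le_right _ _).trans_lt (by linarith))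
  rw [← intervalIntegral.integral_add_adjacent_intervals (b := τ + -η) (c := τ)
    (hy.intervalIntegrable (a := 0)) hy.intervalIntegrable, Real.norm_eq_abs, norm_neg,
    Real.norm_of_nonneg hη0.le] at h2
  have h3 := (abs_le.1 h2).2
  rw [← sub_eq_add_neg] at h3
  simp only [smul_eq_mul] at h3
  have h4 : η * energy Q r U τ ≤ η * (weightedInner Q r u₀ u₀
      - 2 * (∫ t in Ioo 0 τ, power F U G DU t) + γ) := by linarith
  exact le_of_mul_le_mul_left h4 hη0

/-- At the final time the average of the energy is simply dropped, being nonnegative. -/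
theorem integral_power_le [IsFiniteMeasure (volume.restrict Q)] (hQ : MeasurableSet Q)
    (hN : N = 2 ∨ N = 3) (hp : critExp N ≤ p) (hT : 0 < T) (hr : Measurable r) (hL : 0 < L)
    (hrL : ∀ᵐ x, L⁻¹ ≤ r x ∧ r x ≤ L) (hu₀ : MemLp u₀ 2 (volume.restrict Q))
    (h : IsEvolution Q T p c K r u₀ U DU F G) :
    2 * ∫ t in Ioo 0 T, power F U G DU t ≤ weightedInner Q r u₀ u₀ := by
  refine le_of_forall_pos_le_add fun γ hγ => ?_
  obtain ⟨δ, hδ, hle⟩ := h.exists_integral_energy_le hQ hN hp hr hL hrL hu₀ hT le_rfl hγ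
  have h1 := hle (δ / 2) (half_pos hδ).le (half_lt_self hδ)
  have h2 : 0 ≤ ∫ t in (T - δ / 2)..T, energy Q r U t :=
    intervalIntegral.integral_nonneg (by linarith) fun t _ => weightedInner_self_nonneg hL hrL
  have := nonneg_of_mul_nonneg_right (h2.trans h1) (half_pos hδ)
  linarith

/-- The stress dissipates at least `c |DU|^p`. Of the force, the convective part does no work, and
the rest grows linearly in the velocity, so its power is controlled by the energy. -/
theorem ae_le_power [IsFiniteMeasure (volume.restrict Q)] (hQ : MeasurableSet Q)
    (hN : N = 2 ∨ N = 3) (hp : critExp N ≤ p) (hK : 0 ≤ K) (hr : Measurable r) (hL : 0 < L)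
    (hrL : ∀ᵐ x, L⁻¹ ≤ r x ∧ r x ≤ L) (h : IsEvolution Q T p c K r u₀ U DU F G) :
    ∀ᵐ t, t ∈ Ioo 0 T → c * ∫ x, ‖DU (x, t)‖ ^ p ≤ power F U G DU t
      + K * (volume.real Q + 2 * (L * energy Q r U t)) := by
  have hN0 : 0 < N := by omega
  have h2p : 2 ≤ p := (two_le_critExp (by omega)).trans hp
  have := holderConjugate_convExp_velExp hN0
  have := holderConjugate_ofReal h2p
  have := holderTriple_velExp_critExp hN0
  obtain ⟨hUq, hFq, hGq⟩ := h.memLp_all hQ hN hp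
  have hvp : (volume : Measure (Vec N × ℝ)) = (volume : Measure (Vec N)).prod volume :=
    Measure.volume_eq_prod _ _
  have hFU : Integrable (fun z => (inner ℝ (F z) (U z) : ℝ)) volume :=
    integrable_inner_of_holderConjugate hFq hUq
  have hGD : Integrable (fun z => (inner ℝ (G z) (DU z) : ℝ)) volume :=
    integrable_inner_of_holderConjugate hGq h.memLp_DU
  have hDp : Integrable (fun z => ‖DU z‖ ^ p) volume := by
    have := h.memLp_DU.integrable_norm_rpow (by simp; linarith) ENNReal.ofReal_ne_top
    rwa [ENNReal.toReal_ofReal (by linarith)] at this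
  rw [hvp] at hFU hGD hDp
  have hcoer := h.coercive
  have hgr := h.growth_F
  rw [hvp] at hcoer hgr
  filter_upwards [ae_slices hcoer, ae_slices hgr, h.memV, h.ae_memLp_two hN hp,
    hFU.swap.prod_right_ae, hGD.swap.prod_right_ae, hDp.swap.prod_right_ae]
    with t hct hgt hV hU2 hFUt hGDt hDpt ht
  simp only [Function.comp_def, Prod.swap] at hFUt hGDt hDpt
  have h1 : c * ∫ x, ‖DU (x, t)‖ ^ p ≤ pairing volume G DU t t := by
    rw [← integral_const_mul]
    exact integral_mono_ae (hDpt.const_mul c) hGDt hct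
  have h2 : pairing volume F U t t
      = ∫ x in Q, inner ℝ (F (x, t) - convect (U (x, t)) (DU (x, t))) (U (x, t)) := by
    have hz : ∀ x, x ∉ Q → (inner ℝ (F (x, t)) (U (x, t)) : ℝ) = 0 := fun x hx => by
      rw [h.U_zero (x, t) fun hc => hx hc.1, inner_zero_right]
    have hcv := integrable_inner_convect hN0 ((hV ht).memLp_velExp hN hp)
      ((hV ht).memLp_grad hp) ((hV ht).memLp_velExp hN hp)
    simp_rw [inner_sub_left]
    rw [integral_sub hFUt.integrableOn hcv, (hV ht).integral_inner_convect_self hN hp, sub_zero,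
      setIntegral_eq_integral_of_forall_compl_eq_zero hz]
    rfl
  have hUsq : Integrable (fun x => ‖U (x, t)‖ ^ 2) (volume.restrict Q) :=
    (memLp_two_iff_integrable_sq_norm hU2.1).1 hU2
  have h3 : |pairing volume F U t t| ≤ ∫ x in Q, K * (1 + 2 * ‖U (x, t)‖ ^ 2) := by
    rw [h2, ← Real.norm_eq_abs]
    refine norm_integral_le_of_norm_le (((integrable_const 1).add (hUsq.const_mul 2)).const_mul K)
      ?_
    filter_upwards [ae_restrict_mem hQ, ae_restrict_of_ae hgt] with x hx hgx
    refine (norm_inner_le_norm _ _).trans ?_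
    have := mul_le_mul_of_nonneg_right (hgx ⟨hx, ht⟩) (norm_nonneg (U (x, t)))
    refine this.trans ?_
    rw [mul_assoc]
    refine mul_le_mul_of_nonneg_left ?_ hK
    -- `(1 + s) s ≤ 1 + 2 s²` for `s = ‖U‖`.
    nlinarith [sq_nonneg (‖U (x, t)‖ - 1), norm_nonneg (U (x, t))]
  have h4 : ∫ x in Q, K * (1 + 2 * ‖U (x, t)‖ ^ 2)
      = K * (volume.real Q + 2 * ∫ x in Q, ‖U (x, t)‖ ^ 2) := by
    rw [integral_const_mul, integral_add (integrable_const 1) (hUsq.const_mul 2),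
      integral_const_mul]
    simp
  have h5 : ∫ x in Q, ‖U (x, t)‖ ^ 2 ≤ L * energy Q r U t :=
    integral_sq_le_weightedInner hr hL hrL hU2
  have h6 : K * (volume.real Q + 2 * ∫ x in Q, ‖U (x, t)‖ ^ 2)
      ≤ K * (volume.real Q + 2 * (L * energy Q r U t)) := by gcongr
  have := (abs_le.1 h3).1
  unfold power
  linarith

end IsEvolution

end EnergyBound

/-! ### Bounds that depend only on the structural constants. -/

section UniformBound

variable {N : ℕ} {Q : Set (Vec N)} {T p c K L : ℝ} {r : Vec N → ℝ} {u₀ : Vec N → Vec N}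
  {U : Vec N × ℝ → Vec N} {DU : Vec N × ℝ → Grad N} {F : Vec N × ℝ → Vec N}
  {G : Vec N × ℝ → Grad N}

theorem ofReal_integral_norm_sq {α E : Type*} [MeasurableSpace α] [NormedAddCommGroup E]
    {μ : Measure α} {v : α → E} (hv : MemLp v 2 μ) :
    ENNReal.ofReal (∫ x, ‖v x‖ ^ 2 ∂μ) = eLpNorm v 2 μ ^ 2 := by
  rw [eLpNorm_two_sq, ofReal_integral_eq_lintegral_ofReal
    ((memLp_two_iff_integrable_sq_norm hv.1).1 hv) (ae_of_all _ fun x => sq_nonneg _)]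
  refine lintegral_congr fun x => ?_
  rw [ENNReal.ofReal_pow (norm_nonneg _), ofReal_norm]

theorem eLpNorm_two_le_of_integral_le {α E : Type*} [MeasurableSpace α] [NormedAddCommGroup E]
    {μ : Measure α} {v : α → E} (hv : MemLp v 2 μ) {a : ℝ} (h : ∫ x, ‖v x‖ ^ 2 ∂μ ≤ a) :
    eLpNorm v 2 μ ≤ ENNReal.ofReal (√a) := by
  have ha : 0 ≤ a := (integral_nonneg fun x => sq_nonneg _).trans h
  rw [← ENNReal.pow_le_pow_left_iff two_ne_zero, ← ENNReal.ofReal_pow (Real.sqrt_nonneg _),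
    Real.sq_sqrt ha, ← ofReal_integral_norm_sq hv]
  exact ENNReal.ofReal_le_ofReal h

theorem integral_norm_sq_le {α E : Type*} [MeasurableSpace α] [NormedAddCommGroup E]
    {μ : Measure α} {v : α → E} (hv : MemLp v 2 μ) {a : ℝ≥0} (h : eLpNorm v 2 μ ≤ a) :
    ∫ x, ‖v x‖ ^ 2 ∂μ ≤ a ^ 2 := by
  rw [← ENNReal.ofReal_le_ofReal_iff (by positivity), ofReal_integral_norm_sq hv,
    ENNReal.ofReal_pow a.coe_nonneg, ENNReal.ofReal_coe_nnreal]
  gcongr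

namespace IsEvolution

/-- Energy inequality and dissipation estimate combine to `y(τ) ≤ A + C ∫ y`, and Gronwall bounds
the energy by `Y`. The dissipation estimate on all of `(0, T)` then bounds the gradient by means of
`Y`. -/
theorem exists_uniform_bound [IsFiniteMeasure (volume.restrict Q)] (hQ : MeasurableSet Q)
    (hN : N = 2 ∨ N = 3) (hp : critExp N ≤ p) (hT : 0 < T) (hc : 0 < c) (hK : 0 ≤ K) (hL : 0 < L)
    (hu₀ : MemLp u₀ 2 (volume.restrict Q)) :
    ∃ M D : ℝ≥0∞, M ≠ ⊤ ∧ D ≠ ⊤ ∧ ∀ r U DU F G, Measurable r → (∀ᵐ x, L⁻¹ ≤ r x ∧ r x ≤ L) →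
      IsEvolution Q T p c K r u₀ U DU F G →
      (∀ᵐ t, t ∈ Ioo 0 T → eLpNorm (fun x => U (x, t)) 2 (volume.restrict Q) ≤ M) ∧
      eLpNorm DU (ENNReal.ofReal p) volume ≤ D := by
  have h2p : 2 ≤ p := (two_le_critExp (by omega)).trans hp
  set E := ∫ x in Q, ‖u₀ x‖ ^ 2 with hE
  have hE0 : 0 ≤ E := integral_nonneg fun x => sq_nonneg _
  set A := L * E + 2 * (K * (volume.real Q * T)) with hA
  have hA0 : 0 ≤ A := by positivity
  -- Twice the factor `2KL` of the energy in the dissipation estimate; the added 1 keeps `C`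
  -- positive when `K = 0`.
  set C := 4 * K * L + 1 with hC
  have hC0 : 0 < C := by positivity
  set Y := 2 * A * Real.exp (2 * C * T) with hY
  set W := L * E + K * (volume.real Q * T + 2 * (L * (Y * T))) with hW
  refine ⟨ENNReal.ofReal (√(L * Y)), ENNReal.ofReal (W / c) ^ p⁻¹, ENNReal.ofReal_ne_top,
    ENNReal.rpow_ne_top_of_nonneg (by positivity) ENNReal.ofReal_ne_top,
    fun r U DU F G hr hrL h => ?_⟩
  have hU2 := h.ae_memLp_two hN hp
  have hy := h.integrable_energy hQ hN hp hr hL hrL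
  have hP := h.integrable_power hQ hN hp
  have hy0 : weightedInner Q r u₀ u₀ ≤ L * E := weightedInner_self_le hr hL hrL hu₀
  have hDp : Integrable (fun z => ‖DU z‖ ^ p) volume := by
    have := h.memLp_DU.integrable_norm_rpow (by simp; linarith) ENNReal.ofReal_ne_top
    rwa [ENNReal.toReal_ofReal (by linarith)] at this
  have hDt : Integrable fun t => ∫ x, ‖DU (x, t)‖ ^ p := by
    rw [Measure.volume_eq_prod] at hDp
    exact hDp.integral_prod_right
  have hconst : ∀ τ, IntegrableOn (fun _ : ℝ => volume.real Q) (Ioo 0 τ) := fun τ => by simp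
  have hdiss : ∀ τ, 0 < τ → τ ≤ T → c * (∫ t in Ioo 0 τ, ∫ x, ‖DU (x, t)‖ ^ p)
      ≤ (∫ t in Ioo 0 τ, power F U G DU t)
        + K * (volume.real Q * τ + 2 * (L * ∫ t in Ioo 0 τ, energy Q r U t)) := by
    intro τ hτ hτT
    have h1 : ∫ t in Ioo 0 τ, c * ∫ x, ‖DU (x, t)‖ ^ p ≤ ∫ t in Ioo 0 τ, (power F U G DU t
        + K * (volume.real Q + 2 * (L * energy Q r U t))) := by
      refine setIntegral_mono_ae_restrict (hDt.const_mul c).integrableOn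
        (hP.integrableOn.add (((hconst τ).add
          ((hy.const_mul L).const_mul 2).integrableOn).const_mul K)) ?_
      filter_upwards [ae_restrict_mem measurableSet_Ioo,
        ae_restrict_of_ae (h.ae_le_power hQ hN hp hK hr hL hrL)] with t ht hle
      exact hle ⟨ht.1, ht.2.trans_le hτT⟩
    have hi : IntegrableOn (fun t => K * (volume.real Q + 2 * (L * energy Q r U t))) (Ioo 0 τ) :=
      ((hconst τ).add ((hy.const_mul L).const_mul 2).integrableOn).const_mul K
    rw [integral_const_mul, integral_add hP.integrableOn hi, integral_const_mul,
      integral_add (hconst τ) ((hy.const_mul L).const_mul 2).integrableOn,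
      integral_const_mul, integral_const_mul] at h1
    have h2 : ∫ _ in Ioo 0 τ, volume.real Q = volume.real Q * τ := by
      simp [hτ.le, mul_comm]
    rwa [h2] at h1
  have hDnn : ∀ τ, 0 ≤ c * ∫ t in Ioo 0 τ, ∫ x, ‖DU (x, t)‖ ^ p := fun τ =>
    mul_nonneg hc.le (integral_nonneg fun t => integral_nonneg fun x => by positivity)
  have hgron : ∀ᵐ τ, τ ∈ Ioo 0 T → energy Q r U τ ≤ A + C * ∫ t in Ioo 0 τ, energy Q r U t := by
    filter_upwards [h.ae_energy_le hQ hN hp hT hr hL hrL hu₀] with τ hτ hτT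
    have h1 := hτ hτT
    have h2 := hdiss τ hτT.1 hτT.2.le
    have h3 := hDnn τ
    have h4 : 0 ≤ ∫ t in Ioo 0 τ, energy Q r U t :=
      integral_nonneg fun t => weightedInner_self_nonneg hL hrL
    have h5 : K * (volume.real Q * τ) ≤ K * (volume.real Q * T) := by
      have := hτT.2.le
      gcongr
    rw [hA, hC]
    linarith
  -- This bound depends on the solution and serves only to start the Gronwall iteration.
  obtain ⟨M₀, hM₀⟩ := h.bounded
  have hyS : ∀ᵐ t, t ∈ Ioo 0 T → energy Q r U t ≤ L * (M₀ : ℝ) ^ 2 := by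
    filter_upwards [hM₀, hU2] with t ht hUt htT
    refine (weightedInner_self_le hr hL hrL hUt).trans ?_
    gcongr
    exact integral_norm_sq_le hUt (ht htT)
  have hyY : ∀ᵐ t, t ∈ Ioo 0 T → energy Q r U t ≤ Y := by
    filter_upwards [ae_le_of_le_add_integral hA0 hC0 (by positivity) hy hyS hgron] with t ht htT
    refine (ht htT).trans ?_
    have := htT.2.le
    rw [hY]
    gcongr
  constructor
  · filter_upwards [hyY, hU2] with t ht hUt htT
    refine eLpNorm_two_le_of_integral_le hUt
      ((integral_sq_le_weightedInner hr hL hrL hUt).trans ?_)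
    have := ht htT
    unfold energy at this
    gcongr
  · have h1 := hdiss T hT le_rfl
    have h2 := h.integral_power_le hQ hN hp hT hr hL hrL hu₀
    have h3 : ∫ t in Ioo 0 T, energy Q r U t ≤ Y * T := by
      have : ∫ _ in Ioo 0 T, Y = Y * T := by simp [hT.le, mul_comm]
      rw [← this]
      refine setIntegral_mono_ae_restrict hy.integrableOn (by simp) ?_
      filter_upwards [ae_restrict_mem measurableSet_Ioo, ae_restrict_of_ae hyY] with t ht hle
      exact hle ht
    have h4 : K * (volume.real Q * T + 2 * (L * ∫ t in Ioo 0 T, energy Q r U t))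
        ≤ K * (volume.real Q * T + 2 * (L * (Y * T))) := by gcongr
    have h5 : ∫ t in Ioo 0 T, ∫ x, ‖DU (x, t)‖ ^ p = ∫ z, ‖DU z‖ ^ p := by
      have hz : ∀ t, t ∉ Ioo 0 T → ∫ x, ‖DU (x, t)‖ ^ p = 0 := fun t ht => by
        simp [EvolutionData.slice_eq_zero h.DU_zero ht, (by linarith : p ≠ 0)]
      rw [setIntegral_eq_integral_of_forall_compl_eq_zero hz]
      rw [Measure.volume_eq_prod] at hDp ⊢
      exact (integral_prod_symm _ hDp).symm
    have h6 : 0 ≤ L * E := by positivity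
    have h7 : ∫ z, ‖DU z‖ ^ p ≤ W / c := by
      rw [le_div_iff₀' hc, ← h5]
      rw [hW]
      linarith
    rw [ENNReal.le_rpow_inv_iff (by linarith), eLpNorm_rpow_eq_lintegral (by linarith)]
    refine le_trans (le_of_eq ?_) (ENNReal.ofReal_le_ofReal h7)
    rw [ofReal_integral_eq_lintegral_ofReal hDp (ae_of_all _ fun z => by positivity)]
    refine lintegral_congr fun z => ?_
    rw [← ENNReal.ofReal_rpow_of_nonneg (norm_nonneg _) (by linarith), ofReal_norm]

end IsEvolution

end UniformBound

/-! ### Translations in time and in space. -/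

section Equicontinuity

variable {N : ℕ} {Q : Set (Vec N)} {T p c K L : ℝ} {r : Vec N → ℝ} {u₀ : Vec N → Vec N}
  {U : Vec N × ℝ → Vec N} {DU : Vec N × ℝ → Grad N} {F : Vec N × ℝ → Vec N}
  {G : Vec N × ℝ → Grad N}

/-- The increment of `f` over a time step of length `η`. -/
def timeDiff {E : Type*} [Sub E] (η : ℝ) (f : Vec N × ℝ → E) (z : Vec N × ℝ) : E :=
  f z - f (z.1, z.2 - η)

theorem measurable_timeDiff {E : Type*} [NormedAddCommGroup E] [MeasurableSpace E] [BorelSpace E]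
    [SecondCountableTopology E] {f : Vec N × ℝ → E} (hf : Measurable f) (η : ℝ) :
    Measurable (timeDiff η f) :=
  hf.sub (hf.comp (by fun_prop))

theorem memLp_timeDiff {E : Type*} [NormedAddCommGroup E] [InnerProductSpace ℝ E]
    [MeasurableSpace E] [BorelSpace E] [SecondCountableTopology E] {f : Vec N × ℝ → E} {a : ℝ≥0∞}
    (hfa : MemLp f a volume) (η : ℝ) : MemLp (timeDiff η f) a volume :=
  hfa.sub (memLp_timeShift hfa η)

theorem eLpNorm_timeDiff_le {E : Type*} [NormedAddCommGroup E] [InnerProductSpace ℝ E]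
    [MeasurableSpace E] [BorelSpace E] [SecondCountableTopology E] {f : Vec N × ℝ → E} {a : ℝ≥0∞}
    (ha : 1 ≤ a) (hf : Measurable f) {B : ℝ≥0} (hB : eLpNorm f a volume ≤ B) (η : ℝ) :
    eLpNorm (timeDiff η f) a volume ≤ (2 * B : ℝ≥0) := by
  have hshift := (eLpNorm_timeShift (μ := (volume : Measure (Vec N))) (p := a) hf η)
  refine (eLpNorm_sub_le hf.aestronglyMeasurable
    (hf.comp (by fun_prop : Measurable fun z : Vec N × ℝ => (z.1, z.2 - η))).aestronglyMeasurable
    ha).trans ?_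
  rw [ENNReal.coe_mul, ENNReal.coe_ofNat, two_mul]
  exact add_le_add hB (hshift.le.trans hB)

namespace IsEvolution

/-- For `η < t < T` the increment of `U` is an element of `𝕍` and is tested with itself; the forces
on the right are averaged over shifts in `(0, η)` and contribute `O(η)`. The zero extension adds
jumps at times `0` and `T`, seen on two layers of length `η`, whence `2M²η`. -/
theorem eLpNorm_timeDiff_sq_le [IsFiniteMeasure (volume.restrict Q)] (hQ : MeasurableSet Q)
    (hN : N = 2 ∨ N = 3) (hp : critExp N ≤ p) (hr : Measurable r) (hL : 0 < L)
    (hrL : ∀ᵐ x, L⁻¹ ≤ r x ∧ r x ≤ L) (hu₀ : MemLp u₀ 2 (volume.restrict Q))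
    (h : IsEvolution Q T p c K r u₀ U DU F G) {M B D : ℝ≥0}
    (hM : ∀ᵐ t, t ∈ Ioo 0 T → eLpNorm (fun x => U (x, t)) 2 (volume.restrict Q) ≤ M)
    (hUB : eLpNorm U (ENNReal.ofReal (velExp N)) volume ≤ B)
    (hFB : eLpNorm F (ENNReal.ofReal (convExp N)) volume ≤ B)
    (hGB : eLpNorm G (ENNReal.ofReal (p / (p - 1))) volume ≤ B)
    (hDUD : eLpNorm DU (ENNReal.ofReal p) volume ≤ D) {η : ℝ} (hη : 0 ≤ η) (hηT : η < T) :
    eLpNorm (timeDiff η U) 2 volume ^ 2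
      ≤ ENNReal.ofReal ((L * (2 * B * B + 2 * B * D) + 2 * M ^ 2) * η) := by
  have hN0 : 0 < N := by omega
  have h2p : 2 ≤ p := (two_le_critExp (by omega)).trans hp
  have := holderConjugate_convExp_velExp hN0
  have := holderConjugate_ofReal h2p
  have hT : 0 < T := hη.trans_lt hηT
  obtain ⟨hUq, hFq, hGq⟩ := h.memLp_all hQ hN hp
  have hmU := measurable_timeDiff h.measurable_U η
  have hmD := measurable_timeDiff h.measurable_DU η
  have hdU := memLp_timeDiff hUq η
  have hdD := memLp_timeDiff h.memLp_DU η
  have hd2 := memLp_timeDiff (h.memLp_velocity_two hQ hN hp) η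
  have hiF := integrable_integral_pairing_timeShift (p := ENNReal.ofReal (convExp N))
      (q := ENNReal.ofReal (velExp N)) h.measurable_F hmU hFq hdU hη
  have hiG := integrable_integral_pairing_timeShift (p := ENNReal.ofReal (p / (p - 1)))
      (q := ENNReal.ofReal p) h.measurable_G hmD hGq hdD hη
  have hbF := abs_setIntegral_integral_pairing_timeShift_le (p := ENNReal.ofReal (convExp N))
    (q := ENNReal.ofReal (velExp N)) (I := Ioo η T) measurableSet_Ioo h.measurable_F hmU hFq hdU hη
    hFB (eLpNorm_timeDiff_le (by
      rw [ENNReal.one_le_ofReal]; exact one_le_two.trans (two_le_velExp hN0)) h.measurable_U hUB η)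
  have hbG := abs_setIntegral_integral_pairing_timeShift_le (p := ENNReal.ofReal (p / (p - 1)))
    (q := ENNReal.ofReal p) (I := Ioo η T) measurableSet_Ioo h.measurable_G hmD hGq hdD hη
    hGB (eLpNorm_timeDiff_le (by rw [ENNReal.one_le_ofReal]; linarith) h.measurable_DU hDUD η)
  have hsq : Integrable (fun z => ‖timeDiff η U z‖ ^ 2) (volume : Measure (Vec N × ℝ)) :=
    (memLp_two_iff_integrable_sq_norm hd2.1).1 hd2
  rw [← ofReal_integral_norm_sq hd2]
  refine ENNReal.ofReal_le_ofReal ?_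
  rw [Measure.volume_eq_prod] at hsq ⊢
  rw [integral_prod_symm _ hsq]
  set PF := fun t => ∫ s in (0 : ℝ)..η, pairing volume F (timeDiff η U) (t - s) t with hPF
  set PG := fun t => ∫ s in (0 : ℝ)..η, pairing volume G (timeDiff η DU) (t - s) t with hPG
  have hqmp := (measurePreserving_sub_right (volume : Measure ℝ) η).quasiMeasurePreserving
  have hUt2 := h.ae_memLp_two hN hp
  -- Interior times use the equation; in the layers at `0` and `T` only one of the two values is
  -- nonzero; elsewhere both vanish.
  have hslice : ∀ᵐ t, ∫ x, ‖timeDiff η U (x, t)‖ ^ 2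
      ≤ (Ioo η T).indicator (fun t => -L * (PF t + PG t)) t
        + ((Ioc 0 η).indicator (fun _ => (M : ℝ) ^ 2) t
          + (Ico T (T + η)).indicator (fun _ => (M : ℝ) ^ 2) t) := by
    filter_upwards [h.ae_increment hQ hN hp hT hr hL hrL hu₀ hη, hUt2, hqmp.ae hUt2, hM,
      hqmp.ae hM, h.memV, hqmp.ae h.memV] with t hinc hU2 hUs2 hMt hMs hV hVs
    have hoff : ∀ x, x ∉ Q → ‖timeDiff η U (x, t)‖ ^ 2 = 0 := fun x hx => by
      simp [timeDiff, h.U_zero (x, t) fun hc => hx hc.1, h.U_zero (x, t - η) fun hc => hx hc.1]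
    rw [← setIntegral_eq_integral_of_forall_compl_eq_zero hoff]
    by_cases h1 : t ∈ Ioo η T
    · have ht : t ∈ Ioo 0 T := ⟨hη.trans_lt h1.1, h1.2⟩
      have hs : t - η ∈ Ioo 0 T := ⟨sub_pos.2 h1.1, by linarith [h1.2]⟩
      have hv := (hV ht).sub (by linarith) (hVs hs)
      have h2 := (hinc ht).2 _ _ hv
      rw [history_of_pos hs.1] at h2
      have h3 := integral_sq_le_weightedInner hr hL hrL (hU2.sub hUs2)
      have h2' : weightedInner Q r ((fun x => U (x, t)) - fun x => U (x, t - η))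
          ((fun x => U (x, t)) - fun x => U (x, t - η)) = -(PF t + PG t) := h2
      rw [h2'] at h3
      have h4 : t ∉ Ioc 0 η := fun hc => absurd h1.1 hc.2.not_gt
      have h5 : t ∉ Ico T (T + η) := fun hc => absurd h1.2 hc.1.not_gt
      rw [indicator_of_mem h1, indicator_of_notMem h4, indicator_of_notMem h5, add_zero, add_zero,
        neg_mul, ← mul_neg]
      exact h3
    rw [indicator_of_notMem h1, zero_add]
    by_cases h2 : t ∈ Ioc 0 η
    · have ht : t ∈ Ioo 0 T := ⟨h2.1, h2.2.trans_lt hηT⟩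
      have hs : t - η ∉ Ioo 0 T := fun hc => absurd hc.1 (by linarith [h2.2])
      rw [indicator_of_mem h2]
      refine le_add_of_le_of_nonneg ?_ (indicator_nonneg (fun _ _ => by positivity) _)
      simp only [timeDiff, EvolutionData.slice_eq_zero h.U_zero hs, sub_zero]
      exact integral_norm_sq_le hU2 (hMt ht)
    rw [indicator_of_notMem h2, zero_add]
    by_cases h3 : t ∈ Ico T (T + η)
    · have ht : t ∉ Ioo 0 T := fun hc => absurd hc.2 h3.1.not_gt
      have hs : t - η ∈ Ioo 0 T := ⟨by linarith [h3.1], by linarith [h3.2]⟩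
      rw [indicator_of_mem h3]
      simp only [timeDiff, EvolutionData.slice_eq_zero h.U_zero ht, zero_sub, norm_neg]
      exact integral_norm_sq_le hUs2 (hMs hs)
    · have ht : t ∉ Ioo 0 T := fun hc => by
        rcases le_or_gt t η with h4 | h4
        · exact h2 ⟨hc.1, h4⟩
        · exact h1 ⟨h4, hc.2⟩
      have hs : t - η ∉ Ioo 0 T := fun hc => by
        rcases lt_or_ge t T with h4 | h4
        · exact h1 ⟨by linarith [hc.1], h4⟩
        · exact h3 ⟨h4, by linarith [hc.2]⟩
      rw [indicator_of_notMem h3]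
      simp [timeDiff, EvolutionData.slice_eq_zero h.U_zero ht,
        EvolutionData.slice_eq_zero h.U_zero hs]
  have hi1 : Integrable ((Ioo η T).indicator fun t => -L * (PF t + PG t)) :=
    ((hiF.add hiG).const_mul (-L)).indicator measurableSet_Ioo
  have hi2 : Integrable ((Ioc 0 η).indicator fun _ => (M : ℝ) ^ 2) :=
    (integrable_indicator_iff measurableSet_Ioc).2 (by simp)
  have hi3 : Integrable ((Ico T (T + η)).indicator fun _ => (M : ℝ) ^ 2) :=
    (integrable_indicator_iff measurableSet_Ico).2 (by simp)
  refine (integral_mono_ae hsq.integral_prod_right (hi1.add (hi2.add hi3)) hslice).trans ?_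
  have hsum := integral_add hi1 (hi2.add hi3)
  have hsum2 := integral_add hi2 hi3
  have e1 : ∫ t, (Ioo η T).indicator (fun t => -L * (PF t + PG t)) t
      = -L * ((∫ t in Ioo η T, PF t) + ∫ t in Ioo η T, PG t) := by
    rw [integral_indicator measurableSet_Ioo, integral_const_mul,
      integral_add hiF.integrableOn hiG.integrableOn]
  have e2 : ∫ t, (Ioc 0 η).indicator (fun _ => (M : ℝ) ^ 2) t = η * M ^ 2 := by
    rw [integral_indicator measurableSet_Ioc]; simp [hη]
  have e3 : ∫ t, (Ico T (T + η)).indicator (fun _ => (M : ℝ) ^ 2) t = η * M ^ 2 := by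
    rw [integral_indicator measurableSet_Ico]; simp [hη]
  have e4 : ∫ t, ((Ioo η T).indicator (fun t => -L * (PF t + PG t)) t
        + ((Ioc 0 η).indicator (fun _ => (M : ℝ) ^ 2) t
          + (Ico T (T + η)).indicator (fun _ => (M : ℝ) ^ 2) t))
      ≤ (L * (2 * B * B + 2 * B * D) + 2 * M ^ 2) * η := by
    refine hsum.trans_le ?_
    have hsum2' : ∫ t, ((Ioc 0 η).indicator (fun _ => (M : ℝ) ^ 2)
        + (Ico T (T + η)).indicator (fun _ => (M : ℝ) ^ 2)) t = η * M ^ 2 + η * M ^ 2 := by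
      rw [← e2]; nth_rewrite 2 [e2]; rw [← e3]; exact hsum2
    rw [e1, hsum2']
    have hF1 := (abs_le.1 hbF).1
    have hG1 := (abs_le.1 hbG).1
    push_cast at hF1 hG1
    have : L * -((∫ t in Ioo η T, PF t) + ∫ t in Ioo η T, PG t)
        ≤ L * (B * (2 * B) * η + B * (2 * D) * η) := by
      refine mul_le_mul_of_nonneg_left ?_ hL.le
      linarith
    linarith
  exact e4

end IsEvolution

/-- The translation estimate for zero extensions of elements of `𝕍`, integrated over the time
slices. -/
theorem EvolutionData.eLpNorm_spaceShift_le [IsFiniteMeasure (volume.restrict Q)]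
    (hQ : MeasurableSet Q) (hN : N = 2 ∨ N = 3) (hp : critExp N ≤ p)
    (h : EvolutionData Q T p c K U DU F G) (y : Vec N) :
    eLpNorm (fun z : Vec N × ℝ => U (z.1 + y, z.2) - U z) 2 volume
      ≤ ‖y‖ₑ * eLpNorm DU 2 volume := by
  have hm : Measurable fun z : Vec N × ℝ => U (z.1 + y, z.2) - U z :=
    (h.measurable_U.comp (by fun_prop)).sub h.measurable_U
  rw [← ENNReal.pow_le_pow_left_iff two_ne_zero, mul_pow, eLpNorm_two_sq, eLpNorm_two_sq,
    Measure.volume_eq_prod, lintegral_prod_symm' _ (hm.enorm.pow_const 2),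
    lintegral_prod_symm' _ (h.measurable_DU.enorm.pow_const 2),
    ← lintegral_const_mul' _ _ (by simp)]
  refine lintegral_mono_ae ?_
  filter_upwards [h.memV] with t hV
  by_cases ht : t ∈ Ioo 0 T
  · have h1 := (hV ht).eLpNorm_translate_sub_le hQ hN hp y
    have e : Q.indicator (fun x => U (x, t)) = fun x => U (x, t) :=
      indicator_eq_self.2 (support_slice h.U_zero t)
    rw [e, eLpNorm_restrict_eq_of_support_subset (support_slice h.DU_zero t)] at h1
    have h2 := pow_le_pow_left₀ zero_le h1 2
    rwa [mul_pow, eLpNorm_two_sq, eLpNorm_two_sq] at h2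
  · simp [slice_eq_zero h.U_zero ht]

end Equicontinuity

/-! ### Compactness of families of evolutions. -/

section Compactness

variable {N : ℕ}

theorem eLpNorm_timeDiff_neg {U : Vec N × ℝ → Vec N} (hU : Measurable U) (η : ℝ) :
    eLpNorm (timeDiff (-η) U) 2 volume = eLpNorm (timeDiff η U) 2 volume := by
  rw [Measure.volume_eq_prod, ← eLpNorm_timeShift (μ := (volume : Measure (Vec N))) (p := 2)
    (measurable_timeDiff hU (-η)) η, ← eLpNorm_neg]
  refine congrArg (fun f => eLpNorm f 2 (volume.prod volume)) (funext fun z => ?_)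
  simp [timeDiff]

theorem exists_forall_eLpNorm_shift_le {ι : Type*} {U : ι → Vec N × ℝ → Vec N}
    (hU : ∀ i, Measurable (U i)) {T C : ℝ} (hT : 0 < T) (hC : 0 ≤ C) {D : ℝ≥0}
    (htime : ∀ i η, 0 ≤ η → η < T →
      eLpNorm (timeDiff η (U i)) 2 volume ^ 2 ≤ ENNReal.ofReal (C * η))
    (hspace : ∀ i y, eLpNorm (fun z : Vec N × ℝ => U i (z.1 + y, z.2) - U i z) 2 volume
      ≤ ‖y‖ₑ * D) (κ : ℝ≥0∞) (hκ : κ ≠ 0) :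
    ∃ δ : ℝ, 0 < δ ∧ ∀ i, ∀ z : Vec N × ℝ, ‖z‖ < δ →
      eLpNorm (fun x => U i (x + z) - U i x) 2 volume ≤ κ := by
  obtain ⟨e, he0, heκ⟩ := ENNReal.lt_iff_exists_nnreal_btwn.1 (ENNReal.half_pos hκ)
  have he : (0 : ℝ) < e := by exact_mod_cast he0
  -- The time estimate is of order one half, hence `e ^ 2`; the space estimate is Lipschitz. The
  -- summands 1 avoid division by zero.
  refine ⟨min T (min (e ^ 2 / (C + 1)) (e / (D + 1))), by positivity, fun i z hz => ?_⟩
  obtain ⟨hz1, hz2⟩ := lt_min_iff.1 hz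
  obtain ⟨hz2, hz3⟩ := lt_min_iff.1 hz2
  have hy : ‖z.1‖ ≤ ‖z‖ := norm_fst_le z
  have hs : |z.2| ≤ ‖z‖ := norm_snd_le z
  have h1 : eLpNorm (fun x : Vec N × ℝ => U i (x.1 + z.1, x.2) - U i x) 2 volume ≤ e := by
    refine (hspace i z.1).trans ?_
    rw [← ofReal_norm, ← ENNReal.ofReal_coe_nnreal, ← ENNReal.ofReal_mul (norm_nonneg _),
      ← ENNReal.ofReal_coe_nnreal]
    refine ENNReal.ofReal_le_ofReal ?_
    have h2 : ‖z.1‖ * (D + 1) ≤ e := by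
      rw [← le_div_iff₀ (by positivity)]; exact hy.trans hz3.le
    nlinarith [norm_nonneg z.1]
  have h2 : eLpNorm (timeDiff z.2 (U i)) 2 volume ≤ e := by
    have habs : eLpNorm (timeDiff z.2 (U i)) 2 volume = eLpNorm (timeDiff |z.2| (U i)) 2 volume := by
      rcases abs_choice z.2 with h | h
      · rw [h]
      · rw [h, eLpNorm_timeDiff_neg (hU i)]
    rw [habs, ← ENNReal.pow_le_pow_left_iff two_ne_zero]
    refine (htime i _ (abs_nonneg _) (hs.trans_lt hz1)).trans ?_
    rw [← ENNReal.ofReal_coe_nnreal, ← ENNReal.ofReal_pow e.coe_nonneg]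
    refine ENNReal.ofReal_le_ofReal ?_
    have h2 : |z.2| * (C + 1) ≤ (e : ℝ) ^ 2 := by
      rw [← le_div_iff₀ (by positivity)]; exact hs.trans hz2.le
    nlinarith [abs_nonneg z.2]
  have hm : Measurable fun x : Vec N × ℝ => U i (x.1 + z.1, x.2) - U i x :=
    ((hU i).comp (by fun_prop)).sub (hU i)
  have h3 := eLpNorm_timeShift (μ := (volume : Measure (Vec N))) (p := 2) hm (-z.2)
  -- A space translation taken at the shifted time, which has the same norm as at the original time,
  -- followed by a time translation.
  have h4 : (fun x => U i (x + z) - U i x)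
      = (fun x : Vec N × ℝ => U i (x.1 + z.1, x.2 - -z.2) - U i (x.1, x.2 - -z.2))
        - timeDiff (-z.2) (U i) := by
    funext x
    simp only [timeDiff, sub_neg_eq_add, Pi.sub_apply]
    have : x + z = (x.1 + z.1, x.2 + z.2) := rfl
    rw [this]
    abel
  rw [h4]
  refine (eLpNorm_sub_le ?_ (measurable_timeDiff (hU i) _).aestronglyMeasurable one_le_two).trans
    ((add_le_add (h3.le.trans h1) ((eLpNorm_timeDiff_neg (hU i) z.2).le.trans h2)).trans ?_)
  · exact (hm.comp (by fun_prop :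
      Measurable fun x : Vec N × ℝ => (x.1, x.2 - -z.2))).aestronglyMeasurable
  · calc (e : ℝ≥0∞) + e ≤ κ / 2 + κ / 2 := add_le_add heκ.le heκ.le
      _ = κ := ENNReal.add_halves κ

/-- Evolutions with a common initial value, common bounds for the density, and common constants in
the growth and coercivity conditions form a relatively compact subset of `L²(Q_T)`. -/
theorem isCompact_closure_range_of_isEvolution {Q : Set (Vec N)}
    [IsFiniteMeasure (volume.restrict Q)] (hQ : MeasurableSet Q) (hQb : Bornology.IsBounded Q)
    (hN : N = 2 ∨ N = 3) {T p c K L : ℝ} (hp : critExp N ≤ p) (hT : 0 < T) (hc : 0 < c)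
    (hK : 0 ≤ K) (hL : 0 < L) {u₀ : Vec N → Vec N} (hu₀ : MemLp u₀ 2 (volume.restrict Q))
    {ι : Type*} {r : ι → Vec N → ℝ} {U : ι → Vec N × ℝ → Vec N} {DU : ι → Vec N × ℝ → Grad N}
    {F : ι → Vec N × ℝ → Vec N} {G : ι → Vec N × ℝ → Grad N} (hr : ∀ i, Measurable (r i))
    (hrL : ∀ i, ∀ᵐ x, L⁻¹ ≤ r i x ∧ r i x ≤ L)
    (h : ∀ i, IsEvolution Q T p c K (r i) u₀ (U i) (DU i) (F i) (G i))
    (hU2 : ∀ i, MemLp (U i) 2 (volume.restrict (cylinder Q T))) :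
    IsCompact (closure (range fun i => (hU2 i).toLp (U i))) := by
  have h2p : 2 ≤ p := (two_le_critExp (by omega)).trans hp
  have hN0 : 0 < N := by omega
  obtain ⟨M, D, hM, hD, hMD⟩ := IsEvolution.exists_uniform_bound hQ hN hp hT hc hK hL hu₀
  obtain ⟨B, hB, hbound⟩ := EvolutionData.exists_bound hQ hN hp T c K hM hD
  lift M to ℝ≥0 using hM
  lift D to ℝ≥0 using hD
  lift B to ℝ≥0 using hB
  have hVt : (volume : Measure (Vec N × ℝ)) (cylinder Q T) ≠ ⊤ := volume_cylinder_ne_top T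
  have hpow : ∀ {s : ℝ}, 2 ≤ s → volume (cylinder Q T)
      ^ (1 / (2 : ℝ≥0∞).toReal - 1 / (ENNReal.ofReal s).toReal) ≠ ⊤ := by
    intro s hs
    refine ENNReal.rpow_ne_top_of_nonneg ?_ hVt
    rw [ENNReal.toReal_ofReal (by linarith), sub_nonneg]
    exact one_div_le_one_div_of_le (by simp) (by simpa using hs)
  have h2s : ∀ {s : ℝ}, 2 ≤ s → (2 : ℝ≥0∞) ≤ ENNReal.ofReal s := fun hs => by
    rw [← ENNReal.ofReal_ofNat]; exact ENNReal.ofReal_le_ofReal hs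
  have hb := fun i => hbound _ _ _ _ (h i).toEvolutionData (hMD _ _ _ _ _ (hr i) (hrL i) (h i)).1
    (hMD _ _ _ _ _ (hr i) (hrL i) (h i)).2
  obtain ⟨D', hD'⟩ : ∃ D' : ℝ≥0, (D' : ℝ≥0∞) = D * volume (cylinder Q T)
      ^ (1 / (2 : ℝ≥0∞).toReal - 1 / (ENNReal.ofReal p).toReal) :=
    ⟨_, ENNReal.coe_toNNReal (ENNReal.mul_ne_top ENNReal.coe_ne_top (hpow h2p))⟩
  have : (volume : Measure (Vec N × ℝ)).IsAddHaarMeasure :=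
    inferInstanceAs ((volume : Measure (Vec N)).prod (volume : Measure ℝ)).IsAddHaarMeasure
  refine isCompact_closure_range_toLp volume (fun i => (h i).measurable_U)
    (R := B * volume (cylinder Q T)
      ^ (1 / (2 : ℝ≥0∞).toReal - 1 / (ENNReal.ofReal (velExp N)).toReal))
    (ENNReal.mul_ne_top ENNReal.coe_ne_top (hpow (two_le_velExp hN0))) (fun i => ?_)
    (hQb.prod (Metric.isBounded_Ioo 0 T)) (measurableSet_cylinder hQ T)
    (exists_forall_eLpNorm_shift_le (fun i => (h i).measurable_U) hT
      (C := L * (2 * B * B + 2 * B * D) + 2 * M ^ 2) (by positivity) (D := D')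
      (fun i η hη hηT => (h i).eLpNorm_timeDiff_sq_le hQ hN hp (hr i) hL (hrL i) hu₀
        (hMD _ _ _ _ _ (hr i) (hrL i) (h i)).1 (hb i).1 (hb i).2.1 (hb i).2.2
        (hMD _ _ _ _ _ (hr i) (hrL i) (h i)).2 hη hηT)
      fun i y => ((h i).eLpNorm_spaceShift_le hQ hN hp y).trans ?_) hU2
  · exact (eLpNorm_le_of_zero_off (h i).U_zero (h2s (two_le_velExp hN0))
      (h i).measurable_U.aestronglyMeasurable).trans (mul_le_mul_left (hb i).1 _)
  · rw [hD']
    gcongr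
    exact (eLpNorm_le_of_zero_off (h i).DU_zero (h2s h2p)
      (h i).measurable_DU.aestronglyMeasurable).trans
      (mul_le_mul_left (hMD _ _ _ _ _ (hr i) (hrL i) (h i)).2 _)

end Compactness

end Ladyzhenskaya

end

/-! ### The compactness theorem for the family of velocities. -/

theorem proposition2 (N : ℕ) (hN : N = 2 ∨ N = 3)
    (p : ℝ) (hp : 1 + 2 * (N : ℝ) / ((N : ℝ) + 2) ≤ p) (T : ℝ) (hT : 0 < T)
    (Q : Set (Ladyzhenskaya.Vec N)) (hQ : Ladyzhenskaya.IsBoundedSmoothDomain Q)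
    (ρ : Ladyzhenskaya.Vec N → ℝ) (hρ : Ladyzhenskaya.IsAdmissibleDensity ρ)
    (a : Ladyzhenskaya.Vec N × ℝ → Matrix (Fin N) (Fin N) ℝ)
    (ha : Ladyzhenskaya.IsAdmissibleMatrix a)
    (b : Ladyzhenskaya.Vec N × ℝ → ℝ) (hb : Ladyzhenskaya.IsAdmissibleViscosity b)
    (f : ℝ → Ladyzhenskaya.Vec N → Ladyzhenskaya.Vec N)
    (hf : Ladyzhenskaya.IsAdmissibleForce Q f)
    (u₀ : Ladyzhenskaya.Vec N → Ladyzhenskaya.Vec N) (hu₀ : Ladyzhenskaya.MemH Q u₀)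
    (u : ℝ → Ladyzhenskaya.Vec N × ℝ → Ladyzhenskaya.Vec N)
    (hu : ∀ ε : ℝ, 0 < ε → Ladyzhenskaya.IsVelocitySolution Q T p ρ a b f u₀ ε (u ε)) :
    ∃ h : ∀ ε : Set.Ioi (0 : ℝ),
        MemLp (u ε) 2 (volume.restrict (Ladyzhenskaya.cylinder Q T)),
      IsCompact (closure (Set.range fun ε : Set.Ioi (0 : ℝ) =>
        (h ε).toLp (u ε)))  := by
  have hQm : MeasurableSet Q := hQ.isOpen.measurableSet
  have : IsFiniteMeasure (volume.restrict Q) :=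
    ⟨by simpa using hQ.isBounded.measure_lt_top⟩
  have hp' : Ladyzhenskaya.critExp N ≤ p := by
    refine le_trans (le_of_eq ?_) hp
    unfold Ladyzhenskaya.critExp
    field_simp
    ring
  obtain ⟨L, hL, hρL⟩ := hρ.bounds
  obtain ⟨ν₀, hν₀, haν⟩ := ha.coercive
  obtain ⟨ν₁, ν₂, hν₁, hν₂, hbν⟩ := hb.bounds
  obtain ⟨k, hk, hf0, hfL⟩ := hf.lipschitz
  -- The sum of the essential suprema bounds all entries of the matrix at once.
  set A : ℝ := ∑ i, ∑ j, (eLpNorm (fun z => a z i j) ⊤ volume).toReal with hA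
  have hA0 : 0 ≤ A :=
    Finset.sum_nonneg fun i _ => Finset.sum_nonneg fun j _ => ENNReal.toReal_nonneg
  have haA : ∀ᵐ z, ∀ i j, ‖a z i j‖ ≤ A := by
    refine ae_all_iff.2 fun i => ae_all_iff.2 fun j => ?_
    have h1 : (eLpNorm (fun z => a z i j) ⊤ volume).toReal ≤ A :=
      (Finset.single_le_sum (f := fun j => (eLpNorm (fun z => a z i j) ⊤ volume).toReal)
        (fun j _ => ENNReal.toReal_nonneg) (Finset.mem_univ j)).trans
        (Finset.single_le_sum
          (f := fun i => ∑ j, (eLpNorm (fun z => a z i j) ⊤ volume).toReal)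
          (fun i _ => Finset.sum_nonneg fun j _ => ENNReal.toReal_nonneg) (Finset.mem_univ i))
    filter_upwards [ae_le_eLpNormEssSup (f := fun z => a z i j) (μ := volume)] with z hz
    rw [← eLpNorm_exponent_top] at hz
    refine le_trans ?_ h1
    rw [← toReal_enorm]
    exact ENNReal.toReal_mono (ha.memLp i j).2.ne hz
  have hex := fun ε : Set.Ioi (0 : ℝ) =>
    Ladyzhenskaya.IsVelocitySolution.exists_isEvolution hQm hN hp' hρ.memLp.1 hL hρL
      (fun i j => (ha.memLp i j).1) hA0 haA hν₀ haν hb.memLp.1 hν₁ hν₂ hbν hf.continuous hk hf0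
      hfL hu₀.1 ε.2 (hu ε ε.2)
  choose r U DU F G hr hrL hev huU using hex
  have hU2 : ∀ ε, MemLp (U ε) 2 (volume.restrict (Ladyzhenskaya.cylinder Q T)) := fun ε =>
    ((hev ε).memLp_velocity_two hQm hN hp').restrict _
  refine ⟨fun ε => (memLp_congr_ae (huU ε)).2 (hU2 ε), ?_⟩
  have hcompact := Ladyzhenskaya.isCompact_closure_range_of_isEvolution hQm hQ.isBounded hN hp' hT
    hν₁ (by positivity) hL hu₀.1 hr hrL hev hU2
  -- The chosen representatives define the same classes in `L²(Q_T)` as the given velocities.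
  convert hcompact using 4 with ε
  exact (MemLp.toLp_eq_toLp_iff _ _).2 (huU ε)
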